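/- **Notation.** Let $\mathbb T=\{z\in\mathbb C:|z|=1\}$, and for $f\in L^1(\mathbb T)$ let $[f]_n=f_n=\frac1{2\pi}\int_0^{2\pi}f(e^{i\theta})e^{-in\theta}\,d\theta$. For $N>1$ the bordered Toeplitz determinant $D^B_N[\phi;\psi]$ is the determinant of the $N\times N$ matrix whose entry in row $j$ and column $k$ ($0\le j,k\le N-1$) is $\phi_{k-j}$ if $k<N-1$ and $\psi_{N-1-j}$ if $k=N-1$. A function $\phi:\mathbb T\to\mathbb C$ is of *Szegő type* if it is nonzero on $\mathbb T$, has winding number zero, and admits an analytic continuation to a neighborhood of $\mathbb T$ (in particular it is smooth). For a function $\phi$ with a continuous logarithm $\log\phi$ on $\mathbb T$ put $$G[\phi]=\exp\big([\log\phi]_0\big),\qquad E[\phi]=\exp\Big(\sum_{n\ge1}n\,[\log\phi]_n[\log\phi]_{-n}\Big).$$ A *canonical Wiener–Hopf factorization* of $\phi$ is a representation $\phi=\phi_-\phi_+$ on $\mathbb T$ in which $\phi_\pm$ are nonvanishing continuous functions on $\mathbb T$ such that $[\phi_+]_n=[\phi_+^{-1}]_n=0$ for all $n<0$ and $[\phi_-]_n=[\phi_-^{-1}]_n=0$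 for all $n>0$. For such a factorization put $$F[\phi;\psi]=\frac{[\phi_-^{-1}\psi]_0}{[\phi_+]_0}.$$ **Theorem 1.2 (with Remark 1.3).** (a) Let $\phi$ be of Szegő type and let $\psi:\mathbb T\to\mathbb C$ admit an analytic continuation to a neighborhood of $\mathbb T$. Then $\phi$ has a continuous logarithm on $\mathbb T$, the series in $E[\phi]$ converges absolutely, and $\phi$ has a canonical Wiener–Hopf factorization. For every canonical Wiener–Hopf factorization $\phi=\phi_-\phi_+$ one has $[\phi_+]_0\ne0$, and there is a constant $\mathfrak c>0$ such that, as $N\to\infty$, $$D^B_N[\phi;\psi]=G[\phi]^N E[\phi]\left(F[\phi;\psi]+O(e^{-\mathfrak cN})\right).$$ (b) Let $\phi$ belong to the Hölder class $C^{1+\varepsilon}(\mathbb T)$ for some $0<\varepsilon\le1$ (that is, $t\mapsto\phi(e^{it})$ is continuously differentiable with Hölder continuous derivative of exponent $\varepsilon$), be nonzero on $\mathbb T$ and have winding number zero, and let $\psi\in L^2(\mathbb T)$. Then again $\phi$ has a continuous logarithm on $\mathbb T$, the series in $E[\phi]$ converges absolutely, $\phi$ has a canonical Wiener–Hopf factorization,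 and for every canonical Wiener–Hopf factorization $\phi=\phi_-\phi_+$ one has $[\phi_+]_0\ne0$ and, as $N\to\infty$, $$D^B_N[\phi;\psi]=G[\phi]^N E[\phi]\left(F[\phi;\psi]+o(1)\right).$$ -/

import Mathlib

open Filter Asymptotics

noncomputable section

namespace BorderedToeplitz

instance factTwoPiPos : Fact (0 < 2 * Real.pi) := ⟨Real.two_pi_pos⟩

/-- The `n`-th Fourier coefficient `(2π)⁻¹ ∫₀^{2π} f(e^{iθ}) e^{-inθ} dθ` of a function on the unit
circle (`AddCircle.toCircle` is `θ ↦ e^{iθ}` on `ℝ / 2πℤ`). -/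
def coeff (f : Circle → ℂ) (n : ℤ) : ℂ :=
  fourierCoeff (fun θ : AddCircle (2 * Real.pi) => f (AddCircle.toCircle θ)) n

/-- Square integrability on the unit circle with respect to normalized arc length. -/
def IsL2 (f : Circle → ℂ) : Prop :=
  MeasureTheory.MemLp (fun θ : AddCircle (2 * Real.pi) => f (AddCircle.toCircle θ)) 2
    AddCircle.haarAddCircle

/-- The `N × N` bordered Toeplitz determinant (meaningful for `1 ≤ N`). With rows and columns
numbered from `0`, the entry `(j, k)` is `φ_{k-j}` for `k < N - 1`, and `ψ_{N-1-j}` in the last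
column `k = N - 1`. -/
def borderedDet (φ ψ : Circle → ℂ) (N : ℕ) : ℂ :=
  Matrix.det (Matrix.of fun j k : Fin N =>
    if (k : ℕ) + 1 = N then coeff ψ ((N : ℤ) - 1 - (j : ℕ))
    else coeff φ (((k : ℕ) : ℤ) - ((j : ℕ) : ℤ)))

/-- `f` is the restriction to the unit circle of a function that is analytic in a neighborhood of
the circle. -/
def HasAnalyticContinuation (f : Circle → ℂ) : Prop :=
  ∃ g : ℂ → ℂ, AnalyticOnNhd ℂ g (Metric.sphere 0 1) ∧ ∀ z : Circle, g z = f z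

/-- The curve `t ↦ f(e^{it})`, `0 ≤ t ≤ 2π`, has winding number `w` around the origin: a continuous
argument along the curve has total increment `2πw`. It is used for continuous nonvanishing `f`. -/
def HasWindingNumber (f : Circle → ℂ) (w : ℤ) : Prop :=
  ∃ θ : ℝ → ℝ, ContinuousOn θ (Set.Icc 0 (2 * Real.pi)) ∧
    (∀ t ∈ Set.Icc (0 : ℝ) (2 * Real.pi),
      f (Circle.exp t) = (‖f (Circle.exp t)‖ : ℂ) * Complex.exp ((θ t : ℂ) * Complex.I)) ∧
    θ (2 * Real.pi) - θ 0 = 2 * Real.pi * w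

/-- Symbols of Szegő type: nonvanishing on the circle, of winding number zero, with an analytic
continuation to a neighborhood of the circle (so that they are smooth on the circle). -/
structure IsSzegoType (φ : Circle → ℂ) : Prop where
  ne_zero : ∀ z, φ z ≠ 0
  winding : HasWindingNumber φ 0
  analytic : HasAnalyticContinuation φ

/-- The Hölder class `C^{1+ε}` of the circle, `0 < ε ≤ 1`: `t ↦ f(e^{it})` is continuously
differentiable and its derivative is Hölder continuous of exponent `ε`. -/
def IsC1Holder (ε : NNReal) (f : Circle → ℂ) : Prop :=
  ContDiff ℝ 1 (fun t : ℝ => f (Circle.exp t)) ∧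
    ∃ C : NNReal, HolderWith C ε (deriv fun t : ℝ => f (Circle.exp t))

/-- `L` is a continuous logarithm of `f` on the circle. -/
def IsContinuousLog (f L : Circle → ℂ) : Prop :=
  Continuous L ∧ ∀ z, Complex.exp (L z) = f z

open Classical in
/-- The continuous logarithm of `f` on the circle, where there is one (two of them differ by a
constant in `2πiℤ`, which changes neither `szegoG` nor `szegoE`). -/
def contLog (f : Circle → ℂ) : Circle → ℂ :=
  if h : ∃ L, IsContinuousLog f L then h.choose else 0

/-- `G[φ] = exp [log φ]₀`. -/
def szegoG (φ : Circle → ℂ) : ℂ :=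
  Complex.exp (coeff (contLog φ) 0)

/-- The `n`-th term `n [log φ]_n [log φ]_{-n}` of the series in the exponent of `E[φ]`. -/
def szegoETerm (φ : Circle → ℂ) (n : ℕ) : ℂ :=
  (n : ℂ) * coeff (contLog φ) (n : ℤ) * coeff (contLog φ) (-(n : ℤ))

/-- `E[φ] = exp (∑_{n ≥ 1} n [log φ]_n [log φ]_{-n})`; the term with `n = 0` is zero. -/
def szegoE (φ : Circle → ℂ) : ℂ :=
  Complex.exp (∑' n : ℕ, szegoETerm φ n)

/-- `f` is continuous on the circle and belongs to the Hardy space `H^∞_+`. -/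
def InHardyPlus (f : Circle → ℂ) : Prop :=
  Continuous f ∧ ∀ n : ℤ, n < 0 → coeff f n = 0

/-- `f` is continuous on the circle and belongs to the Hardy space `H^∞_-`. -/
def InHardyMinus (f : Circle → ℂ) : Prop :=
  Continuous f ∧ ∀ n : ℤ, 0 < n → coeff f n = 0

/-- A continuous canonical Wiener–Hopf factorization `φ = φ₋ φ₊`: the functions `φ₊`, `φ₊⁻¹` are
continuous and in `H^∞_+`, and `φ₋`, `φ₋⁻¹` are continuous and in `H^∞_-`. -/
structure IsCanonicalWienerHopf (φ φm φp : Circle → ℂ) : Prop where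
  factor : ∀ z, φ z = φm z * φp z
  plus_ne_zero : ∀ z, φp z ≠ 0
  minus_ne_zero : ∀ z, φm z ≠ 0
  plus : InHardyPlus φp
  plus_inv : InHardyPlus fun z => (φp z)⁻¹
  minus : InHardyMinus φm
  minus_inv : InHardyMinus fun z => (φm z)⁻¹

/-- The constant `F[φ; ψ] = [φ₋⁻¹ ψ]₀ / [φ₊]₀`, in terms of the Wiener–Hopf factors of `φ`. -/
def constF (φm φp ψ : Circle → ℂ) : ℂ :=
  coeff (fun z => (φm z)⁻¹ * ψ z) 0 / coeff φp 0

end BorderedToeplitz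

end

/-! By winding number zero, `φ = G m p` on the circle with `G = szegoG φ`, `m = exp a`, `p = exp b`,
where `a` and `b` are the negatively and positively indexed parts of `log φ`. Everything happens in
a Wiener algebra with norm `∑ w(n) |f_n|` containing `log φ`. For analytic symbols the weight is `ρ
^ |n|`; for Hölder symbols it is `(1 + |n|) ^ (1/2 + ε/4)`. The essential condition is `∑ w(l)⁻² <
∞`: it makes the entries of the Hankel products `H(f) H(g~)` absolutely summable, so finite sections
obey bounds independent of `N`.

Bordered part. Reversing rows and columns and applying Cramer's rule, the bordered determinant is `G
^ (N-1)` times entry `0` of `adj T_N(mp)` applied to the vector `(ψ_j)`. Since `m⁻¹ · (m p) = p` is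
a plus function of mean one, the row vector `([m⁻¹]_{-j})_j` multiplies `T_N(mp)` to the first unit
row, up to a tail of size `1 / w(N)`. Thus the entry is `det T_N(mp) · ∑ [m⁻¹]_{-k} ψ_k + O(1 /
w(N))` (`exists_norm_adjugate_mulVec_sub_le`). Working with the adjugate avoids any invertibility of
`T_N(mp)`.

Strong Szegő limit `det T_N(mp) → E` (`tendsto_det_toep_cexp`). Toeplitz determinants are
asymptotically multiplicative in each factor (`tendsto_det_mul_plus`, `tendsto_det_mul_minus`),
hence `det T_N(mp)` is close to the `n²`-th power of the determinant for the roots `exp (a/n)`, `exp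
(b/n)`. For these small symbols the determinant is `1 + n⁻² tr H(b) H(a~) + O(n⁻³)` uniformly in `N`
(`exists_norm_det_sub_le`), and the `n²`-th power tends to the exponential of the trace, whose limit
is `∑ n b_n a_{-n}`.

Rate. Taking the first unit vector as border compares consecutive determinants: `det T_N - det
T_{N+1} = O(1 / w(N+1))`. With an exponential weight this makes the convergence to `E` exponentially
fast. Uniqueness of Wiener–Hopf factors up to a constant (`IsCanonicalWienerHopf.eq_const_mul`)
transfers the result to every factorization, because `constF` is unaffected by that constant. -/

open Filter Asymptotics

noncomputable section

namespace BorderedToeplitz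

/-! ### Fourier coefficients of functions on the circle. -/

section

open MeasureTheory AddCircle Topology
open scoped ENNReal NNReal

/-- Integrability on the unit circle with respect to normalized arc length. -/
def IntegrableOnCircle (f : Circle → ℂ) : Prop :=
  Integrable (fun θ : AddCircle (2 * Real.pi) => f (toCircle θ)) haarAddCircle

lemma continuous_comp_toCircle {f : Circle → ℂ} (hf : Continuous f) :
    Continuous fun θ : AddCircle (2 * Real.pi) => f (toCircle θ) :=
  hf.comp continuous_toCircle

lemma _root_.Continuous.integrableOnCircle {f : Circle → ℂ} (hf : Continuous f) :
    IntegrableOnCircle f :=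
  (continuous_comp_toCircle hf).integrable_of_hasCompactSupport
    (HasCompactSupport.of_compactSpace _)

lemma coeff_eq_integral (f : Circle → ℂ) (n : ℤ) :
    coeff f n = ∫ θ : AddCircle (2 * Real.pi),
      ((toCircle θ : Circle) : ℂ) ^ (-n) * f (toCircle θ) ∂haarAddCircle := by
  simp only [coeff, fourierCoeff, fourier_apply, smul_eq_mul, toCircle_zsmul, Circle.coe_zpow]

lemma norm_coeff_le_integral (f : Circle → ℂ) (n : ℤ) :
    ‖coeff f n‖ ≤ ∫ θ : AddCircle (2 * Real.pi), ‖f (toCircle θ)‖ ∂haarAddCircle := by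
  rw [coeff_eq_integral]
  refine (norm_integral_le_integral_norm _).trans (le_of_eq ?_)
  simp [Circle.norm_coe]

lemma norm_coeff_le {f : Circle → ℂ} {C : ℝ} (h : ∀ z, ‖f z‖ ≤ C) (n : ℤ) :
    ‖coeff f n‖ ≤ C := by
  rw [coeff_eq_integral]
  refine (norm_integral_le_of_norm_le_const (C := C) (Eventually.of_forall fun θ => ?_)).trans
    (by simp)
  simpa [Circle.norm_coe] using h _

lemma coeff_add {f g : Circle → ℂ} (hf : IntegrableOnCircle f) (hg : IntegrableOnCircle g) (n : ℤ) :
    coeff (fun z => f z + g z) n = coeff f n + coeff g n :=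
  congrFun (fourierCoeff.add hf hg) n

lemma coeff_const_mul (c : ℂ) (f : Circle → ℂ) (n : ℤ) :
    coeff (fun z => c * f z) n = c * coeff f n :=
  fourierCoeff.const_mul _ c n

/-- The `n`-th Fourier coefficient as a continuous linear functional. -/
def coeffL (n : ℤ) : C(Circle, ℂ) →L[ℂ] ℂ :=
  LinearMap.mkContinuous
    { toFun := fun f => coeff f n
      map_add' := fun f g => coeff_add f.continuous.integrableOnCircle g.continuous.integrableOnCircle n
      map_smul' := fun c f => coeff_const_mul c f n } 1
    fun f => by simpa using norm_coeff_le f.norm_coe_le_norm n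

/-- The sequence of Fourier coefficients of a continuous function on the circle. -/
def cf (f : C(Circle, ℂ)) (n : ℤ) : ℂ := coeff f n

@[simp] lemma coeffL_apply (n : ℤ) (f : C(Circle, ℂ)) : coeffL n f = cf f n := rfl

lemma cf_def (f : C(Circle, ℂ)) (n : ℤ) : cf f n = coeff f n := rfl

lemma cf_sub (f g : C(Circle, ℂ)) (n : ℤ) : cf (f - g) n = cf f n - cf g n :=
  map_sub (coeffL n) f g

lemma cf_smul (c : ℂ) (f : C(Circle, ℂ)) (n : ℤ) : cf (c • f) n = c * cf f n :=
  map_smul (coeffL n) c f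

/-- The monomial `z ↦ z ^ n` on the circle. -/
def mono (n : ℤ) : C(Circle, ℂ) := ⟨fun z => (z : ℂ) ^ n,
  continuous_iff_continuousAt.2 fun z =>
    (continuousAt_zpow₀ _ _ (Or.inl (Circle.coe_ne_zero z))).comp
      continuous_subtype_val.continuousAt⟩

@[simp] lemma mono_apply (n : ℤ) (z : Circle) : mono n z = (z : ℂ) ^ n := rfl

lemma norm_mono (n : ℤ) : ‖mono n‖ = 1 := by
  refine le_antisymm ((ContinuousMap.norm_le _ zero_le_one).2 fun z => by simp [Circle.norm_coe]) ?_
  simpa using (mono n).norm_coe_le_norm 1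

lemma cf_mono (m n : ℤ) : cf (mono m) n = if n = m then 1 else 0 := by
  have : (fun θ : AddCircle (2 * Real.pi) => mono m (toCircle θ)) = fourier m := by
    ext θ; simp [fourier_apply, toCircle_zsmul]
  rw [cf, coeff, this, fourierCoeff_fourier, Pi.single_apply]

lemma cf_one (n : ℤ) : cf 1 n = if n = 0 then 1 else 0 := by
  rw [← cf_mono]; congr 1

lemma hasSum_coeff {f : Circle → ℂ} (hf : Continuous f) (hs : Summable (coeff f)) (z : Circle) :
    HasSum (fun n => coeff f n * (z : ℂ) ^ n) (f z) := by
  obtain ⟨θ, rfl⟩ : ∃ θ : AddCircle (2 * Real.pi), toCircle θ = z := by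
    obtain ⟨θ, h⟩ := (homeomorphCircle (T := 2 * Real.pi) (by positivity)).surjective z
    exact ⟨θ, by rw [← h, homeomorphCircle_apply]⟩
  have := has_pointwise_sum_fourier_series_of_summable
    (f := ⟨fun θ : AddCircle (2 * Real.pi) => f (toCircle θ), continuous_comp_toCircle hf⟩) hs θ
  simpa [fourier_apply, toCircle_zsmul, coeff] using this

lemma eq_const_of_coeff_eq_zero {f : Circle → ℂ} (hf : Continuous f)
    (h : ∀ n, n ≠ 0 → coeff f n = 0) (z : Circle) : f z = coeff f 0 := by
  have hs : Summable (coeff f) := summable_of_ne_finset_zero (s := {0}) fun n hn => h n (by simpa using hn)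
  refine (hasSum_coeff hf hs z).unique ?_
  convert hasSum_single (f := fun n => coeff f n * (z : ℂ) ^ n) 0 fun n hn => by simp [h n hn]
  simp

/-- The Fourier coefficients of a product are the convolution of the Fourier coefficients. -/
lemma hasSum_coeff_mul {f g : Circle → ℂ} (hf : Continuous f) (hs : Summable (coeff f))
    (hg : IntegrableOnCircle g) (n : ℤ) :
    HasSum (fun k => coeff f k * coeff g (n - k)) (coeff (fun z => f z * g z) n) := by
  have hi : ∀ m : ℤ, Integrable (fun θ : AddCircle (2 * Real.pi) =>
      ((toCircle θ : Circle) : ℂ) ^ (-m) * g (toCircle θ)) haarAddCircle := fun m => by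
    simpa only [fourier_apply, toCircle_zsmul, Circle.coe_zpow, smul_eq_mul] using
      Integrable.fourier_smul hg (-m)
  have key := hasSum_integral_of_summable_integral_norm
    (μ := haarAddCircle (T := 2 * Real.pi))
    (F := fun (k : ℤ) θ => coeff f k * (((toCircle θ : Circle) : ℂ) ^ (-(n - k)) * g (toCircle θ)))
    (fun k => (hi (n - k)).const_mul _) (by
      simp only [norm_mul, norm_zpow, Circle.norm_coe, one_zpow, one_mul]
      simp_rw [integral_const_mul]
      exact hs.norm.mul_right _)
  simp_rw [integral_const_mul, ← coeff_eq_integral] at key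
  suffices h : coeff (fun z => f z * g z) n = _ by rw [h]; exact key
  rw [coeff_eq_integral]
  refine integral_congr_ae (Eventually.of_forall fun θ => ?_)
  have := ((hasSum_coeff hf hs (toCircle θ)).mul_right
    (((toCircle θ : Circle) : ℂ) ^ (-n) * g (toCircle θ))).tsum_eq
  simp only
  rw [mul_left_comm, ← this]
  refine tsum_congr fun k => ?_
  rw [neg_sub, sub_eq_add_neg, zpow_add₀ (Circle.coe_ne_zero _)]
  ring

/-- The continuous function with a prescribed absolutely summable sequence of Fourier
coefficients. -/
def ofCoeff (a : ℤ → ℂ) : C(Circle, ℂ) := ∑' n, a n • mono n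

lemma hasSum_ofCoeff {a : ℤ → ℂ} (ha : Summable a) : HasSum (fun n => a n • mono n) (ofCoeff a) :=
  (Summable.of_norm (by simpa [norm_smul, norm_mono] using ha.norm)).hasSum

lemma cf_ofCoeff {a : ℤ → ℂ} (ha : Summable a) (n : ℤ) : cf (ofCoeff a) n = a n := by
  have := (hasSum_ofCoeff ha).mapL (coeffL n)
  refine this.unique ?_
  convert hasSum_single (f := fun b => coeffL n (a b • mono b)) n fun m hm => ?_
  · simp [cf_mono]
  · simp [cf_mono, hm.symm]

/-- The reflection `z ↦ f z⁻¹`. -/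
def reflect (f : C(Circle, ℂ)) : C(Circle, ℂ) := f.comp ⟨fun z => z⁻¹, continuous_inv⟩

lemma reflect_apply (f : C(Circle, ℂ)) (z : Circle) : reflect f z = f z⁻¹ := rfl

lemma reflect_mul (f g : C(Circle, ℂ)) : reflect (f * g) = reflect f * reflect g := rfl

lemma reflect_one : reflect 1 = 1 := rfl

lemma cf_reflect (f : C(Circle, ℂ)) (n : ℤ) : cf (reflect f) n = cf f (-n) := by
  rw [cf, cf, coeff_eq_integral, coeff_eq_integral,
    ← integral_neg_eq_self _ (haarAddCircle (T := 2 * Real.pi))]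
  refine integral_congr_ae (Eventually.of_forall fun θ => ?_)
  simp [reflect_apply, toCircle_neg]

end

/-! ### Weighted Wiener algebras and exponentials in them. -/

section

open MeasureTheory AddCircle Topology
open scoped ENNReal NNReal Nat

/-- Submultiplicative even weights on `ℤ`, nondecreasing in `|n|`, that grow faster than
`|n| ^ (1 / 2)` in the sense that `∑ w(l)⁻²` converges. -/
structure IsWeight (w : ℤ → ℝ≥0) : Prop where
  zero : w 0 = 1
  mono : ∀ m n : ℤ, m.natAbs ≤ n.natAbs → w m ≤ w n
  add_le : ∀ m n : ℤ, w (m + n) ≤ w m * w n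
  summable : Summable fun l : ℕ => ((w l)⁻¹) ^ 2

/-- The norm `∑ w(n) |f_n|` of the weighted Wiener algebra. -/
def wnorm (w : ℤ → ℝ≥0) (f : C(Circle, ℂ)) : ℝ≥0∞ := ∑' n : ℤ, (w n : ℝ≥0∞) * ‖cf f n‖ₑ

variable {w : ℤ → ℝ≥0} {f g : C(Circle, ℂ)}

lemma IsWeight.one_le (hw : IsWeight w) (n : ℤ) : 1 ≤ w n := hw.zero ▸ hw.mono 0 n (by simp)

lemma IsWeight.neg (hw : IsWeight w) (n : ℤ) : w (-n) = w n :=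
  le_antisymm (hw.mono _ _ (by simp)) (hw.mono _ _ (by simp))

lemma IsWeight.tendsto_inv (hw : IsWeight w) :
    Tendsto (fun N : ℕ => ((w N : ℝ))⁻¹) atTop (𝓝 0) := by
  have h : Tendsto (fun N : ℕ => (((w N)⁻¹ ^ 2 : ℝ≥0) : ℝ)) atTop (𝓝 ((0 : ℝ≥0) : ℝ)) :=
    NNReal.tendsto_coe.2 (NNReal.tendsto_atTop_zero_of_summable hw.summable)
  refine ((Real.continuous_sqrt.tendsto' _ 0 (by simp)).comp h).congr fun N => ?_
  simp [Real.sqrt_sq]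

lemma tsum_enorm_cf_le (hw : IsWeight w) (f : C(Circle, ℂ)) :
    ∑' n : ℤ, ‖cf f n‖ₑ ≤ wnorm w f :=
  ENNReal.tsum_le_tsum fun n => le_mul_of_one_le_left zero_le (by exact_mod_cast hw.one_le n)

lemma summable_cf (hw : IsWeight w) (hf : wnorm w f ≠ ⊤) : Summable (cf f) :=
  Summable.of_norm (by
    simpa [ENNReal.tsum_coe_ne_top_iff_summable, enorm, ← NNReal.summable_coe] using
      ne_top_of_le_ne_top hf (tsum_enorm_cf_le hw f))

lemma hasSum_cf_mul (hw : IsWeight w) (hf : wnorm w f ≠ ⊤) (n : ℤ) :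
    HasSum (fun k => cf f k * cf g (n - k)) (cf (f * g) n) :=
  hasSum_coeff_mul f.continuous (summable_cf hw hf) g.continuous.integrableOnCircle n

/-- No summability is assumed: where absolute summability fails the right side is `⊤`. -/
lemma enorm_tsum_le {ι : Type*} (a : ι → ℂ) : ‖∑' i, a i‖ₑ ≤ ∑' i, ‖a i‖ₑ := by
  by_cases h : Summable fun i => ‖a i‖
  · have := norm_tsum_le_tsum_norm h
    rw [← ofReal_norm]
    refine (ENNReal.ofReal_le_ofReal this).trans ?_
    rw [ENNReal.ofReal_tsum_of_nonneg (fun _ => norm_nonneg _) h]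
    simp [ofReal_norm]
  · have : ∑' i, ‖a i‖ₑ = ⊤ := by
      by_contra h'
      exact h (by simpa [ENNReal.tsum_coe_ne_top_iff_summable, enorm, ← NNReal.summable_coe] using h')
    simp [this]

lemma wnorm_mul_le (hw : IsWeight w) (hf : wnorm w f ≠ ⊤) :
    wnorm w (f * g) ≤ wnorm w f * wnorm w g := by
  calc wnorm w (f * g)
      ≤ ∑' n, ∑' k, ((w k : ℝ≥0∞) * ‖cf f k‖ₑ) * ((w (n - k) : ℝ≥0∞) * ‖cf g (n - k)‖ₑ) := by
        refine ENNReal.tsum_le_tsum fun n => ?_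
        rw [← (hasSum_cf_mul hw hf n).tsum_eq]
        refine (mul_le_mul_right (enorm_tsum_le _) _).trans ?_
        rw [← ENNReal.tsum_mul_left]
        refine ENNReal.tsum_le_tsum fun k => ?_
        rw [enorm_mul, mul_mul_mul_comm]
        gcongr
        have := hw.add_le k (n - k)
        rw [add_sub_cancel] at this
        exact_mod_cast this
    _ = wnorm w f * wnorm w g := by
        rw [ENNReal.tsum_comm, wnorm, ← ENNReal.tsum_mul_right]
        refine tsum_congr fun k => ?_
        rw [ENNReal.tsum_mul_left, wnorm,
          ← (Equiv.subRight k).tsum_eq fun m : ℤ => (w m : ℝ≥0∞) * ‖cf g m‖ₑ]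
        rfl

lemma wnorm_smul (c : ℂ) : wnorm w (c • f) = ‖c‖ₑ * wnorm w f := by
  rw [wnorm, wnorm, ← ENNReal.tsum_mul_left]
  refine tsum_congr fun n => ?_
  rw [cf_smul, enorm_mul, mul_left_comm]

lemma wnorm_one (hw : IsWeight w) : wnorm w 1 = 1 := by
  rw [wnorm, tsum_eq_single 0 fun n hn => by simp [cf_one, hn]]
  simp [cf_one, hw.zero]

lemma wnorm_reflect (hw : IsWeight w) : wnorm w (reflect f) = wnorm w f := by
  rw [wnorm, wnorm, ← (Equiv.neg ℤ).tsum_eq fun n : ℤ => (w n : ℝ≥0∞) * ‖cf f n‖ₑ]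
  simp [cf_reflect, hw.neg]

lemma wnorm_pow_le (hw : IsWeight w) (hf : wnorm w f ≠ ⊤) (k : ℕ) :
    wnorm w (f ^ k) ≤ wnorm w f ^ k := by
  induction k with
  | zero => simp [wnorm_one hw]
  | succ k ih =>
    rw [pow_succ', pow_succ']
    exact (wnorm_mul_le hw hf).trans (by gcongr)

/-- Uniform convergence suffices because each Fourier coefficient is continuous in the sup norm.
This takes the place of completeness of the weighted algebra when power series are estimated. -/
lemma wnorm_le_of_hasSum {ι : Type*} {u : ι → C(Circle, ℂ)} (h : HasSum u f) :
    wnorm w f ≤ ∑' i, wnorm w (u i) := by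
  simp only [wnorm]
  rw [ENNReal.tsum_comm]
  refine ENNReal.tsum_le_tsum fun n => ?_
  rw [ENNReal.tsum_mul_left]
  gcongr
  have h1 := (h.mapL (coeffL n)).tsum_eq
  simp only [coeffL_apply] at h1
  rw [← h1]
  exact enorm_tsum_le _

/-- The pointwise exponential of a continuous function on the circle. -/
def cexp (f : C(Circle, ℂ)) : C(Circle, ℂ) := ⟨fun z => Complex.exp (f z), by fun_prop⟩

@[simp] lemma cexp_apply (z : Circle) : cexp f z = Complex.exp (f z) := rfl

lemma cexp_add : cexp (f + g) = cexp f * cexp g := by ext; simp [Complex.exp_add]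

lemma cexp_zero : cexp 0 = 1 := by ext; simp

lemma cexp_mul_cexp_neg : cexp f * cexp (-f) = 1 := by rw [← cexp_add, add_neg_cancel, cexp_zero]

lemma hasSum_cexp (f : C(Circle, ℂ)) : HasSum (fun k : ℕ => ((k ! : ℂ)⁻¹) • f ^ k) (cexp f) := by
  have h := NormedSpace.exp_series_hasSum_exp' (𝕂 := ℂ) f
  suffices h' : cexp f = NormedSpace.exp f by rwa [h']
  ext z
  have h1 := ContinuousLinearMap.hasSum (ContinuousMap.evalCLM ℂ z) h
  have h2 := NormedSpace.exp_series_hasSum_exp' (𝕂 := ℂ) (f z)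
  rw [← Complex.exp_eq_exp_ℂ] at h2
  exact h2.unique (by simpa using h1)

/-- A bound for the exponential of a small multiple of `f` in the weighted Wiener algebra. -/
def expBound (w : ℤ → ℝ≥0) (f : C(Circle, ℂ)) : ℝ≥0∞ := ∑' k : ℕ, (k ! : ℝ≥0∞)⁻¹ * wnorm w f ^ k

lemma expBound_ne_top (hf : wnorm w f ≠ ⊤) : expBound w f ≠ ⊤ := by
  lift wnorm w f to ℝ≥0 using hf with x hx
  have h := Real.summable_pow_div_factorial x
  have : expBound w f = ∑' k : ℕ, ((x ^ k / k ! : ℝ≥0) : ℝ≥0∞) := by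
    refine tsum_congr fun k => ?_
    rw [← hx, ENNReal.coe_div (by positivity), ENNReal.div_eq_inv_mul]
    simp
  rw [this, ENNReal.tsum_coe_ne_top_iff_summable, ← NNReal.summable_coe]
  simpa using h

lemma wnorm_smul_pow_le (hw : IsWeight w) (hf : wnorm w f ≠ ⊤) {s : ℝ} (hs : 0 ≤ s) (k : ℕ) :
    wnorm w (((k ! : ℂ)⁻¹) • ((s : ℂ) • f) ^ k) ≤
      (k ! : ℝ≥0∞)⁻¹ * (ENNReal.ofReal s ^ k * wnorm w f ^ k) := by
  rw [smul_pow, wnorm_smul, wnorm_smul]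
  gcongr
  · rw [enorm_inv (by exact_mod_cast k.factorial_ne_zero)]
    simp [enorm]
  · rw [enorm_pow]
    gcongr
    rw [← ofReal_norm]
    simp [abs_of_nonneg hs]
  · exact wnorm_pow_le hw hf k

/-- For `s ≤ 1` each term of degree at least `r` in the exponential series carries a factor at most
`s ^ r`. The cases `r = 0, 1, 2` are the ones used. -/
lemma wnorm_cexp_sub_sum_le (hw : IsWeight w) (hf : wnorm w f ≠ ⊤) {s : ℝ} (hs : 0 ≤ s)
    (hs1 : s ≤ 1) (r : ℕ) :
    wnorm w (cexp ((s : ℂ) • f) - ∑ k ∈ Finset.range r, ((k ! : ℂ)⁻¹) • ((s : ℂ) • f) ^ k) ≤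
      ENNReal.ofReal (s ^ r) * expBound w f := by
  have h := (hasSum_nat_add_iff' r).2 (hasSum_cexp ((s : ℂ) • f))
  refine (wnorm_le_of_hasSum h).trans ?_
  calc _ ≤ ∑' k : ℕ, ENNReal.ofReal (s ^ r) *
        (((k + r)! : ℝ≥0∞)⁻¹ * wnorm w f ^ (k + r)) := by
        refine ENNReal.tsum_le_tsum fun k => (wnorm_smul_pow_le hw hf hs _).trans ?_
        rw [mul_left_comm]
        gcongr
        rw [← ENNReal.ofReal_pow hs]
        exact ENNReal.ofReal_le_ofReal (pow_le_pow_of_le_one hs hs1 (by omega))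
    _ ≤ _ := by
        rw [ENNReal.tsum_mul_left]
        gcongr
        exact ENNReal.tsum_comp_le_tsum_of_injective (add_left_injective r)
          fun k : ℕ => (k ! : ℝ≥0∞)⁻¹ * wnorm w f ^ k

lemma wnorm_cexp_le (hw : IsWeight w) (hf : wnorm w f ≠ ⊤) {s : ℝ} (hs : 0 ≤ s) (hs1 : s ≤ 1) :
    wnorm w (cexp ((s : ℂ) • f)) ≤ expBound w f := by
  simpa using wnorm_cexp_sub_sum_le hw hf hs hs1 0

lemma wnorm_cexp_sub_one_le (hw : IsWeight w) (hf : wnorm w f ≠ ⊤) {s : ℝ} (hs : 0 ≤ s)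
    (hs1 : s ≤ 1) : wnorm w (cexp ((s : ℂ) • f) - 1) ≤ ENNReal.ofReal s * expBound w f := by
  simpa using wnorm_cexp_sub_sum_le hw hf hs hs1 1

lemma wnorm_cexp_sub_one_sub_le (hw : IsWeight w) (hf : wnorm w f ≠ ⊤) {s : ℝ} (hs : 0 ≤ s)
    (hs1 : s ≤ 1) :
    wnorm w (cexp ((s : ℂ) • f) - 1 - (s : ℂ) • f) ≤ ENNReal.ofReal (s ^ 2) * expBound w f := by
  simpa [Finset.sum_range_succ, sub_sub] using wnorm_cexp_sub_sum_le hw hf hs hs1 2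

lemma wnorm_cexp_ne_top (hw : IsWeight w) (hf : wnorm w f ≠ ⊤) : wnorm w (cexp f) ≠ ⊤ := by
  have := wnorm_cexp_le hw hf zero_le_one le_rfl
  simp only [Complex.ofReal_one, one_smul] at this
  exact ne_top_of_le_ne_top (expBound_ne_top hf) this

lemma wnorm_neg : wnorm w (-f) = wnorm w f := by
  rw [← neg_one_smul ℂ f, wnorm_smul]; simp

/-- The negatively indexed Fourier coefficients vanish. -/
def IsPlus (f : C(Circle, ℂ)) : Prop := ∀ n < 0, cf f n = 0

/-- The Fourier coefficients with nonpositive index vanish. -/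
def IsStrictPlus (f : C(Circle, ℂ)) : Prop := ∀ n ≤ 0, cf f n = 0

lemma IsStrictPlus.isPlus (h : IsStrictPlus f) : IsPlus f := fun n hn => h n hn.le

lemma IsPlus.one : IsPlus 1 := fun n hn => by simp [cf_one, hn.ne]

lemma IsPlus.mul (hw : IsWeight w) (hfw : wnorm w f ≠ ⊤) (hf : IsPlus f) (hg : IsPlus g) :
    IsPlus (f * g) := fun n hn => by
  refine (hasSum_cf_mul hw hfw n).unique ?_
  convert hasSum_zero with k
  rcases lt_or_ge k 0 with hk | hk
  · rw [hf k hk, zero_mul]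
  · rw [hg (n - k) (by omega), mul_zero]

lemma IsPlus.mul_strict (hw : IsWeight w) (hfw : wnorm w f ≠ ⊤) (hf : IsPlus f)
    (hg : IsStrictPlus g) : IsStrictPlus (f * g) := fun n hn => by
  refine (hasSum_cf_mul hw hfw n).unique ?_
  convert hasSum_zero with k
  rcases lt_or_ge k 0 with hk | hk
  · rw [hf k hk, zero_mul]
  · rw [hg (n - k) (by omega), mul_zero]

lemma IsPlus.cf_mul_zero (hw : IsWeight w) (hfw : wnorm w f ≠ ⊤) (hf : IsPlus f)
    (hg : IsPlus g) : cf (f * g) 0 = cf f 0 * cf g 0 := by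
  refine (hasSum_cf_mul hw hfw 0).unique ?_
  refine hasSum_single (f := fun k => cf f k * cf g (0 - k)) 0 fun k hk => ?_
  rcases lt_or_gt_of_ne hk with hk | hk
  · rw [hf k hk, zero_mul]
  · rw [hg (0 - k) (by omega), mul_zero]

lemma IsPlus.pow (hw : IsWeight w) (hfw : wnorm w f ≠ ⊤) (hf : IsPlus f) (k : ℕ) :
    IsPlus (f ^ k) := by
  induction k with
  | zero => simpa using IsPlus.one
  | succ k ih => rw [pow_succ']; exact hf.mul hw hfw ih

lemma cf_cexp (f : C(Circle, ℂ)) (n : ℤ) :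
    HasSum (fun k : ℕ => ((k ! : ℂ)⁻¹) * cf (f ^ k) n) (cf (cexp f) n) := by
  have := (hasSum_cexp f).mapL (coeffL n)
  simp only [map_smul, smul_eq_mul] at this
  exact this

lemma IsStrictPlus.cexp_isPlus (hw : IsWeight w) (hfw : wnorm w f ≠ ⊤) (hf : IsStrictPlus f) :
    IsPlus (cexp f) := fun n hn => by
  refine (cf_cexp f n).unique ?_
  convert hasSum_zero with k
  rw [hf.isPlus.pow hw hfw k n hn, mul_zero]

/-- All positive powers of `f` are strictly plus, so only the constant term of the exponential
series contributes to the mean. -/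
lemma IsStrictPlus.cf_cexp_zero (hw : IsWeight w) (hfw : wnorm w f ≠ ⊤) (hf : IsStrictPlus f) :
    cf (cexp f) 0 = 1 := by
  refine (cf_cexp f 0).unique ?_
  convert hasSum_single (f := fun k : ℕ => ((k ! : ℂ)⁻¹) * cf (f ^ k) 0) 0 fun k hk => ?_
  · simp [cf_one]
  · obtain ⟨k, rfl⟩ := Nat.exists_eq_succ_of_ne_zero hk
    rw [pow_succ, (hf.isPlus.pow hw hfw k).mul_strict hw
      (ne_top_of_le_ne_top (ENNReal.pow_ne_top hfw) (wnorm_pow_le hw hfw k)) hf 0 le_rfl, mul_zero]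

end

/-! ### Determinant and adjugate estimates independent of the matrix size. -/

section FiniteMatrices

open scoped Matrix

variable {ι : Type*} [Fintype ι] {X Y A : Matrix ι ι ℂ}

/-- The sum of the absolute values of the entries of a matrix. -/
def entrySum (X : Matrix ι ι ℂ) : ℝ := ∑ j, ∑ i, ‖X i j‖

lemma entrySum_nonneg (X : Matrix ι ι ℂ) : 0 ≤ entrySum X := by
  unfold entrySum; positivity

lemma entrySum_comm (X : Matrix ι ι ℂ) : entrySum X = ∑ i, ∑ j, ‖X i j‖ := Finset.sum_comm

lemma entrySum_add_le (X Y : Matrix ι ι ℂ) : entrySum (X + Y) ≤ entrySum X + entrySum Y := by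
  simp only [entrySum, ← Finset.sum_add_distrib, Matrix.add_apply]
  gcongr; exact norm_add_le _ _

lemma entrySum_smul (c : ℂ) (X : Matrix ι ι ℂ) : entrySum (c • X) = ‖c‖ * entrySum X := by
  simp [entrySum, Finset.mul_sum]

lemma entrySum_neg (X : Matrix ι ι ℂ) : entrySum (-X) = entrySum X := by simp [entrySum]

lemma entrySum_mul_left {C : ℝ} (hA : ∀ j, ∑ i, ‖A i j‖ ≤ C) (X : Matrix ι ι ℂ) :
    entrySum (A * X) ≤ C * entrySum X := by
  rw [entrySum, entrySum, Finset.mul_sum]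
  refine Finset.sum_le_sum fun j _ => ?_
  calc ∑ i, ‖(A * X) i j‖ ≤ ∑ i, ∑ k, ‖A i k‖ * ‖X k j‖ := by
        gcongr with i
        rw [Matrix.mul_apply]
        exact (norm_sum_le _ _).trans (by simp)
    _ = ∑ k, (∑ i, ‖A i k‖) * ‖X k j‖ := by
        rw [Finset.sum_comm]; simp [Finset.sum_mul]
    _ ≤ _ := by
        rw [Finset.mul_sum]
        gcongr with k
        exact hA k

lemma entrySum_transpose (X : Matrix ι ι ℂ) : entrySum Xᵀ = entrySum X := by
  rw [entrySum_comm]; rfl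

lemma entrySum_mul_right {C : ℝ} (hA : ∀ i, ∑ j, ‖A i j‖ ≤ C) (X : Matrix ι ι ℂ) :
    entrySum (X * A) ≤ C * entrySum X := by
  rw [← entrySum_transpose, Matrix.transpose_mul, ← entrySum_transpose X]
  exact entrySum_mul_left (by simpa using hA) _

lemma entrySum_mul_le (X Y : Matrix ι ι ℂ) : entrySum (X * Y) ≤ entrySum X * entrySum Y := by
  refine entrySum_mul_left (fun j => ?_) Y
  have h0 : ∀ j ∈ Finset.univ, 0 ≤ ∑ i, ‖X i j‖ := fun j _ => by positivity
  exact Finset.single_le_sum h0 (Finset.mem_univ j)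

lemma eq_zero_of_entrySum_eq_zero (h : entrySum X = 0) : X = 0 := by
  ext i j
  have h1 := (Finset.sum_eq_zero_iff_of_nonneg fun j _ => by positivity).1 h j (Finset.mem_univ j)
  simpa using (Finset.sum_eq_zero_iff_of_nonneg fun _ _ => norm_nonneg _).1 h1 i
    (Finset.mem_univ i)

lemma norm_trace_le (X : Matrix ι ι ℂ) : ‖X.trace‖ ≤ entrySum X := by
  refine (norm_sum_le _ _).trans (Finset.sum_le_sum fun j _ => ?_)
  exact Finset.single_le_sum (f := fun i => ‖X i j‖) (fun _ _ => norm_nonneg _) (Finset.mem_univ j)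

lemma norm_mulVec_le {C S : ℝ} (hA : ∀ i, ∑ j, ‖A i j‖ ≤ C) {v : ι → ℂ} (hS : 0 ≤ S)
    (hv : ∀ j, ‖v j‖ ≤ S) (i : ι) : ‖(A *ᵥ v) i‖ ≤ C * S := by
  calc ‖(A *ᵥ v) i‖ ≤ ∑ j, ‖A i j‖ * ‖v j‖ := by
        refine (norm_sum_le _ _).trans (by simp)
    _ ≤ ∑ j, ‖A i j‖ * S := by gcongr with j; exact hv j
    _ ≤ _ := by rw [← Finset.sum_mul]; gcongr; exact hA i

variable [DecidableEq ι]

/-- Expanding the product of column sums gives a sum over all maps `ι → ι`; the Leibniz formula uses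
only those that are permutations. -/
lemma norm_det_le_prod (M : Matrix ι ι ℂ) : ‖M.det‖ ≤ ∏ j, ∑ i, ‖M i j‖ := by
  rw [Matrix.det_apply, Finset.prod_univ_sum, Fintype.piFinset_univ]
  refine (norm_sum_le _ _).trans ?_
  calc ∑ σ : Equiv.Perm ι, ‖Equiv.Perm.sign σ • ∏ i, M (σ i) i‖
      = ∑ σ : Equiv.Perm ι, (fun p : ι → ι => ∏ i, ‖M (p i) i‖) σ := by
        refine Finset.sum_congr rfl fun σ _ => ?_
        rcases Int.units_eq_one_or (Equiv.Perm.sign σ) with h | h <;> simp [h]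
    _ = ∑ p ∈ Finset.univ.map ⟨fun σ : Equiv.Perm ι => (σ : ι → ι), DFunLike.coe_injective⟩,
          ∏ i, ‖M (p i) i‖ := by
        rw [Finset.sum_map]; rfl
    _ ≤ _ := Finset.sum_le_sum_of_subset_of_nonneg (Finset.subset_univ _)
        fun _ _ _ => by positivity

lemma sum_norm_one_add_le (X : Matrix ι ι ℂ) (j : ι) :
    ∑ i, ‖(1 + X) i j‖ ≤ 1 + ∑ i, ‖X i j‖ := by
  calc ∑ i, ‖(1 + X) i j‖ ≤ ∑ i, (‖(1 : Matrix ι ι ℂ) i j‖ + ‖X i j‖) := by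
        gcongr; exact norm_add_le _ _
    _ = _ := by
        rw [Finset.sum_add_distrib]
        simp [Matrix.one_apply, apply_ite norm]

lemma norm_det_one_add_le (X : Matrix ι ι ℂ) : ‖(1 + X).det‖ ≤ Real.exp (entrySum X) := by
  refine (norm_det_le_prod _).trans ?_
  rw [entrySum, Real.exp_sum]
  refine Finset.prod_le_prod (fun _ _ => by positivity) fun j _ => ?_
  refine (sum_norm_one_add_le X j).trans ?_
  linarith [Real.add_one_le_exp (∑ i, ‖X i j‖)]

lemma differentiable_det_line (X Y : Matrix ι ι ℂ) :
    Differentiable ℂ fun t : ℂ => (1 + (X + t • Y)).det := by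
  simp only [Matrix.det_apply, Matrix.add_apply, Matrix.smul_apply]
  fun_prop

/-- With `d = entrySum (X - Y)`, the entire function `t ↦ det (1 + Y + t (X - Y))` is bounded by
`exp (B + 1)` on the disc of radius `1 / d`. The Schwarz lemma compares its values at `0` and `1`.
For `d ≥ 1` the triangle inequality is enough. -/
lemma norm_det_one_add_sub_le {B : ℝ} (hX : entrySum X ≤ B) (hY : entrySum Y ≤ B) :
    ‖(1 + X).det - (1 + Y).det‖ ≤ 2 * Real.exp (B + 1) * entrySum (X - Y) := by
  set d := entrySum (X - Y) with hd
  have hd0 : 0 ≤ d := entrySum_nonneg _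
  have hB : Real.exp B < Real.exp (B + 1) := Real.exp_lt_exp.2 (by linarith)
  have hbX := (norm_det_one_add_le X).trans (Real.exp_le_exp.2 hX)
  have hbY := (norm_det_one_add_le Y).trans (Real.exp_le_exp.2 hY)
  rcases le_or_gt 1 d with h1 | h1
  · have := norm_sub_le (1 + X).det (1 + Y).det
    nlinarith [Real.exp_pos (B + 1)]
  rcases hd0.eq_or_lt with h0 | h0
  · have : X - Y = 0 := eq_zero_of_entrySum_eq_zero (hd ▸ h0.symm)
    rw [← h0, sub_eq_zero.1 this]; simp
  · have hmaps : Set.MapsTo (fun t : ℂ => (1 + (Y + t • (X - Y))).det) (Metric.ball 0 d⁻¹)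
        (Metric.closedBall ((1 + (Y + (0 : ℂ) • (X - Y))).det) (2 * Real.exp (B + 1))) := by
      intro t ht
      have ht' : ‖t‖ * d ≤ 1 := by
        rw [mem_ball_zero_iff] at ht
        calc ‖t‖ * d ≤ d⁻¹ * d := by gcongr
          _ = 1 := inv_mul_cancel₀ h0.ne'
      have h2 : entrySum (Y + t • (X - Y)) ≤ B + 1 := by
        refine (entrySum_add_le _ _).trans ?_
        rw [entrySum_smul]
        linarith
      have h3 := (norm_det_one_add_le (Y + t • (X - Y))).trans (Real.exp_le_exp.2 h2)
      rw [mem_closedBall_iff_norm]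
      simp only [zero_smul, add_zero]
      refine (norm_sub_le _ _).trans ?_
      linarith
    have := Complex.dist_le_div_mul_dist_of_mapsTo_ball
      (differentiable_det_line Y (X - Y)).differentiableOn hmaps (z := 1)
      (mem_ball_zero_iff.2 (by simpa using (one_lt_inv₀ h0).2 h1))
    simpa [dist_eq_norm] using this

/-- The remainder of `det (1 + r X)` after its linear part is `r² q(r)` with `q` a polynomial. On
`|r| = 1 / entrySum X` the determinant is at most `e` and the linear part at most `2`; the maximum
principle carries the resulting bound on `q` to `r = 1`. -/
lemma norm_det_one_add_sub_one_sub_trace_le (hX : entrySum X ≤ 1) :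
    ‖(1 + X).det - 1 - X.trace‖ ≤ (Real.exp 1 + 2) * entrySum X ^ 2 := by
  set d := entrySum X with hd
  have hd0 : 0 ≤ d := entrySum_nonneg _
  rcases hd0.eq_or_lt with h0 | h0
  · have : ‖(1 + X).det - (1 + 0 : Matrix ι ι ℂ).det‖ ≤ _ :=
      norm_det_one_add_sub_le (B := 0) (by rw [← hd, ← h0]) (by simp [entrySum])
    rw [sub_zero, ← hd, ← h0, mul_zero, norm_le_zero_iff] at this
    have h2 := norm_trace_le X
    rw [← hd, ← h0, norm_le_zero_iff] at h2
    rw [← h0, h2]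
    simp at this
    simp [this]
  obtain ⟨q, hq⟩ : ∃ q : Polynomial ℂ, ∀ r : ℂ, (1 + r • X).det =
    1 + X.trace * r + q.eval r * r ^ 2 := ⟨_, fun r => Matrix.det_one_add_smul r X⟩
  have h1 : ‖q.eval 1‖ ≤ (Real.exp 1 + 2) * d ^ 2 := by
    refine Complex.norm_le_of_forall_mem_frontier_norm_le (U := Metric.ball 0 d⁻¹)
      (f := fun r => q.eval r) Metric.isBounded_ball q.differentiable.diffContOnCl ?_ ?_
    · intro r hr
      rw [frontier_ball _ (by positivity), mem_sphere_zero_iff_norm] at hr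
      have h2 := norm_det_one_add_le (r • X)
      rw [entrySum_smul, hr, ← hd, inv_mul_cancel₀ h0.ne'] at h2
      have h3 : q.eval r * r ^ 2 = (1 + r • X).det - 1 - X.trace * r := by rw [hq]; ring
      have h4 : ‖q.eval r‖ * (d⁻¹) ^ 2 ≤ Real.exp 1 + 2 := by
        rw [← hr, ← norm_pow, ← norm_mul, h3]
        refine (norm_sub_le _ _).trans ?_
        have h5 := norm_sub_le (1 + r • X).det 1
        have h6 : ‖X.trace * r‖ ≤ 1 := by
          rw [norm_mul, hr]
          calc _ ≤ d * d⁻¹ := by gcongr; exact norm_trace_le X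
            _ = 1 := mul_inv_cancel₀ h0.ne'
        simp only [norm_one] at h5
        linarith
      have h7 := mul_le_mul_of_nonneg_right h4 (sq_nonneg d)
      rwa [mul_assoc, ← mul_pow, inv_mul_cancel₀ h0.ne', one_pow, mul_one] at h7
    · rw [closure_ball _ (by positivity)]
      simpa using (one_le_inv₀ h0).2 hX
  have h2 := hq 1
  rw [one_smul] at h2
  rw [h2]
  convert h1 using 2
  ring

/-- The adjugate entry is the determinant after row `j` is replaced by the unit row at `i`. If `i ≠
j`, column `j` loses its diagonal `1` and so contributes a factor `∑ l, ‖X l j‖`, while column `i`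
gains a `1`, whence the factor `2`. Keeping the column sum is what makes row sums of the adjugate
bounded independently of the size. -/
lemma norm_adjugate_one_add_le (X : Matrix ι ι ℂ) (i j : ι) :
    ‖(1 + X).adjugate i j‖ ≤
      ((if i = j then 1 else 0) + 2 * ∑ l, ‖X l j‖) * Real.exp (entrySum X) := by
  set M := (1 + X).updateRow j (Pi.single i 1) with hM
  rw [Matrix.adjugate_apply]
  have hcol : ∀ k, k ≠ i → ∑ l, ‖M l k‖ ≤ (if k = j then 0 else 1) + ∑ l, ‖X l k‖ := by
    intro k hk
    calc ∑ l, ‖M l k‖ ≤ ∑ l, ((if l = k then (if k = j then 0 else 1) else 0) + ‖X l k‖) := by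
          refine Finset.sum_le_sum fun l _ => ?_
          rw [hM, Matrix.updateRow_apply]
          by_cases hl : l = j
          · simp only [hl, if_true, Pi.single_apply, hk, if_false, norm_zero]
            positivity
          · rw [if_neg hl, Matrix.add_apply, Matrix.one_apply]
            refine (norm_add_le _ _).trans ?_
            gcongr
            by_cases hlk : l = k
            · subst hlk; simp [hl]
            · simp [hlk]
      _ = _ := by rw [Finset.sum_add_distrib]; simp
  have hcoli : ∑ l, ‖M l i‖ ≤ (if i = j then 1 else 2) + ∑ l, ‖X l i‖ := by
    calc ∑ l, ‖M l i‖ ≤ ∑ l, ((if l = j then 1 else 0) +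
          (if l = i then (if i = j then 0 else 1) else 0) + ‖X l i‖) := by
          refine Finset.sum_le_sum fun l _ => ?_
          rw [hM, Matrix.updateRow_apply]
          by_cases hl : l = j
          · simp only [hl, if_true, Pi.single_eq_same, norm_one]
            have : (0 : ℝ) ≤ if j = i then (if i = j then 0 else 1) else 0 := by positivity
            linarith [norm_nonneg (X j i)]
          · rw [if_neg hl, Matrix.add_apply, Matrix.one_apply, if_neg hl, zero_add]
            refine (norm_add_le _ _).trans ?_
            gcongr
            by_cases hli : l = i
            · subst hli; simp [hl]
            · simp [hli]
      _ = _ := by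
          rw [Finset.sum_add_distrib, Finset.sum_add_distrib]
          split_ifs <;> simp <;> norm_num
  have hexp : ∀ x : ℝ, 1 + x ≤ Real.exp x := fun x => by linarith [Real.add_one_le_exp x]
  refine (norm_det_le_prod M).trans ?_
  by_cases hij : i = j
  · subst hij
    calc ∏ k, ∑ l, ‖M l k‖ ≤ ∏ k, Real.exp (∑ l, ‖X l k‖) := by
          refine Finset.prod_le_prod (fun _ _ => by positivity) fun k _ => ?_
          refine le_trans ?_ (hexp _)
          by_cases hk : k = i
          · subst hk; simpa using hcoli
          · simpa [hk] using hcol k hk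
      _ = Real.exp (entrySum X) := by rw [entrySum, Real.exp_sum]
      _ ≤ _ := le_mul_of_one_le_left (Real.exp_pos _).le (by
          have : 0 ≤ ∑ l, ‖X l i‖ := by positivity
          simp [this])
  · calc ∏ k, ∑ l, ‖M l k‖ ≤ ∏ k, ((if k = i then 2 else 1) *
          (if k = j then ∑ l, ‖X l j‖ else 1) * Real.exp (∑ l, ‖X l k‖)) := by
          refine Finset.prod_le_prod (fun _ _ => by positivity) fun k _ => ?_
          have h0 : 0 ≤ ∑ l, ‖X l k‖ := by positivity
          have h1 := hexp (∑ l, ‖X l k‖)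
          by_cases hk : k = i
          · subst hk
            rw [if_neg hij] at hcoli
            simp only [if_true, if_neg hij]
            linarith
          · by_cases hkj : k = j
            · subst hkj
              have := hcol k hk
              simp only [hk, if_true, if_false, zero_add, one_mul] at this ⊢
              nlinarith
            · have := hcol k hk
              simp only [hk, hkj, if_false, one_mul] at this ⊢
              linarith
      _ = _ := by
          rw [Finset.prod_mul_distrib, Finset.prod_mul_distrib, entrySum, Real.exp_sum]
          simp [hij]

lemma sum_norm_adjugate_one_add_le {B : ℝ} (hX : entrySum X ≤ B) (i : ι) :
    ∑ j, ‖(1 + X).adjugate i j‖ ≤ (1 + 2 * B) * Real.exp B := by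
  calc ∑ j, ‖(1 + X).adjugate i j‖
      ≤ ∑ j, ((if i = j then 1 else 0) + 2 * ∑ l, ‖X l j‖) * Real.exp (entrySum X) :=
        Finset.sum_le_sum fun j _ => norm_adjugate_one_add_le X i j
    _ = (1 + 2 * entrySum X) * Real.exp (entrySum X) := by
        rw [← Finset.sum_mul, Finset.sum_add_distrib, ← Finset.mul_sum]
        simp [entrySum]
    _ ≤ _ := by
        have := entrySum_nonneg X
        have : 0 ≤ 1 + 2 * B := by linarith
        gcongr

end FiniteMatrices

/-! ### Finite Toeplitz matrices and products of Hankel operators. -/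

section

open Topology
open scoped Matrix ENNReal NNReal

variable {w : ℤ → ℝ≥0} {f g h : C(Circle, ℂ)} {N : ℕ}

/-- The finite Toeplitz matrix `(f_{j-k})`. -/
def toep (f : C(Circle, ℂ)) (N : ℕ) : Matrix (Fin N) (Fin N) ℂ :=
  Matrix.of fun j k => cf f ((j : ℤ) - (k : ℤ))

lemma toep_apply (j k : Fin N) : toep f N j k = cf f ((j : ℤ) - (k : ℤ)) := rfl

/-- The entries of the product `H(f) H(g~)` of two Hankel operators. -/
def hank (f g : C(Circle, ℂ)) (j k : ℕ) : ℂ :=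
  ∑' l : ℕ, cf f (j + l + 1) * cf g (-(k + l + 1))

/-- The finite section of the product `H(f) H(g~)` of two Hankel operators. -/
def hankM (f g : C(Circle, ℂ)) (N : ℕ) : Matrix (Fin N) (Fin N) ℂ :=
  Matrix.of fun j k => hank f g j k

/-- The positively indexed Fourier coefficients vanish. -/
def IsMinus (f : C(Circle, ℂ)) : Prop := ∀ n > 0, cf f n = 0

lemma IsPlus.reflect (hf : IsPlus f) : IsMinus (reflect f) := fun n hn => by
  rw [cf_reflect]; exact hf _ (by omega)

lemma IsMinus.reflect (hf : IsMinus f) : IsPlus (reflect f) := fun n hn => by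
  rw [cf_reflect]; exact hf _ (by omega)

lemma reflect_reflect (f : C(Circle, ℂ)) : reflect (reflect f) = f := by
  ext z; simp [reflect_apply]

lemma toep_reflect : toep (reflect f) N = (toep f N)ᵀ := by
  ext j k
  rw [Matrix.transpose_apply, toep_apply, toep_apply, cf_reflect, neg_sub]

lemma toep_one : toep 1 N = 1 := by
  ext j k
  rw [toep_apply, cf_one, Matrix.one_apply]
  congr 1
  rw [sub_eq_zero, Nat.cast_inj, Fin.val_inj]

lemma sum_norm_cf_le (hw : IsWeight w) (hf : wnorm w f ≠ ⊤) {ι : Type*} [Fintype ι] {e : ι → ℤ}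
    (he : Function.Injective e) : ∑ i, ‖cf f (e i)‖ ≤ (wnorm w f).toReal := by
  rw [← ENNReal.ofReal_le_iff_le_toReal hf, ENNReal.ofReal_sum_of_nonneg fun _ _ => norm_nonneg _]
  simp only [ofReal_norm]
  calc ∑ i, ‖cf f (e i)‖ₑ = ∑' i, ‖cf f (e i)‖ₑ := (tsum_fintype _).symm
    _ ≤ ∑' n, ‖cf f n‖ₑ := ENNReal.tsum_comp_le_tsum_of_injective he fun n => ‖cf f n‖ₑ
    _ ≤ _ := tsum_enorm_cf_le hw f

lemma sum_row_toep_le (hw : IsWeight w) (hf : wnorm w f ≠ ⊤) (j : Fin N) :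
    ∑ k, ‖toep f N j k‖ ≤ (wnorm w f).toReal :=
  sum_norm_cf_le hw hf fun a b hab => by
    simp only [sub_right_inj, Nat.cast_inj, Fin.val_inj] at hab
    exact hab

lemma sum_col_toep_le (hw : IsWeight w) (hf : wnorm w f ≠ ⊤) (k : Fin N) :
    ∑ j, ‖toep f N j k‖ ≤ (wnorm w f).toReal :=
  sum_norm_cf_le hw hf fun a b hab => by
    simp only [sub_left_inj, Nat.cast_inj, Fin.val_inj] at hab
    exact hab

/-- The product formula `T(fg) = T(f) T(g) + H(f) H(g~)`, entrywise. -/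
lemma cf_mul_eq_tsum_add_hank (hw : IsWeight w) (hf : wnorm w f ≠ ⊤) (j k : ℕ) :
    cf (f * g) ((j : ℤ) - k) = ∑' i : ℕ, cf f ((j : ℤ) - i) * cf g ((i : ℤ) - k) + hank f g j k := by
  have h := (Equiv.subLeft (j : ℤ)).hasSum_iff.2 (hasSum_cf_mul (g := g) hw hf ((j : ℤ) - k))
  have hs := h.summable
  -- The convolution is split by the sign of the intermediate index: nonnegative indices give the
  -- Toeplitz product, negative ones `-(l + 1)` the Hankel product.
  rw [← h.tsum_eq, tsum_of_nat_of_neg_add_one (hs.comp_injective Nat.cast_injective)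
    (hs.comp_injective (i := fun n : ℕ => -((n : ℤ) + 1)) fun a b hab => by simpa using hab)]
  simp only [Function.comp_def, Equiv.subLeft_apply, hank]
  congr 1
  · refine tsum_congr fun i => ?_
    congr 2; ring
  · refine tsum_congr fun i => ?_
    congr 2 <;> ring

lemma hank_eq_zero_of_isPlus (hg : IsPlus g) (j k : ℕ) : hank f g j k = 0 := by
  simp only [hank]
  convert tsum_zero with l
  rw [hg _ (by omega), mul_zero]

lemma hank_eq_zero_of_isMinus (hf : IsMinus f) (j k : ℕ) : hank f g j k = 0 := by
  simp only [hank]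
  convert tsum_zero with l
  rw [hf _ (by omega), zero_mul]

/-- With this triangularity the intermediate indices `i ≥ N` contribute nothing, so truncation
commutes with the product. -/
lemma toep_mul (hw : IsWeight w) (hfw : wnorm w f ≠ ⊤) (h : IsPlus f ∨ IsMinus g) :
    toep (f * g) N = toep f N * toep g N + hankM f g N := by
  ext j k
  rw [toep_apply, cf_mul_eq_tsum_add_hank hw hfw, Matrix.add_apply, Matrix.mul_apply]
  congr 1
  rw [tsum_eq_sum (s := Finset.range N), Finset.sum_range]
  · rfl
  · intro i hi
    have h1 := j.2
    have h2 := k.2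
    rw [Finset.mem_range] at hi
    rcases h with h | h
    · rw [h _ (by omega), zero_mul]
    · rw [h _ (by omega), mul_zero]

lemma IsPlus.toep_mul (hw : IsWeight w) (hfw : wnorm w f ≠ ⊤) (hf : IsPlus f) (hg : IsPlus g) :
    toep (f * g) N = toep f N * toep g N := by
  rw [BorderedToeplitz.toep_mul hw hfw (Or.inl hf), add_eq_left]
  ext j k
  exact hank_eq_zero_of_isPlus hg _ _

lemma IsMinus.toep_mul (hw : IsWeight w) (hfw : wnorm w f ≠ ⊤) (hf : IsMinus f)
    (hg : IsMinus g) : toep (f * g) N = toep f N * toep g N := by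
  rw [BorderedToeplitz.toep_mul hw hfw (Or.inr hg), add_eq_left]
  ext j k
  exact hank_eq_zero_of_isMinus hf _ _

lemma IsPlus.det_toep (hf : IsPlus f) (h0 : cf f 0 = 1) : (toep f N).det = 1 := by
  rw [Matrix.det_of_isLowerTriangular _ fun j k hjk => ?_]
  · simp [toep_apply, h0]
  · rw [toep_apply]
    exact hf _ (by have : (j : Fin N) < k := hjk; omega)

lemma IsMinus.det_toep (hf : IsMinus f) (h0 : cf f 0 = 1) : (toep f N).det = 1 := by
  rw [← Matrix.det_transpose, ← toep_reflect]
  exact hf.reflect.det_toep (by rw [cf_reflect, neg_zero, h0])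

/-- The sum of `w(l)⁻²`. -/
def weightSum (w : ℤ → ℝ≥0) : ℝ≥0∞ := ∑' l : ℕ, (((w l)⁻¹ ^ 2 : ℝ≥0) : ℝ≥0∞)

lemma weightSum_ne_top (hw : IsWeight w) : weightSum w ≠ ⊤ :=
  ENNReal.tsum_coe_ne_top_iff_summable.2 hw.summable

/-- Coefficients with `|n| ≥ N` are weighted by at least `w(N)`; this is the source of every factor
`1 / w(N)`. -/
lemma tsum_enorm_tail_le (hw : IsWeight w) (f : C(Circle, ℂ)) (N : ℕ) {e : ℕ → ℤ}
    (he : Function.Injective e) (hN : ∀ j, N ≤ (e j).natAbs) :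
    ∑' j, ‖cf f (e j)‖ₑ ≤ ((w N)⁻¹ : ℝ≥0) * wnorm w f := by
  have h1 : ∀ n : ℤ, w n ≠ 0 := fun n => (zero_lt_one.trans_le (hw.one_le n)).ne'
  calc ∑' j, ‖cf f (e j)‖ₑ ≤ ∑' j, ((w N)⁻¹ : ℝ≥0) * ((w (e j) : ℝ≥0∞) * ‖cf f (e j)‖ₑ) := by
        refine ENNReal.tsum_le_tsum fun j => ?_
        rw [← mul_assoc]
        refine le_mul_of_one_le_left zero_le ?_
        rw [← ENNReal.coe_mul, ← ENNReal.coe_one, ENNReal.coe_le_coe, inv_mul_eq_div,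
          one_le_div₀ (pos_iff_ne_zero.2 (h1 _))]
        exact hw.mono _ _ (by simpa using hN j)
    _ ≤ _ := by
        rw [ENNReal.tsum_mul_left]
        gcongr
        exact ENNReal.tsum_comp_le_tsum_of_injective he fun n => (w n : ℝ≥0∞) * ‖cf f n‖ₑ

/-- For fixed `l` the sums over `j` and `k` separate into two tails, each at most `1 / w(l)` times a
norm, and `∑ w(l)⁻²` converges. This is the elementary substitute for `H(f) H(g~)` being of trace
class. -/
lemma tsum_enorm_hank_le (hw : IsWeight w) (f g : C(Circle, ℂ)) :
    ∑' (k : ℕ) (j : ℕ), ‖hank f g j k‖ₑ ≤ weightSum w * (wnorm w f * wnorm w g) := by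
  calc ∑' (k : ℕ) (j : ℕ), ‖hank f g j k‖ₑ
      ≤ ∑' (k : ℕ) (j : ℕ) (l : ℕ), ‖cf f (j + l + 1)‖ₑ * ‖cf g (-(k + l + 1))‖ₑ := by
        refine ENNReal.tsum_le_tsum fun k => ENNReal.tsum_le_tsum fun j => ?_
        refine (enorm_tsum_le _).trans (le_of_eq ?_)
        simp only [enorm_mul]
    _ = ∑' l : ℕ, (∑' j : ℕ, ‖cf f (j + l + 1)‖ₑ) * ∑' k : ℕ, ‖cf g (-(k + l + 1))‖ₑ := by
        have : ∀ k : ℕ, ∑' (j : ℕ) (l : ℕ), ‖cf f (j + l + 1)‖ₑ * ‖cf g (-(k + l + 1))‖ₑ =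
            ∑' l : ℕ, (∑' j : ℕ, ‖cf f (j + l + 1)‖ₑ) * ‖cf g (-(k + l + 1))‖ₑ := fun k => by
          rw [ENNReal.tsum_comm]
          simp only [ENNReal.tsum_mul_right]
        simp only [this]
        rw [ENNReal.tsum_comm]
        simp only [ENNReal.tsum_mul_left]
    _ ≤ ∑' l : ℕ, (((w l)⁻¹ : ℝ≥0) * wnorm w f) * (((w l)⁻¹ : ℝ≥0) * wnorm w g) := by
        refine ENNReal.tsum_le_tsum fun l => mul_le_mul' ?_ ?_
        · exact tsum_enorm_tail_le hw f l (fun a b hab => by simpa using hab) fun j => by omega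
        · exact tsum_enorm_tail_le hw g l (fun a b hab => by simpa using hab) fun j => by omega
    _ = _ := by
        rw [weightSum, ← ENNReal.tsum_mul_right]
        refine tsum_congr fun l => ?_
        push_cast
        ring

lemma ofReal_entrySum {ι : Type*} [Fintype ι] [DecidableEq ι] (X : Matrix ι ι ℂ) :
    ENNReal.ofReal (entrySum X) = ∑ j, ∑ i, ‖X i j‖ₑ := by
  rw [entrySum, ENNReal.ofReal_sum_of_nonneg fun _ _ => by positivity]
  refine Finset.sum_congr rfl fun j _ => ?_
  rw [ENNReal.ofReal_sum_of_nonneg fun _ _ => by positivity]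
  simp

lemma sum_fin_le_tsum (a : ℕ → ℝ≥0∞) (N : ℕ) : ∑ i : Fin N, a i ≤ ∑' i, a i := by
  rw [← Finset.sum_range]
  exact ENNReal.sum_le_tsum _

lemma ofReal_entrySum_hankM_le (hw : IsWeight w) (f g : C(Circle, ℂ)) (N : ℕ) :
    ENNReal.ofReal (entrySum (hankM f g N)) ≤ weightSum w * (wnorm w f * wnorm w g) := by
  rw [ofReal_entrySum]
  refine le_trans ?_ (tsum_enorm_hank_le hw f g)
  refine le_trans ?_ (sum_fin_le_tsum _ N)
  exact Finset.sum_le_sum fun k _ => sum_fin_le_tsum (fun j => ‖hank f g j k‖ₑ) N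

lemma entrySum_hankM_le (hw : IsWeight w) (hf : wnorm w f ≠ ⊤) (hg : wnorm w g ≠ ⊤) (N : ℕ) :
    entrySum (hankM f g N) ≤
      (weightSum w).toReal * ((wnorm w f).toReal * (wnorm w g).toReal) := by
  rw [← ENNReal.toReal_mul, ← ENNReal.toReal_mul, ← ENNReal.ofReal_le_iff_le_toReal]
  · exact ofReal_entrySum_hankM_le hw f g N
  · exact ENNReal.mul_ne_top (weightSum_ne_top hw) (ENNReal.mul_ne_top hf hg)

lemma summable_hank (hw : IsWeight w) (hf : wnorm w f ≠ ⊤) (hg : wnorm w g ≠ ⊤) (j k : ℕ) :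
    Summable fun l : ℕ => cf f (j + l + 1) * cf g (-(k + l + 1)) := by
  have h1 : Summable fun l : ℕ => cf f (j + l + 1) :=
    (summable_cf hw hf).comp_injective fun a b hab => by simpa using hab
  have h2 : Summable fun l : ℕ => cf g (-(k + l + 1)) :=
    (summable_cf hw hg).comp_injective fun a b hab => by simpa using hab
  exact (summable_mul_of_summable_norm h1.norm h2.norm).comp_injective
    (i := fun l : ℕ => (l, l)) fun a b hab => (Prod.ext_iff.1 hab).1

lemma hankM_sub_left (hw : IsWeight w) (hf : wnorm w f ≠ ⊤) (hg : wnorm w g ≠ ⊤)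
    (hh : wnorm w h ≠ ⊤) : hankM (f - g) h N = hankM f h N - hankM g h N := by
  ext j k
  simp only [hankM, Matrix.of_apply, Matrix.sub_apply, hank, cf_sub, sub_mul]
  exact (summable_hank hw hf hh j k).tsum_sub (summable_hank hw hg hh j k)

lemma hankM_sub_right (hw : IsWeight w) (hf : wnorm w f ≠ ⊤) (hg : wnorm w g ≠ ⊤)
    (hh : wnorm w h ≠ ⊤) : hankM h (f - g) N = hankM h f N - hankM h g N := by
  ext j k
  simp only [hankM, Matrix.of_apply, Matrix.sub_apply, hank, cf_sub, mul_sub]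
  exact (summable_hank hw hh hf j k).tsum_sub (summable_hank hw hh hg j k)

lemma hankM_smul_smul (c d : ℂ) : hankM (c • f) (d • g) N = (c * d) • hankM f g N := by
  ext j k
  simp only [hankM, Matrix.of_apply, Matrix.smul_apply, hank, cf_smul, smul_eq_mul]
  rw [← tsum_mul_left]
  exact tsum_congr fun l => by ring

/-- Hankel entries never involve the mean. Hence for symbols near `1` the Hankel product is of
second order. -/
lemma hankM_sub_one_sub_one : hankM (f - 1) (g - 1) N = hankM f g N := by
  ext j k
  simp only [hankM, Matrix.of_apply, hank]
  refine tsum_congr fun l => ?_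
  rw [cf_sub, cf_sub, cf_one, cf_one, if_neg (by omega), if_neg (by omega), sub_zero, sub_zero]

end

/-! ### Asymptotic multiplicativity of Toeplitz determinants. -/

section

open Topology
open scoped Matrix ENNReal NNReal

variable {w : ℤ → ℝ≥0} {m m' p p' q q' : C(Circle, ℂ)} {N : ℕ}

/-- `p` and `p' = p⁻¹` belong to the plus part of the weighted Wiener algebra, with mean `1`. -/
structure PlusUnit (w : ℤ → ℝ≥0) (p p' : C(Circle, ℂ)) : Prop where
  ne_top : wnorm w p ≠ ⊤
  inv_ne_top : wnorm w p' ≠ ⊤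
  plus : IsPlus p
  inv_plus : IsPlus p'
  mean : cf p 0 = 1
  inv_mean : cf p' 0 = 1
  mul_inv : p * p' = 1

/-- `m` and `m' = m⁻¹` belong to the minus part of the weighted Wiener algebra, with mean `1`. -/
structure MinusUnit (w : ℤ → ℝ≥0) (m m' : C(Circle, ℂ)) : Prop where
  ne_top : wnorm w m ≠ ⊤
  inv_ne_top : wnorm w m' ≠ ⊤
  minus : IsMinus m
  inv_minus : IsMinus m'
  mean : cf m 0 = 1
  inv_mean : cf m' 0 = 1
  mul_inv : m * m' = 1

lemma PlusUnit.reflect (hw : IsWeight w) (h : PlusUnit w p p') :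
    MinusUnit w (reflect p) (reflect p') where
  ne_top := by rw [wnorm_reflect hw]; exact h.ne_top
  inv_ne_top := by rw [wnorm_reflect hw]; exact h.inv_ne_top
  minus := h.plus.reflect
  inv_minus := h.inv_plus.reflect
  mean := by rw [cf_reflect]; exact h.mean
  inv_mean := by rw [cf_reflect]; exact h.inv_mean
  mul_inv := by rw [← reflect_mul, h.mul_inv, reflect_one]

lemma MinusUnit.reflect (hw : IsWeight w) (h : MinusUnit w m m') :
    PlusUnit w (reflect m) (reflect m') where
  ne_top := by rw [wnorm_reflect hw]; exact h.ne_top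
  inv_ne_top := by rw [wnorm_reflect hw]; exact h.inv_ne_top
  plus := h.minus.reflect
  inv_plus := h.inv_minus.reflect
  mean := by rw [cf_reflect]; exact h.mean
  inv_mean := by rw [cf_reflect]; exact h.inv_mean
  mul_inv := by rw [← reflect_mul, h.mul_inv, reflect_one]

lemma PlusUnit.mul (hw : IsWeight w) (hp : PlusUnit w p p') (hq : PlusUnit w q q') :
    PlusUnit w (p * q) (p' * q') where
  ne_top := ne_top_of_le_ne_top (ENNReal.mul_ne_top hp.ne_top hq.ne_top) (wnorm_mul_le hw hp.ne_top)
  inv_ne_top := ne_top_of_le_ne_top (ENNReal.mul_ne_top hp.inv_ne_top hq.inv_ne_top)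
    (wnorm_mul_le hw hp.inv_ne_top)
  plus := hp.plus.mul hw hp.ne_top hq.plus
  inv_plus := hp.inv_plus.mul hw hp.inv_ne_top hq.inv_plus
  mean := by rw [hp.plus.cf_mul_zero hw hp.ne_top hq.plus, hp.mean, hq.mean, one_mul]
  inv_mean := by
    rw [hp.inv_plus.cf_mul_zero hw hp.inv_ne_top hq.inv_plus, hp.inv_mean, hq.inv_mean, one_mul]
  mul_inv := by rw [mul_mul_mul_comm, hp.mul_inv, hq.mul_inv, one_mul]

lemma PlusUnit.toep_mul_inv (hw : IsWeight w) (hp : PlusUnit w p p') :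
    toep p N * toep p' N = 1 := by
  rw [← hp.plus.toep_mul hw hp.ne_top hp.inv_plus, hp.mul_inv, toep_one]

lemma PlusUnit.toep_inv_mul (hw : IsWeight w) (hp : PlusUnit w p p') :
    toep p' N * toep p N = 1 := by
  rw [← hp.inv_plus.toep_mul hw hp.inv_ne_top hp.plus, mul_comm, hp.mul_inv, toep_one]

lemma MinusUnit.toep_mul_inv (hw : IsWeight w) (hm : MinusUnit w m m') :
    toep m N * toep m' N = 1 := by
  rw [← hm.minus.toep_mul hw hm.ne_top hm.inv_minus, hm.mul_inv, toep_one]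

/-- The matrix `K` with `T(p)⁻¹ T(mp) T(m)⁻¹ = 1 + K`. -/
def pert (m m' p p' : C(Circle, ℂ)) (N : ℕ) : Matrix (Fin N) (Fin N) ℂ :=
  toep p' N * hankM p m N * toep m' N

lemma one_add_pert (hw : IsWeight w) (hm : MinusUnit w m m') (hp : PlusUnit w p p') (N : ℕ) :
    toep p' N * toep (m * p) N * toep m' N = 1 + pert m m' p p' N := by
  rw [mul_comm m p, toep_mul hw hp.ne_top (Or.inl hp.plus), mul_add, add_mul, pert,
    ← mul_assoc, hp.toep_inv_mul hw, one_mul, hm.toep_mul_inv hw]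

lemma det_toep_eq (hw : IsWeight w) (hm : MinusUnit w m m') (hp : PlusUnit w p p') (N : ℕ) :
    (toep (m * p) N).det = (1 + pert m m' p p' N).det := by
  rw [← one_add_pert hw hm hp, Matrix.det_mul, Matrix.det_mul,
    hp.inv_plus.det_toep hp.inv_mean, hm.inv_minus.det_toep hm.inv_mean, one_mul, mul_one]

/-- The outer factors are triangular with unit diagonal and inverses bounded uniformly in `N`, so
determinant and adjugate bounds for `T(mp)` reduce to those for `1 + K`. -/
lemma toep_eq (hw : IsWeight w) (hm : MinusUnit w m m') (hp : PlusUnit w p p') (N : ℕ) :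
    toep (m * p) N = toep p N * (1 + pert m m' p p' N) * toep m N := by
  have h : toep m' N * toep m N = 1 := mul_eq_one_comm.1 (hm.toep_mul_inv hw)
  rw [← one_add_pert hw hm hp, mul_assoc (toep p' N), ← mul_assoc (toep p N),
    hp.toep_mul_inv hw, one_mul, mul_assoc, h, mul_one]

lemma entrySum_toep_mul_mul_toep_le (hw : IsWeight w) {f g : C(Circle, ℂ)} (hf : wnorm w f ≠ ⊤)
    (hg : wnorm w g ≠ ⊤) (X : Matrix (Fin N) (Fin N) ℂ) :
    entrySum (toep f N * X * toep g N) ≤ (wnorm w g).toReal * ((wnorm w f).toReal * entrySum X) :=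
  (entrySum_mul_right (sum_row_toep_le hw hg) _).trans
    (mul_le_mul_of_nonneg_left (entrySum_mul_left (sum_col_toep_le hw hf) _)
      ENNReal.toReal_nonneg)

lemma exists_entrySum_pert_le (hw : IsWeight w) (hm : MinusUnit w m m') (hp : PlusUnit w p p') :
    ∃ B : ℝ, 0 ≤ B ∧ ∀ N, entrySum (pert m m' p p' N) ≤ B :=
  ⟨(wnorm w m').toReal * ((wnorm w p').toReal *
      ((weightSum w).toReal * ((wnorm w p).toReal * (wnorm w m).toReal))), by positivity, fun N =>
    (entrySum_toep_mul_mul_toep_le hw hp.inv_ne_top hm.inv_ne_top _).trans (by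
      gcongr
      exact entrySum_hankM_le hw hp.ne_top hm.ne_top N)⟩

/-- The corner term in the approximate multiplicativity of Toeplitz matrices. -/
def corner (f g h : C(Circle, ℂ)) (N : ℕ) : Matrix (Fin N) (Fin N) ℂ :=
  Matrix.of fun j k => ∑' i : ℕ, hank f g j (i + N : ℕ) * cf h (((i + N : ℕ) : ℤ) - (k : ℤ))

lemma ofReal_entrySum_corner_le (hw : IsWeight w) (f g h : C(Circle, ℂ)) (N : ℕ) :
    ENNReal.ofReal (entrySum (corner f g h N)) ≤
      (∑' (i : ℕ) (j : ℕ), ‖hank f g j (i + N)‖ₑ) * wnorm w h := by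
  rw [ofReal_entrySum]
  calc ∑ k : Fin N, ∑ j : Fin N, ‖corner f g h N j k‖ₑ
      ≤ ∑ k : Fin N, ∑ j : Fin N, ∑' i : ℕ, ‖hank f g j (i + N)‖ₑ *
          ‖cf h (((i + N : ℕ) : ℤ) - (k : ℤ))‖ₑ := by
        refine Finset.sum_le_sum fun k _ => Finset.sum_le_sum fun j _ => ?_
        refine (enorm_tsum_le _).trans (le_of_eq ?_)
        simp only [enorm_mul]
    _ ≤ ∑' k : ℕ, ∑' j : ℕ, ∑' i : ℕ, ‖hank f g j (i + N)‖ₑ *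
          ‖cf h (((i + N : ℕ) : ℤ) - (k : ℤ))‖ₑ := by
        refine le_trans (Finset.sum_le_sum fun k _ => ?_) (sum_fin_le_tsum _ N)
        exact sum_fin_le_tsum (fun j => ∑' i : ℕ, ‖hank f g j (i + N)‖ₑ *
          ‖cf h (((i + N : ℕ) : ℤ) - (k : ℤ))‖ₑ) N
    _ = ∑' i : ℕ, (∑' j : ℕ, ‖hank f g j (i + N)‖ₑ) *
          ∑' k : ℕ, ‖cf h (((i + N : ℕ) : ℤ) - (k : ℤ))‖ₑ := by
        have : ∀ k : ℕ, ∑' (j : ℕ) (i : ℕ), ‖hank f g j (i + N)‖ₑ *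
            ‖cf h (((i + N : ℕ) : ℤ) - (k : ℤ))‖ₑ = ∑' i : ℕ, (∑' j : ℕ, ‖hank f g j (i + N)‖ₑ) *
            ‖cf h (((i + N : ℕ) : ℤ) - (k : ℤ))‖ₑ := fun k => by
          rw [ENNReal.tsum_comm]
          simp only [ENNReal.tsum_mul_right]
        simp only [this]
        rw [ENNReal.tsum_comm]
        simp only [ENNReal.tsum_mul_left]
    _ ≤ _ := by
        rw [← ENNReal.tsum_mul_right]
        gcongr with i
        refine le_trans ?_ (tsum_enorm_cf_le hw h)
        exact ENNReal.tsum_comp_le_tsum_of_injective (f := fun k : ℕ => ((i + N : ℕ) : ℤ) - (k : ℤ))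
          (fun a b hab => by simpa using hab) fun n => ‖cf h n‖ₑ

/-- The corner only involves columns of the Hankel product with index at least `N`, that is, a tail
of a convergent double sum. -/
lemma tendsto_entrySum_corner (hw : IsWeight w) {f g h : C(Circle, ℂ)} (hf : wnorm w f ≠ ⊤)
    (hg : wnorm w g ≠ ⊤) (hh : wnorm w h ≠ ⊤) :
    Tendsto (fun N => entrySum (corner f g h N)) atTop (𝓝 0) := by
  have h1 : ∑' (k : ℕ) (j : ℕ), ‖hank f g j k‖ₑ ≠ ⊤ := ne_top_of_le_ne_top
    (ENNReal.mul_ne_top (weightSum_ne_top hw) (ENNReal.mul_ne_top hf hg)) (tsum_enorm_hank_le hw f g)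
  have h2 := ENNReal.Tendsto.mul_const (b := wnorm w h) (ENNReal.tendsto_sum_nat_add _ h1)
    (Or.inr hh)
  rw [zero_mul] at h2
  have h3 : Tendsto (fun N => ENNReal.ofReal (entrySum (corner f g h N))) atTop (𝓝 0) :=
    tendsto_of_tendsto_of_tendsto_of_le_of_le tendsto_const_nhds h2 (fun _ => zero_le)
      fun N => ofReal_entrySum_corner_le hw f g h N
  have h4 := (ENNReal.tendsto_toReal ENNReal.zero_ne_top).comp h3
  simpa [Function.comp_def, ENNReal.toReal_ofReal (entrySum_nonneg _)] using h4

/-- The product formula `T(f) T(g) T(h) = T(f g h)` for minus functions `g` and plus functions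
`g h`, in a finite section. -/
lemma toep_mul_mul_eq (hw : IsWeight w) {f g h : C(Circle, ℂ)} (hf : wnorm w f ≠ ⊤)
    (hg : wnorm w g ≠ ⊤) (hh : wnorm w h ≠ ⊤) (hgm : IsMinus g) (hfg : IsPlus (f * g))
    (hgh : IsPlus (g * h)) (N : ℕ) :
    toep (f * g * h) N = toep f N * toep g N * toep h N - corner f g h N := by
  have hs : ∀ j k : ℕ, Summable fun x : ℕ × ℕ =>
      cf f ((j : ℤ) - x.1) * (cf g ((x.1 : ℤ) - x.2) * cf h ((x.2 : ℤ) - k)) := fun j k => by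
    have h1 := summable_mul_of_summable_norm (summable_cf hw hf).norm
      (summable_mul_of_summable_norm (summable_cf hw hg).norm (summable_cf hw hh).norm).norm
    exact h1.comp_injective (i := fun x : ℕ × ℕ =>
      ((j : ℤ) - x.1, (x.1 : ℤ) - x.2, (x.2 : ℤ) - k)) fun a b hab => by
        simp only [Prod.mk.injEq, sub_right_inj, sub_left_inj, Nat.cast_inj] at hab
        exact Prod.ext hab.1 hab.2.2
  have hT : toep f N * toep g N = toep (f * g) N - hankM f g N := by
    rw [toep_mul hw hf (Or.inr hgm), add_sub_cancel_right]
  have hrow : ∀ j k i : ℕ, ∑' r : ℕ, cf f ((j : ℤ) - r) * (cf g ((r : ℤ) - i) * cf h ((i : ℤ) - k)) =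
      (cf (f * g) ((j : ℤ) - i) - hank f g j i) * cf h ((i : ℤ) - k) := fun j k i => by
    rw [cf_mul_eq_tsum_add_hank hw hf, add_sub_cancel_right, ← tsum_mul_right]
    simp only [mul_assoc]
  ext j k
  have h1 : cf (f * g * h) ((j : ℤ) - k) =
      ∑' i : ℕ, (cf (f * g) ((j : ℤ) - i) - hank f g j i) * cf h ((i : ℤ) - k) := by
    have h2 := (hs j k).tsum_comm (f := fun r i : ℕ =>
      cf f ((j : ℤ) - r) * (cf g ((r : ℤ) - i) * cf h ((i : ℤ) - k)))
    simp only [hrow] at h2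
    rw [h2, mul_assoc, cf_mul_eq_tsum_add_hank hw hf, hank_eq_zero_of_isPlus hgh, add_zero]
    refine tsum_congr fun r => ?_
    rw [cf_mul_eq_tsum_add_hank hw hg, hank_eq_zero_of_isMinus hgm, add_zero, tsum_mul_left]
  have hsum := (hs j k).prod_symm.prod
  simp only [Prod.swap_prod_mk, hrow] at hsum
  rw [toep_apply, h1, ← hsum.sum_add_tsum_nat_add N, Finset.sum_range, hT, Matrix.sub_apply,
    Matrix.mul_apply, sub_eq_add_neg]
  congr 1
  simp only [corner, Matrix.of_apply]
  rw [← tsum_neg]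
  refine tsum_congr fun i => ?_
  -- For intermediate index at least `N > j` the Toeplitz entry of the plus function `f * g`
  -- vanishes, which leaves only the Hankel part, the negative of the corner.
  rw [hfg _ (by have := j.2; omega), zero_sub, neg_mul]

/-- Asymptotic multiplicativity of Toeplitz determinants in the plus factor. -/
lemma tendsto_det_mul_plus (hw : IsWeight w) (hm : MinusUnit w m m') (hp : PlusUnit w p p')
    (hq : PlusUnit w q q') :
    Tendsto (fun N => (toep (m * (p * q)) N).det - (toep (m * p) N).det * (toep (m * q) N).det)
      atTop (𝓝 0) := by
  obtain ⟨B₁, hB₁, h₁⟩ := exists_entrySum_pert_le hw hm hp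
  obtain ⟨B₂, hB₂, h₂⟩ := exists_entrySum_pert_le hw hm hq
  have hmq : wnorm w (m * q) ≠ ⊤ :=
    ne_top_of_le_ne_top (ENNReal.mul_ne_top hm.ne_top hq.ne_top) (wnorm_mul_le hw hm.ne_top)
  have hmp : wnorm w (m * p) ≠ ⊤ :=
    ne_top_of_le_ne_top (ENNReal.mul_ne_top hm.ne_top hp.ne_top) (wnorm_mul_le hw hm.ne_top)
  -- The symbol is regrouped as `m p q = (m q) m' (m p)`. The partial products `(m q) m' = q` and
  -- `m' (m p) = p` are plus functions, as the triple product formula requires.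
  have e1 : m * q * m' = q := by rw [mul_right_comm, hm.mul_inv, one_mul]
  have e2 : m' * (m * p) = p := by rw [← mul_assoc, mul_comm m', hm.mul_inv, one_mul]
  have e3 : m * q * m' * (m * p) = m * (p * q) := by rw [e1]; ring
  have hprod := toep_mul_mul_eq hw hmq hm.inv_ne_top hmp hm.inv_minus (by rw [e1]; exact hq.plus)
    (by rw [e2]; exact hp.plus)
  rw [e3] at hprod
  have hκ := tendsto_entrySum_corner hw hmq hm.inv_ne_top hmp
  set κ := corner (m * q) m' (m * p) with hκdef
  set Wp := (wnorm w p).toReal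
  set Wp' := (wnorm w p').toReal
  set Wq' := (wnorm w q').toReal
  set Wm' := (wnorm w m').toReal
  have key : ∀ N, entrySum (toep p' N * (toep q' N * κ N) * toep m' N) ≤
      Wm' * (Wp' * (Wq' * entrySum (κ N))) := fun N =>
    (entrySum_toep_mul_mul_toep_le hw hp.inv_ne_top hm.inv_ne_top _).trans (by
      gcongr
      exact entrySum_mul_left (sum_col_toep_le hw hq.inv_ne_top) _)
  have htend : Tendsto (fun N => Wm' * (Wp' * (Wq' * entrySum (κ N)))) atTop (𝓝 0) := by
    simpa using ((hκ.const_mul Wq').const_mul Wp').const_mul Wm'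
  set P : (N : ℕ) → Matrix (Fin N) (Fin N) ℂ := fun N =>
    toep p' N * pert m m' q q' N * toep p N with hP
  -- Chosen so that `1 + Y = T(p') (1 + K_q) T(p) (1 + K_p)`, where `K_p` and `K_q` are the
  -- perturbations for `m p` and `m q`. Its determinant is the product of the two given
  -- determinants, and subtracting the transformed corner yields the determinant for `m p q`.
  set Y : (N : ℕ) → Matrix (Fin N) (Fin N) ℂ := fun N =>
    pert m m' p p' N + P N + P N * pert m m' p p' N with hY
  have hYB : ∃ B, ∀ N, entrySum (Y N) ≤ B := by
    refine ⟨B₁ + Wp * (Wp' * B₂) + Wp * (Wp' * B₂) * B₁, fun N => ?_⟩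
    have hP' : entrySum (P N) ≤ Wp * (Wp' * B₂) :=
      (entrySum_toep_mul_mul_toep_le hw hp.inv_ne_top hp.ne_top _).trans (by
        gcongr; exact h₂ N)
    refine (entrySum_add_le _ _).trans (add_le_add ((entrySum_add_le _ _).trans
      (add_le_add (h₁ N) hP')) ((entrySum_mul_le _ _).trans ?_))
    have := entrySum_nonneg (P N)
    have := entrySum_nonneg (pert m m' p p' N)
    gcongr
    exact h₁ N
  obtain ⟨B, hB⟩ := hYB
  have hdetY : ∀ N, (1 + Y N).det = (toep (m * p) N).det * (toep (m * q) N).det := fun N => by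
    have : 1 + Y N = toep p' N * (1 + pert m m' q q' N) * toep p N * (1 + pert m m' p p' N) := by
      have h := hp.toep_inv_mul hw (N := N)
      simp only [hY, hP, mul_add, add_mul, mul_one, h, one_mul]
      abel
    rw [this, Matrix.det_mul, Matrix.det_mul, Matrix.det_mul, hp.plus.det_toep hp.mean,
      hp.inv_plus.det_toep hp.inv_mean, det_toep_eq hw hm hp, det_toep_eq hw hm hq]
    ring
  have hdetX : ∀ N, (1 + (Y N - toep p' N * (toep q' N * κ N) * toep m' N)).det =
      (toep (m * (p * q)) N).det := fun N => by
    have h3 : 1 + (Y N - toep p' N * (toep q' N * κ N) * toep m' N) =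
        toep p' N * (toep q' N * toep (m * (p * q)) N) * toep m' N := by
      have h := hp.toep_inv_mul hw (N := N)
      have h4 : toep p' N * toep (m * p) N * toep m' N = 1 + pert m m' p p' N :=
        one_add_pert hw hm hp N
      have h5 : toep q' N * toep (m * q) N * toep m' N = 1 + pert m m' q q' N :=
        one_add_pert hw hm hq N
      have h6 := hp.toep_mul_inv hw (N := N)
      have h7 : toep (m * p) N * toep m' N = toep p N * (1 + pert m m' p p' N) := by
        rw [← h4, mul_assoc (toep p' N), ← mul_assoc (toep p N), h6, one_mul]
      have h8 : toep p' N * (toep q' N * (toep (m * q) N * toep m' N * toep (m * p) N)) * toep m' N =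
          1 + Y N := by
        calc _ = toep p' N * (toep q' N * toep (m * q) N * toep m' N) *
              (toep (m * p) N * toep m' N) := by simp only [mul_assoc]
          _ = toep p' N * (1 + pert m m' q q' N) * toep p N * (1 + pert m m' p p' N) := by
              rw [h5, h7]; simp only [mul_assoc]
          _ = _ := by
              simp only [hY, hP, mul_add, add_mul, mul_one, h, one_mul]
              abel
      rw [hprod, mul_sub, mul_sub, sub_mul, h8]
      abel
    rw [h3, Matrix.det_mul, Matrix.det_mul, Matrix.det_mul, hp.inv_plus.det_toep hp.inv_mean,
      hq.inv_plus.det_toep hq.inv_mean, hm.inv_minus.det_toep hm.inv_mean]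
    ring
  have hev : ∀ᶠ N in atTop, Wm' * (Wp' * (Wq' * entrySum (κ N))) ≤ 1 :=
    htend.eventually_le_const zero_lt_one
  refine squeeze_zero_norm' (a := fun N => 2 * Real.exp (B + 1 + 1) *
    (Wm' * (Wp' * (Wq' * entrySum (κ N))))) ?_ (by simpa using htend.const_mul _)
  filter_upwards [hev] with N hN
  rw [← hdetX, ← hdetY]
  have hk := key N
  have hX : entrySum (Y N - toep p' N * (toep q' N * κ N) * toep m' N) ≤ B + 1 := by
    rw [sub_eq_add_neg]
    refine (entrySum_add_le _ _).trans ?_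
    rw [entrySum_neg]
    linarith [hB N]
  refine (norm_det_one_add_sub_le hX (by linarith [hB N])).trans ?_
  gcongr
  rw [sub_sub_cancel_left, entrySum_neg]
  exact hk

/-- Asymptotic multiplicativity of Toeplitz determinants in the minus factor. -/
lemma tendsto_det_mul_minus (hw : IsWeight w) {n n' : C(Circle, ℂ)} (hm : MinusUnit w m m')
    (hn : MinusUnit w n n') (hp : PlusUnit w p p') :
    Tendsto (fun N => (toep ((m * n) * p) N).det - (toep (m * p) N).det * (toep (n * p) N).det)
      atTop (𝓝 0) := by
  -- The reflection `z ↦ z⁻¹` exchanges plus and minus functions and transposes Toeplitz matrices.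
  have h := tendsto_det_mul_plus hw (hp.reflect hw) (hm.reflect hw) (hn.reflect hw)
  simp only [← reflect_mul, toep_reflect, Matrix.det_transpose] at h
  simpa only [mul_comm] using h

end

/-! ### The strong Szegő limit theorem. -/

section

open Topology
open scoped Matrix ENNReal NNReal

variable {w : ℤ → ℝ≥0} {a b m m' p p' : C(Circle, ℂ)} {N : ℕ}

/-- The Fourier coefficients with nonnegative index vanish. -/
def IsStrictMinus (f : C(Circle, ℂ)) : Prop := ∀ n ≥ 0, cf f n = 0

lemma IsStrictMinus.reflect (ha : IsStrictMinus a) : IsStrictPlus (reflect a) := fun n hn => by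
  rw [cf_reflect]; exact ha _ (by omega)

lemma reflect_cexp (f : C(Circle, ℂ)) : reflect (cexp f) = cexp (reflect f) := rfl

lemma IsStrictPlus.smul (hb : IsStrictPlus b) (c : ℂ) : IsStrictPlus (c • b) := fun n hn => by
  rw [cf_smul, hb n hn, mul_zero]

lemma IsStrictPlus.neg (hb : IsStrictPlus b) : IsStrictPlus (-b) := by
  simpa using hb.smul (-1)

lemma IsStrictMinus.smul (hb : IsStrictMinus b) (c : ℂ) : IsStrictMinus (c • b) := fun n hn => by
  rw [cf_smul, hb n hn, mul_zero]

lemma IsStrictPlus.plusUnit (hw : IsWeight w) (hb : IsStrictPlus b) (hbw : wnorm w b ≠ ⊤) :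
    PlusUnit w (cexp b) (cexp (-b)) where
  ne_top := wnorm_cexp_ne_top hw hbw
  inv_ne_top := wnorm_cexp_ne_top hw (by rwa [wnorm_neg])
  plus := hb.cexp_isPlus hw hbw
  inv_plus := hb.neg.cexp_isPlus hw (by rwa [wnorm_neg])
  mean := hb.cf_cexp_zero hw hbw
  inv_mean := hb.neg.cf_cexp_zero hw (by rwa [wnorm_neg])
  mul_inv := cexp_mul_cexp_neg

lemma IsStrictMinus.minusUnit (hw : IsWeight w) (ha : IsStrictMinus a) (haw : wnorm w a ≠ ⊤) :
    MinusUnit w (cexp a) (cexp (-a)) := by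
  have h := (ha.reflect.plusUnit hw (by rwa [wnorm_reflect hw])).reflect hw
  rw [reflect_cexp, reflect_cexp, reflect_reflect] at h
  have e : BorderedToeplitz.reflect (-BorderedToeplitz.reflect a) = -a := by
    ext z; simp [reflect_apply]
  rwa [e] at h

lemma PlusUnit.pow (hw : IsWeight w) (hp : PlusUnit w p p') (k : ℕ) :
    PlusUnit w (p ^ k) (p' ^ k) := by
  induction k with
  | zero =>
    have h1 : wnorm w 1 ≠ ⊤ := by simp [wnorm_one hw]
    simp only [pow_zero]
    exact ⟨h1, h1, IsPlus.one, IsPlus.one, by simp [cf_one], by simp [cf_one], one_mul 1⟩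
  | succ k ih => rw [pow_succ, pow_succ]; exact ih.mul hw hp

lemma MinusUnit.pow (hw : IsWeight w) (hm : MinusUnit w m m') (k : ℕ) :
    MinusUnit w (m ^ k) (m' ^ k) := by
  have h := ((hm.reflect hw).pow hw k).reflect hw
  have e : ∀ f : C(Circle, ℂ), BorderedToeplitz.reflect (BorderedToeplitz.reflect f ^ k) = f ^ k :=
    fun f => by ext z; simp [reflect_apply]
  rwa [e, e] at h

lemma exists_norm_det_toep_le (hw : IsWeight w) (hm : MinusUnit w m m') (hp : PlusUnit w p p') :
    ∃ B : ℝ, ∀ N, ‖(toep (m * p) N).det‖ ≤ B := by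
  obtain ⟨B, -, hB⟩ := exists_entrySum_pert_le hw hm hp
  refine ⟨Real.exp B, fun N => ?_⟩
  rw [det_toep_eq hw hm hp]
  exact (norm_det_one_add_le _).trans (Real.exp_le_exp.2 (hB N))

/-- Boundedness of `x 1` keeps the error small when it is multiplied along the induction. -/
lemma tendsto_sub_pow_of_tendsto_sub_mul {x : ℕ → ℕ → ℂ} {B : ℝ} (hB : ∀ N, ‖x 1 N‖ ≤ B)
    (h0 : ∀ N, x 0 N = 1)
    (h : ∀ k, Tendsto (fun N => x (k + 1) N - x k N * x 1 N) atTop (𝓝 0)) (k : ℕ) :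
    Tendsto (fun N => x k N - x 1 N ^ k) atTop (𝓝 0) := by
  induction k with
  | zero => simp [h0]
  | succ k ih =>
    have h1 : Tendsto (fun N => (x k N - x 1 N ^ k) * x 1 N) atTop (𝓝 0) := by
      refine squeeze_zero_norm (a := fun N => ‖x k N - x 1 N ^ k‖ * B) (fun N => ?_)
        (by simpa using ih.norm.mul_const B)
      rw [norm_mul]
      gcongr
      exact hB N
    have h2 := (h k).add h1
    rw [add_zero] at h2
    refine h2.congr fun N => ?_
    ring

lemma tendsto_det_pow_plus (hw : IsWeight w) (hm : MinusUnit w m m') (hp : PlusUnit w p p')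
    (k : ℕ) :
    Tendsto (fun N => (toep (m * p ^ k) N).det - (toep (m * p) N).det ^ k) atTop (𝓝 0) := by
  obtain ⟨B, hB⟩ := exists_norm_det_toep_le hw hm hp
  have h := tendsto_sub_pow_of_tendsto_sub_mul (x := fun k N => (toep (m * p ^ k) N).det) (B := B)
    (by simpa using hB) (fun N => by simpa using hm.minus.det_toep hm.mean)
    (fun k => by simpa [pow_succ] using tendsto_det_mul_plus hw hm (hp.pow hw k) hp) k
  simpa using h

lemma tendsto_det_pow_minus (hw : IsWeight w) (hm : MinusUnit w m m') (hp : PlusUnit w p p')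
    (k : ℕ) :
    Tendsto (fun N => (toep (m ^ k * p) N).det - (toep (m * p) N).det ^ k) atTop (𝓝 0) := by
  obtain ⟨B, hB⟩ := exists_norm_det_toep_le hw hm hp
  have h := tendsto_sub_pow_of_tendsto_sub_mul (x := fun k N => (toep (m ^ k * p) N).det) (B := B)
    (by simpa using hB) (fun N => by simpa using hp.plus.det_toep hp.mean)
    (fun k => by simpa [pow_succ] using tendsto_det_mul_minus hw (hm.pow hw k) hm hp) k
  simpa using h

lemma norm_pow_sub_pow_le_mul {x y : ℂ} {r : ℝ} (hr : 1 ≤ r) (hx : ‖x‖ ≤ r) (hy : ‖y‖ ≤ r) (k : ℕ) :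
    ‖x ^ k - y ^ k‖ ≤ k * r ^ k * ‖x - y‖ := by
  induction k with
  | zero => simp
  | succ k ih =>
    have e : x ^ (k + 1) - y ^ (k + 1) = x * (x ^ k - y ^ k) + (x - y) * y ^ k := by ring
    rw [e]
    refine (norm_add_le _ _).trans ?_
    rw [norm_mul, norm_mul, norm_pow]
    have h1 : ‖x‖ * ‖x ^ k - y ^ k‖ ≤ r * (k * r ^ k * ‖x - y‖) := by gcongr
    have h2 : ‖x - y‖ * ‖y‖ ^ k ≤ ‖x - y‖ * r ^ (k + 1) := by
      gcongr
      exact (pow_le_pow_left₀ (norm_nonneg _) hy k).trans (pow_le_pow_right₀ hr (by omega))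
    push_cast
    calc _ ≤ r * (k * r ^ k * ‖x - y‖) + ‖x - y‖ * r ^ (k + 1) := add_le_add h1 h2
      _ = _ := by ring

/-- The exponent is `k * k` because each of the two factors contributes a `k`-th power separately.
This matches the quadratic leading term of the small-symbol expansion. -/
lemma tendsto_det_pow (hw : IsWeight w) (hm : MinusUnit w m m') (hp : PlusUnit w p p') (k : ℕ) :
    Tendsto (fun N => (toep (m ^ k * p ^ k) N).det - (toep (m * p) N).det ^ (k * k))
      atTop (𝓝 0) := by
  obtain ⟨B₁, hB₁⟩ := exists_norm_det_toep_le hw hm (hp.pow hw k)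
  obtain ⟨B₂, hB₂⟩ := exists_norm_det_toep_le hw hm hp
  set r : ℝ := max 1 (max B₁ (B₂ ^ k)) with hr
  have h1 := tendsto_det_pow_minus hw hm (hp.pow hw k) k
  have h2 := tendsto_det_pow_plus hw hm hp k
  have h3 : Tendsto (fun N => (toep (m * p ^ k) N).det ^ k - ((toep (m * p) N).det ^ k) ^ k)
      atTop (𝓝 0) := by
    refine squeeze_zero_norm (fun N => norm_pow_sub_pow_le_mul (le_max_left _ _ : (1 : ℝ) ≤ r) ?_ ?_ k)
      (by simpa using h2.norm.const_mul (k * r ^ k))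
    · exact (hB₁ N).trans ((le_max_left _ _).trans (le_max_right _ _))
    · rw [norm_pow]
      exact (pow_le_pow_left₀ (norm_nonneg _) (hB₂ N) k).trans
        ((le_max_right _ _).trans (le_max_right _ _))
  have h4 := h1.add h3
  rw [add_zero] at h4
  refine h4.congr fun N => ?_
  ring

/-- The determinant for small symbols, up to an error of third order. -/
lemma exists_norm_det_sub_le (hw : IsWeight w) (ha : IsStrictMinus a) (hb : IsStrictPlus b)
    (haw : wnorm w a ≠ ⊤) (hbw : wnorm w b ≠ ⊤) :
    ∃ C : ℝ, 0 ≤ C ∧ ∀ s : ℝ, 0 ≤ s → s ≤ 1 → C * s ≤ 1 → ∀ N,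
      ‖(toep (cexp ((s : ℂ) • a) * cexp ((s : ℂ) • b)) N).det - 1 -
        (s : ℂ) ^ 2 * (hankM b a N).trace‖ ≤ C * s ^ 3 := by
  set S := (weightSum w).toReal
  set A := (wnorm w a).toReal
  set B := (wnorm w b).toReal
  set Ea := (expBound w a).toReal
  set Eb := (expBound w b).toReal
  set E := S * (Eb * Ea)
  set C₁ := (Eb * Ea + Ea) * E + S * (Eb * Ea) + S * (B * Ea) with hC₁
  set C₃ := S * (B * A) with hC₃
  set B₀ := Ea * (Eb * E) + C₃ with hB₀
  have hS : 0 ≤ S := ENNReal.toReal_nonneg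
  have hA : 0 ≤ A := ENNReal.toReal_nonneg
  have hB : 0 ≤ B := ENNReal.toReal_nonneg
  have hEa : 0 ≤ Ea := ENNReal.toReal_nonneg
  have hEb : 0 ≤ Eb := ENNReal.toReal_nonneg
  have hE : 0 ≤ E := by positivity
  have hC₁0 : 0 ≤ C₁ := by positivity
  have hC₃0 : 0 ≤ C₃ := by positivity
  -- The first summand comes from replacing the perturbation by `s² H(b) H(a~)`, the second from the
  -- quadratic remainder of the determinant. The last one only ensures that `C * s ≤ 1` forces `C₃ *
  -- s ≤ 1`, so that the trace estimate applies.
  refine ⟨2 * Real.exp (B₀ + 1) * C₁ + (Real.exp 1 + 2) * C₃ ^ 2 + C₃, by positivity,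
    fun s hs hs1 hsC N => ?_⟩
  have haw' : wnorm w (-a) ≠ ⊤ := by rwa [wnorm_neg]
  have hbw' : wnorm w (-b) ≠ ⊤ := by rwa [wnorm_neg]
  have hsa : wnorm w ((s : ℂ) • a) ≠ ⊤ := by
    rw [wnorm_smul]; exact ENNReal.mul_ne_top (by simp) haw
  have hsb : wnorm w ((s : ℂ) • b) ≠ ⊤ := by
    rw [wnorm_smul]; exact ENNReal.mul_ne_top (by simp) hbw
  have hm := (ha.smul s).minusUnit hw hsa
  have hp := (hb.smul s).plusUnit hw hsb
  have hEa' : expBound w (-a) = expBound w a := by simp [expBound, wnorm_neg]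
  have hEb' : expBound w (-b) = expBound w b := by simp [expBound, wnorm_neg]
  have real_of : ∀ {x y : ℝ≥0∞} {r : ℝ}, 0 ≤ r → y ≠ ⊤ → x ≤ ENNReal.ofReal r * y →
      x ≠ ⊤ ∧ x.toReal ≤ r * y.toReal := fun {x y r} hr hy hxy => by
    have h1 : ENNReal.ofReal r * y ≠ ⊤ := ENNReal.mul_ne_top ENNReal.ofReal_ne_top hy
    refine ⟨ne_top_of_le_ne_top h1 hxy, (ENNReal.toReal_mono h1 hxy).trans ?_⟩
    rw [ENNReal.toReal_mul, ENNReal.toReal_ofReal hr]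
  have p1 := real_of hs (expBound_ne_top hbw) (wnorm_cexp_sub_one_le hw hbw hs hs1)
  have m1 := real_of hs (expBound_ne_top haw) (wnorm_cexp_sub_one_le hw haw hs hs1)
  have p2 := real_of (sq_nonneg s) (expBound_ne_top hbw) (wnorm_cexp_sub_one_sub_le hw hbw hs hs1)
  have m2 := real_of (sq_nonneg s) (expBound_ne_top haw) (wnorm_cexp_sub_one_sub_le hw haw hs hs1)
  have p1' := real_of hs (expBound_ne_top hbw') (wnorm_cexp_sub_one_le hw hbw' hs hs1)
  have m1' := real_of hs (expBound_ne_top haw') (wnorm_cexp_sub_one_le hw haw' hs hs1)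
  have p0' := ENNReal.toReal_mono (expBound_ne_top hbw') (wnorm_cexp_le hw hbw' hs hs1)
  have m0' := ENNReal.toReal_mono (expBound_ne_top haw') (wnorm_cexp_le hw haw' hs hs1)
  rw [hEb', smul_neg] at p1' p0'
  rw [hEa', smul_neg] at m1' m0'
  set p := cexp ((s : ℂ) • b)
  set m := cexp ((s : ℂ) • a)
  set p' := cexp (-((s : ℂ) • b))
  set m' := cexp (-((s : ℂ) • a))
  set H := hankM p m N with hH
  have hHle : entrySum H ≤ E * s ^ 2 := by
    rw [hH, ← hankM_sub_one_sub_one]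
    refine (entrySum_hankM_le hw p1.1 m1.1 N).trans ?_
    calc _ ≤ S * ((s * Eb) * (s * Ea)) := by gcongr; exacts [p1.2, m1.2]
      _ = _ := by ring
  have hpert : entrySum (pert m m' p p' N) ≤ Ea * (Eb * (E * s ^ 2)) := by
    refine (entrySum_toep_mul_mul_toep_le hw hp.inv_ne_top hm.inv_ne_top _).trans ?_
    have := entrySum_nonneg H
    gcongr
  have hH₀ : entrySum ((s : ℂ) ^ 2 • hankM b a N) ≤ C₃ * s ^ 2 := by
    rw [entrySum_smul, norm_pow, Complex.norm_real, Real.norm_of_nonneg hs, mul_comm]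
    gcongr
    exact entrySum_hankM_le hw hbw haw N
  have hdiff : entrySum (pert m m' p p' N - (s : ℂ) ^ 2 • hankM b a N) ≤ C₁ * s ^ 3 := by
    have e0 : toep (p' - 1) N = toep p' N - 1 := by
      rw [← toep_one]; ext j k; simp [toep_apply, cf_sub]
    have e1 : toep (m' - 1) N = toep m' N - 1 := by
      rw [← toep_one]; ext j k; simp [toep_apply, cf_sub]
    have e2 : H - (s : ℂ) ^ 2 • hankM b a N =
        hankM (p - 1 - (s : ℂ) • b) (m - 1) N + hankM ((s : ℂ) • b) (m - 1 - (s : ℂ) • a) N := by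
      rw [hankM_sub_left hw p1.1 hsb m1.1, hankM_sub_right hw m1.1 hsa hsb, hankM_sub_one_sub_one,
        hankM_smul_smul, ← hH]
      rw [sub_add_sub_cancel, sq]
    -- Since `H` is of order `s²` and `p' - 1`, `m' - 1` are of order `s`, the first two terms are
    -- of order `s³`. In the Hankel terms one factor is of order `s`, the other of order `s²`.
    have e3 : pert m m' p p' N - (s : ℂ) ^ 2 • hankM b a N =
        toep (p' - 1) N * H * toep m' N + H * toep (m' - 1) N +
        (hankM (p - 1 - (s : ℂ) • b) (m - 1) N + hankM ((s : ℂ) • b) (m - 1 - (s : ℂ) • a) N) := by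
      rw [← e2, pert, ← hH, e0, e1, sub_mul, sub_mul, mul_sub]
      simp only [one_mul, mul_one]
      abel
    rw [e3]
    have hH0 := entrySum_nonneg H
    have t1 : entrySum (toep (p' - 1) N * H * toep m' N) ≤ Ea * ((s * Eb) * (E * s ^ 2)) := by
      refine (entrySum_toep_mul_mul_toep_le hw p1'.1 hm.inv_ne_top _).trans ?_
      have := p1'.2
      gcongr
    have t2 : entrySum (H * toep (m' - 1) N) ≤ (s * Ea) * (E * s ^ 2) := by
      refine (entrySum_mul_right (sum_row_toep_le hw m1'.1) _).trans ?_
      have := m1'.2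
      gcongr
    have t3 : entrySum (hankM (p - 1 - (s : ℂ) • b) (m - 1) N) ≤ S * ((s ^ 2 * Eb) * (s * Ea)) := by
      refine (entrySum_hankM_le hw p2.1 m1.1 N).trans ?_
      have := p2.2
      have := m1.2
      gcongr
    have t4 : entrySum (hankM ((s : ℂ) • b) (m - 1 - (s : ℂ) • a) N) ≤
        S * ((s * B) * (s ^ 2 * Ea)) := by
      refine (entrySum_hankM_le hw hsb m2.1 N).trans ?_
      have := m2.2
      have h5 : (wnorm w ((s : ℂ) • b)).toReal = s * B := by
        rw [wnorm_smul, ENNReal.toReal_mul]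
        simp [abs_of_nonneg hs, B]
      rw [h5]
      gcongr
    calc _ ≤ Ea * ((s * Eb) * (E * s ^ 2)) + (s * Ea) * (E * s ^ 2) +
          (S * ((s ^ 2 * Eb) * (s * Ea)) + S * ((s * B) * (s ^ 2 * Ea))) :=
        (entrySum_add_le _ _).trans (add_le_add ((entrySum_add_le _ _).trans (add_le_add t1 t2))
          ((entrySum_add_le _ _).trans (add_le_add t3 t4)))
      _ = C₁ * s ^ 3 := by rw [hC₁]; ring
  have hs2 : s ^ 2 ≤ 1 := pow_le_one₀ hs hs1
  have hX : entrySum (pert m m' p p' N) ≤ B₀ := by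
    refine hpert.trans ?_
    calc Ea * (Eb * (E * s ^ 2)) ≤ Ea * (Eb * (E * 1)) := by gcongr
      _ ≤ B₀ := by rw [hB₀, mul_one]; linarith
  have hY : entrySum ((s : ℂ) ^ 2 • hankM b a N) ≤ B₀ := by
    refine hH₀.trans ?_
    calc C₃ * s ^ 2 ≤ C₃ * 1 := by gcongr
      _ ≤ B₀ := by rw [hB₀, mul_one, le_add_iff_nonneg_left]; positivity
  have hC₃s : C₃ * s ≤ 1 := by
    refine le_trans ?_ hsC
    gcongr
    rw [le_add_iff_nonneg_left]; positivity
  have hY1 : entrySum ((s : ℂ) ^ 2 • hankM b a N) ≤ 1 := by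
    refine hH₀.trans ?_
    calc C₃ * s ^ 2 = (C₃ * s) * s := by ring
      _ ≤ 1 * 1 := by gcongr
      _ = 1 := one_mul 1
  have f1 := norm_det_one_add_sub_le hX hY
  have f2 := norm_det_one_add_sub_one_sub_trace_le hY1
  rw [Matrix.trace_smul, smul_eq_mul] at f2
  rw [det_toep_eq hw hm hp]
  calc _ ≤ ‖(1 + pert m m' p p' N).det - (1 + (s : ℂ) ^ 2 • hankM b a N).det‖ +
        ‖(1 + (s : ℂ) ^ 2 • hankM b a N).det - 1 - (s : ℂ) ^ 2 * (hankM b a N).trace‖ := by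
        refine le_trans (le_of_eq ?_) (norm_add_le _ _)
        congr 1; ring
    _ ≤ 2 * Real.exp (B₀ + 1) * (C₁ * s ^ 3) + (Real.exp 1 + 2) * (C₃ * s ^ 2) ^ 2 := by
        refine add_le_add (f1.trans (by gcongr)) (f2.trans ?_)
        have := entrySum_nonneg ((s : ℂ) ^ 2 • hankM b a N)
        gcongr
    _ ≤ _ := by
        have h1 : (C₃ * s ^ 2) ^ 2 ≤ C₃ ^ 2 * s ^ 3 := by
          calc (C₃ * s ^ 2) ^ 2 = C₃ ^ 2 * s ^ 3 * s := by ring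
            _ ≤ C₃ ^ 2 * s ^ 3 * 1 := by gcongr
            _ = _ := mul_one _
        have h2 : 0 ≤ C₃ * s ^ 3 := by positivity
        have h3 : (Real.exp 1 + 2) * (C₃ * s ^ 2) ^ 2 ≤ (Real.exp 1 + 2) * (C₃ ^ 2 * s ^ 3) := by
          gcongr
        linarith

lemma summable_nat_mul_cf_mul_cf (hw : IsWeight w) (ha : wnorm w a ≠ ⊤) (hb : wnorm w b ≠ ⊤) :
    Summable fun n : ℕ => (n : ℂ) * cf b n * cf a (-n) := by
  -- For `l < n` monotonicity gives `w(l)⁻² w(n)² ≥ 1`; summing over these `l` produces `n`. Thus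
  -- two weighted coefficients absorb the factor `n`.
  have hwn : ∀ n : ℕ, (n : ℝ≥0∞) ≤ weightSum w * ((w n : ℝ≥0∞) * w n) := fun n => by
    have h0 : ∀ l : ℤ, w l ≠ 0 := fun l => (zero_lt_one.trans_le (hw.one_le l)).ne'
    calc (n : ℝ≥0∞) = ∑ l ∈ Finset.range n, 1 := by simp
      _ ≤ ∑ l ∈ Finset.range n, (((w l)⁻¹ ^ 2 : ℝ≥0) : ℝ≥0∞) * ((w n : ℝ≥0∞) * w n) := by
          refine Finset.sum_le_sum fun l hl => ?_
          have h1 : w l ≤ w n := hw.mono _ _ (by simpa using (Finset.mem_range.1 hl).le)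
          rw [← ENNReal.coe_mul, ← ENNReal.coe_mul, ← ENNReal.coe_one, ENNReal.coe_le_coe, ← sq,
            ← mul_pow, inv_mul_eq_div]
          exact one_le_pow₀ ((one_le_div₀ (pos_iff_ne_zero.2 (h0 _))).2 h1)
      _ ≤ _ := by
          rw [← Finset.sum_mul]
          gcongr
          exact ENNReal.sum_le_tsum _
  have key : ∑' n : ℕ, ‖(n : ℂ) * cf b n * cf a (-n)‖ₑ ≤
      weightSum w * (wnorm w a * wnorm w b) := by
    calc _ ≤ ∑' n : ℕ, weightSum w * (wnorm w a * ((w n : ℝ≥0∞) * ‖cf b n‖ₑ)) := by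
          refine ENNReal.tsum_le_tsum fun n => ?_
          have h1 : (w n : ℝ≥0∞) * ‖cf a (-n)‖ₑ ≤ wnorm w a := by
            rw [← hw.neg]
            exact ENNReal.le_tsum (f := fun n : ℤ => (w n : ℝ≥0∞) * ‖cf a n‖ₑ) (-(n : ℤ))
          have h2 : ‖(n : ℂ)‖ₑ = (n : ℝ≥0∞) := by simp [enorm]
          rw [enorm_mul, enorm_mul, h2]
          calc (n : ℝ≥0∞) * ‖cf b n‖ₑ * ‖cf a (-n)‖ₑ
              ≤ weightSum w * ((w n : ℝ≥0∞) * w n) * ‖cf b n‖ₑ * ‖cf a (-n)‖ₑ := by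
                gcongr; exact hwn n
            _ = weightSum w * (((w n : ℝ≥0∞) * ‖cf a (-n)‖ₑ) * ((w n : ℝ≥0∞) * ‖cf b n‖ₑ)) := by
                ring
            _ ≤ _ := by gcongr
      _ ≤ _ := by
          rw [ENNReal.tsum_mul_left, ENNReal.tsum_mul_left]
          gcongr
          exact ENNReal.tsum_comp_le_tsum_of_injective Nat.cast_injective
            fun n : ℤ => (w n : ℝ≥0∞) * ‖cf b n‖ₑ
  refine Summable.of_norm ?_
  have h3 := ne_top_of_le_ne_top (ENNReal.mul_ne_top (weightSum_ne_top hw) (ENNReal.mul_ne_top ha hb)) key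
  simpa only [ENNReal.tsum_coe_ne_top_iff_summable, enorm, ← NNReal.summable_coe, coe_nnnorm] using h3

/-- Exactly `n` pairs `(j, l)` satisfy `j + l + 1 = n`. This turns the trace of `H(b) H(a~)` into
the series of the Szegő constant. -/
lemma hasSum_add_add_one {c : ℕ → ℂ} (h : Summable fun n : ℕ => (n : ℂ) * c n) :
    HasSum (fun x : ℕ × ℕ => c (x.1 + x.2 + 1)) (∑' n : ℕ, (n : ℂ) * c n) := by
  have h1 : Summable fun n : ℕ => ((n + 1 : ℕ) : ℂ) * c (n + 1) := (summable_nat_add_iff 1).2 h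
  have hval : ∀ (n : ℕ) (x : Finset.HasAntidiagonal.antidiagonal n), c (x.1.1 + x.1.2 + 1) = c (n + 1) :=
    fun n x => by rw [Finset.HasAntidiagonal.mem_antidiagonal.1 x.2]
  have hsum : Summable fun x : Σ n : ℕ, Finset.HasAntidiagonal.antidiagonal n =>
      c (x.2.1.1 + x.2.1.2 + 1) := by
    refine Summable.of_norm ((summable_sigma_of_nonneg fun _ => norm_nonneg _).2 ⟨fun n =>
      (hasSum_fintype _).summable, ?_⟩)
    refine h1.norm.congr fun n => ?_
    simp only [hval, tsum_fintype, Finset.sum_const, Finset.card_univ, Fintype.card_coe,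
      Finset.Nat.card_antidiagonal, nsmul_eq_mul, norm_mul, Complex.norm_natCast]
  rw [← Finset.HasAntidiagonal.sigmaAntidiagonalEquivProd.hasSum_iff]
  have h2 := hsum.hasSum
  rw [hsum.tsum_sigma] at h2
  rw [h.tsum_eq_zero_add]
  simp only [hval, tsum_fintype, Finset.sum_const, Finset.card_univ, Fintype.card_coe,
    Finset.Nat.card_antidiagonal, nsmul_eq_mul, Nat.cast_zero, zero_mul, zero_add] at h2 ⊢
  convert h2 using 2 with x
  exact (hval _ _)

lemma tendsto_trace_hankM (hw : IsWeight w) (ha : wnorm w a ≠ ⊤) (hb : wnorm w b ≠ ⊤) :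
    Tendsto (fun N => (hankM b a N).trace) atTop
      (𝓝 (∑' n : ℕ, (n : ℂ) * cf b n * cf a (-n))) := by
  have h := summable_nat_mul_cf_mul_cf hw ha hb
  simp only [mul_assoc] at h ⊢
  have h1 := hasSum_add_add_one (c := fun n : ℕ => cf b n * cf a (-n)) h
  have h2 := h1.summable.hasSum.prod_fiberwise fun j => (h1.summable.prod_factor j).hasSum
  rw [h1.tsum_eq] at h2
  refine h2.tendsto_sum_nat.congr fun N => ?_
  rw [Finset.sum_range, Matrix.trace]
  refine Finset.sum_congr rfl fun j _ => tsum_congr fun l => ?_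
  push_cast
  rfl

lemma tendsto_nat_mul_inv_aux {C₁ C₂ : ℝ} :
    Tendsto (fun n : ℕ => C₁ * (C₂ * ((n : ℝ))⁻¹)) atTop (𝓝 0) := by
  simpa using (tendsto_inv_atTop_nhds_zero_nat.const_mul C₂).const_mul C₁

/-- A perturbation estimate for `(1 + x / n²) ^ (n²) ≈ exp x`. -/
lemma norm_pow_sub_exp_le {C R : ℝ} (hC : 0 ≤ C) (hR : 0 ≤ R) {n : ℕ} (hn : 1 ≤ n)
    (hRn : R ≤ n) {s : ℝ} (hs : s = (n : ℝ)⁻¹) {x z : ℂ} (hz : ‖z‖ ≤ R)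
    (hx : ‖x - 1 - (s : ℂ) ^ 2 * z‖ ≤ C * s ^ 3) :
    ‖x ^ (n * n) - Complex.exp z‖ ≤ Real.exp (R + C) * ((C + R ^ 2) * s) := by
  have hn0 : (0 : ℝ) < n := by exact_mod_cast hn
  have hs0 : 0 ≤ s := by rw [hs]; positivity
  have hs1 : s ≤ 1 := hs ▸ inv_le_one_of_one_le₀ (by exact_mod_cast hn)
  have hns : (n : ℝ) * s = 1 := hs ▸ mul_inv_cancel₀ hn0.ne'
  set u : ℂ := (s : ℂ) ^ 2 * z with hu
  have hun : ‖u‖ ≤ s ^ 2 * R := by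
    rw [hu, norm_mul, norm_pow, Complex.norm_real, Real.norm_of_nonneg hs0]
    gcongr
  have hu1 : ‖u‖ ≤ 1 := by
    refine hun.trans ?_
    calc s ^ 2 * R ≤ s ^ 2 * n := by gcongr
      _ = s * (n * s) := by ring
      _ ≤ 1 := by rw [hns, mul_one]; exact hs1
  have hs3 : s ^ 3 ≤ s ^ 2 := pow_le_pow_of_le_one hs0 hs1 (by norm_num)
  have hs4 : s ^ 4 ≤ s ^ 3 := pow_le_pow_of_le_one hs0 hs1 (by norm_num)
  have hx' : ‖x - 1 - u‖ ≤ C * s ^ 3 := hx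
  have hxr : ‖x‖ ≤ Real.exp (s ^ 2 * (R + C)) := by
    have h1 : x = (x - 1 - u) + u + 1 := by ring
    have h2 : ‖x‖ ≤ ‖x - 1 - u‖ + ‖u‖ + 1 := by
      conv_lhs => rw [h1]
      exact (norm_add_le _ _).trans (by simpa using norm_add_le (x - 1 - u) u)
    have h3 := Real.add_one_le_exp (s ^ 2 * (R + C))
    have h4 : C * s ^ 3 ≤ C * s ^ 2 := by gcongr
    nlinarith
  have hyr : ‖Complex.exp u‖ ≤ Real.exp (s ^ 2 * (R + C)) := by
    rw [Complex.norm_exp]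
    refine Real.exp_le_exp.2 ((Complex.re_le_norm u).trans (hun.trans ?_))
    gcongr; linarith
  have hxy : ‖x - Complex.exp u‖ ≤ (C + R ^ 2) * s ^ 3 := by
    have h1 := Complex.norm_exp_sub_one_sub_id_le hu1
    have h2 : x - Complex.exp u = (x - 1 - u) - (Complex.exp u - 1 - u) := by ring
    rw [h2]
    refine (norm_sub_le _ _).trans ?_
    have h3 : ‖u‖ ^ 2 ≤ R ^ 2 * s ^ 3 := by
      calc ‖u‖ ^ 2 ≤ (s ^ 2 * R) ^ 2 := by gcongr
        _ = R ^ 2 * s ^ 4 := by ring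
        _ ≤ _ := by gcongr
    linarith
  have hexp : Complex.exp z = Complex.exp u ^ (n * n) := by
    rw [← Complex.exp_nat_mul, hu]
    congr 1
    have : ((n : ℂ) * (s : ℂ)) = 1 := by exact_mod_cast hns
    push_cast
    calc z = ((n : ℂ) * s) * (n * s) * z := by rw [this]; ring
      _ = _ := by ring
  rw [hexp]
  refine (norm_pow_sub_pow_le_mul (Real.one_le_exp (by positivity)) hxr hyr _).trans ?_
  rw [← Real.exp_nat_mul]
  have e1 : ((n * n : ℕ) : ℝ) * (s ^ 2 * (R + C)) = R + C := by
    push_cast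
    calc _ = (n * s) * (n * s) * (R + C) := by ring
      _ = _ := by rw [hns]; ring
  rw [e1]
  calc ((n * n : ℕ) : ℝ) * Real.exp (R + C) * ‖x - Complex.exp u‖
      ≤ ((n * n : ℕ) : ℝ) * Real.exp (R + C) * ((C + R ^ 2) * s ^ 3) := by gcongr
    _ = (n * s) * (n * s) * (Real.exp (R + C) * ((C + R ^ 2) * s)) := by push_cast; ring
    _ = _ := by rw [hns]; ring

/-- The strong Szegő limit theorem for symbols `exp a exp b` with `a`, `b` in the strict minus and
plus parts of a weighted Wiener algebra. -/
theorem tendsto_det_toep_cexp (hw : IsWeight w) (ha : IsStrictMinus a) (hb : IsStrictPlus b)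
    (haw : wnorm w a ≠ ⊤) (hbw : wnorm w b ≠ ⊤) :
    Tendsto (fun N => (toep (cexp a * cexp b) N).det) atTop
      (𝓝 (Complex.exp (∑' n : ℕ, (n : ℂ) * cf b n * cf a (-n)))) := by
  have htr := tendsto_trace_hankM hw haw hbw
  obtain ⟨C, hC, hexpand⟩ := exists_norm_det_sub_le hw ha hb haw hbw
  set R := (weightSum w).toReal * ((wnorm w b).toReal * (wnorm w a).toReal)
  have hR : 0 ≤ R := by positivity
  have htrR : ∀ N, ‖(hankM b a N).trace‖ ≤ R := fun N =>
    (norm_trace_le _).trans (entrySum_hankM_le hw hbw haw N)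
  suffices h : Tendsto (fun N => (toep (cexp a * cexp b) N).det -
      Complex.exp (hankM b a N).trace) atTop (𝓝 0) by
    simpa using h.add ((Complex.continuous_exp.tendsto _).comp htr)
  rw [Metric.tendsto_atTop]
  intro δ hδ
  -- The root order `n` is fixed before `N` grows: the small-symbol error is uniform in `N`, whereas
  -- asymptotic multiplicativity is only available for a fixed power.
  obtain ⟨n, hn⟩ : ∃ n : ℕ, 1 ≤ n ∧ R ≤ n ∧ C ≤ n ∧
      Real.exp (R + C) * ((C + R ^ 2) * ((n : ℝ))⁻¹) < δ / 2 := by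
    have h1 := (tendsto_nat_mul_inv_aux (C₁ := Real.exp (R + C)) (C₂ := C + R ^ 2)).eventually_lt_const
      (half_pos hδ)
    have h2 := (tendsto_natCast_atTop_atTop (R := ℝ)).eventually_ge_atTop R
    have h3 := (tendsto_natCast_atTop_atTop (R := ℝ)).eventually_ge_atTop C
    obtain ⟨n, h⟩ := ((eventually_ge_atTop 1).and (h2.and (h3.and h1))).exists
    exact ⟨n, h⟩
  obtain ⟨hn1, hnR, hnC, hnδ⟩ := hn
  have hn0 : (0 : ℝ) < n := by exact_mod_cast hn1
  have hn0' : (n : ℂ) ≠ 0 := by exact_mod_cast hn0.ne'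
  set s : ℝ := (n : ℝ)⁻¹ with hs
  have hs1 : s ≤ 1 := inv_le_one_of_one_le₀ (by exact_mod_cast hn1)
  have hsa : wnorm w ((s : ℂ) • a) ≠ ⊤ := by
    rw [wnorm_smul]; exact ENNReal.mul_ne_top (by simp) haw
  have hsb : wnorm w ((s : ℂ) • b) ≠ ⊤ := by
    rw [wnorm_smul]; exact ENNReal.mul_ne_top (by simp) hbw
  have hpow := tendsto_det_pow hw ((ha.smul s).minusUnit hw hsa) ((hb.smul s).plusUnit hw hsb) n
  have hroot : ∀ f : C(Circle, ℂ), cexp ((s : ℂ) • f) ^ n = cexp f := fun f => by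
    ext z
    simp only [ContinuousMap.pow_apply, cexp_apply, ContinuousMap.smul_apply, smul_eq_mul,
      ← Complex.exp_nat_mul, hs]
    congr 1
    push_cast
    rw [mul_inv_cancel_left₀ hn0']
  simp only [hroot] at hpow
  rw [Metric.tendsto_atTop] at hpow
  obtain ⟨N₀, hN₀⟩ := hpow (δ / 2) (half_pos hδ)
  refine ⟨N₀, fun N hN => ?_⟩
  have h1 := hN₀ N hN
  have h2 := hexpand s (by positivity) hs1 (by
    rw [hs]; exact (mul_inv_le_iff₀ hn0).2 (by rwa [one_mul])) N
  have h3 := norm_pow_sub_exp_le hC hR hn1 hnR hs (htrR N) h2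
  rw [dist_zero_right] at h1 ⊢
  have h4 := norm_add_le ((toep (cexp a * cexp b) N).det -
    (toep (cexp ((s : ℂ) • a) * cexp ((s : ℂ) • b)) N).det ^ (n * n))
    ((toep (cexp ((s : ℂ) • a) * cexp ((s : ℂ) • b)) N).det ^ (n * n) -
      Complex.exp (hankM b a N).trace)
  rw [sub_add_sub_cancel] at h4
  linarith

/-! ### Bordered Toeplitz systems. -/

lemma adjugate_eq_of_mul_eq_one {ι : Type*} [Fintype ι] [DecidableEq ι] {A B : Matrix ι ι ℂ}
    (h : A * B = 1) (hA : A.det = 1) : A.adjugate = B := by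
  calc A.adjugate = A.adjugate * (A * B) := by rw [h, mul_one]
    _ = B := by rw [← mul_assoc, Matrix.adjugate_mul, hA, one_smul, one_mul]

/-- The adjugates of the Toeplitz matrices are uniformly bounded in the maximum norm. -/
lemma exists_norm_adjugate_toep_mulVec_le (hw : IsWeight w) (hm : MinusUnit w m m')
    (hp : PlusUnit w p p') : ∃ C : ℝ, 0 ≤ C ∧ ∀ N (v : Fin N → ℂ) (S : ℝ), 0 ≤ S →
      (∀ k, ‖v k‖ ≤ S) → ∀ i, ‖((toep (m * p) N).adjugate *ᵥ v) i‖ ≤ C * S := by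
  obtain ⟨B, hB0, hB⟩ := exists_entrySum_pert_le hw hm hp
  refine ⟨(wnorm w m').toReal * (((1 + 2 * B) * Real.exp B) * (wnorm w p').toReal), by positivity,
    fun N v S hS hv i => ?_⟩
  rw [toep_eq hw hm hp, Matrix.adjugate_mul_distrib, Matrix.adjugate_mul_distrib,
    adjugate_eq_of_mul_eq_one (hp.toep_mul_inv hw) (hp.plus.det_toep hp.mean),
    adjugate_eq_of_mul_eq_one (hm.toep_mul_inv hw) (hm.minus.det_toep hm.mean),
    ← Matrix.mulVec_mulVec, ← Matrix.mulVec_mulVec, mul_assoc, mul_assoc _ _ S]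
  refine norm_mulVec_le (sum_row_toep_le hw hm.inv_ne_top) (by positivity) (fun j => ?_) i
  refine norm_mulVec_le (sum_norm_adjugate_one_add_le (hB N)) (by positivity) (fun j => ?_) j
  exact norm_mulVec_le (sum_row_toep_le hw hp.inv_ne_top) hS hv j

lemma norm_sum_mul_le {ι : Type*} [Fintype ι] (x y : ι → ℂ) {S : ℝ} (hy : ∀ i, ‖y i‖ ≤ S) :
    ‖∑ i, x i * y i‖ ≤ (∑ i, ‖x i‖) * S := by
  refine (norm_sum_le _ _).trans ?_
  rw [Finset.sum_mul]
  gcongr with i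
  rw [norm_mul]
  gcongr
  exact hy i

lemma tsum_norm_tail_le (hw : IsWeight w) (hm : wnorm w m ≠ ⊤) (N : ℕ) :
    ∑' i : ℕ, ‖cf m (-((i + N : ℕ) : ℤ))‖ ≤ ((w N : ℝ))⁻¹ * (wnorm w m).toReal := by
  have h := tsum_enorm_tail_le hw m N (e := fun i : ℕ => -((i + N : ℕ) : ℤ))
    (fun a b hab => by simpa using hab) fun j => by omega
  have h2 := ENNReal.toReal_mono (ENNReal.mul_ne_top (by simp) hm) h
  rw [ENNReal.tsum_toReal_eq (by simp)] at h2
  simpa using h2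

lemma summable_cf_neg_add (hw : IsWeight w) (hm : wnorm w m ≠ ⊤) (N : ℕ) :
    Summable fun i : ℕ => ‖cf m (-((i + N : ℕ) : ℤ))‖ :=
  ((summable_cf hw hm).comp_injective (i := fun i : ℕ => -((i + N : ℕ) : ℤ))
    fun a b hab => by simpa using hab).norm

lemma sum_norm_tail_conv_le (hw : IsWeight w) {f g : C(Circle, ℂ)} (hf : wnorm w f ≠ ⊤)
    (hg : wnorm w g ≠ ⊤) (N : ℕ) :
    ∑ k : Fin N, ‖∑' i : ℕ, cf f (-((i + N : ℕ) : ℤ)) * cf g (((i + N : ℕ) : ℤ) - (k : ℤ))‖ ≤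
      ((w N : ℝ))⁻¹ * (wnorm w f).toReal * (wnorm w g).toReal := by
  have hs : ∀ k : Fin N, Summable fun i : ℕ =>
      ‖cf f (-((i + N : ℕ) : ℤ))‖ * ‖cf g (((i + N : ℕ) : ℤ) - (k : ℤ))‖ := fun k => by
    refine Summable.of_nonneg_of_le (fun _ => by positivity) (fun i => ?_)
      ((summable_cf_neg_add hw hf N).mul_right ‖g‖)
    gcongr
    exact norm_coeff_le g.norm_coe_le_norm _
  calc _ ≤ ∑ k : Fin N, ∑' i : ℕ,
        ‖cf f (-((i + N : ℕ) : ℤ))‖ * ‖cf g (((i + N : ℕ) : ℤ) - (k : ℤ))‖ := by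
        gcongr with k
        refine (norm_tsum_le_tsum_norm (by simpa only [norm_mul] using hs k)).trans (le_of_eq ?_)
        simp only [norm_mul]
    _ = ∑' i : ℕ, ‖cf f (-((i + N : ℕ) : ℤ))‖ *
        ∑ k : Fin N, ‖cf g (((i + N : ℕ) : ℤ) - (k : ℤ))‖ := by
        rw [← Summable.tsum_finsetSum fun k _ => hs k]
        simp only [Finset.mul_sum]
    _ ≤ ∑' i : ℕ, ‖cf f (-((i + N : ℕ) : ℤ))‖ * (wnorm w g).toReal := by
        have h1 : ∀ i : ℕ, ∑ k : Fin N, ‖cf g (((i + N : ℕ) : ℤ) - (k : ℤ))‖ ≤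
            (wnorm w g).toReal := fun i => sum_norm_cf_le hw hg fun a b hab => by
          simp only [sub_right_inj, Nat.cast_inj, Fin.val_inj] at hab
          exact hab
        have h2 := (summable_cf_neg_add hw hf N).mul_right (wnorm w g).toReal
        refine Summable.tsum_le_tsum (fun i => by gcongr; exact h1 i)
          (Summable.of_nonneg_of_le (fun _ => by positivity) (fun i => ?_) h2) h2
        gcongr
        exact h1 i
    _ ≤ _ := by
        rw [tsum_mul_right]
        gcongr
        exact tsum_norm_tail_le hw hf N

/-- Approximate solution of bordered Toeplitz systems. -/
lemma exists_norm_adjugate_mulVec_sub_le (hw : IsWeight w) (hm : MinusUnit w m m')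
    (hp : PlusUnit w p p') : ∃ C : ℝ, 0 ≤ C ∧ ∀ (N : ℕ) (ψ : ℕ → ℂ) (S : ℝ), (∀ k, ‖ψ k‖ ≤ S) →
      ‖((toep (m * p) (N + 1)).adjugate *ᵥ fun j => ψ j) 0 -
        (toep (m * p) (N + 1)).det * ∑' k : ℕ, cf m' (-k) * ψ k‖ ≤
          C * S * ((w (N + 1 : ℕ) : ℝ))⁻¹ := by
  obtain ⟨C, hC0, hC⟩ := exists_norm_adjugate_toep_mulVec_le hw hm hp
  obtain ⟨D, hD⟩ := exists_norm_det_toep_le hw hm hp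
  have hD0 : 0 ≤ D := (norm_nonneg _).trans (hD 0)
  have hmp : wnorm w (m * p) ≠ ⊤ :=
    ne_top_of_le_ne_top (ENNReal.mul_ne_top hm.ne_top hp.ne_top) (wnorm_mul_le hw hm.ne_top)
  refine ⟨(wnorm w m').toReal * (wnorm w (m * p)).toReal * C + D * (wnorm w m').toReal,
    by positivity, fun N ψ S hψ => ?_⟩
  have hS : 0 ≤ S := (norm_nonneg _).trans (hψ 0)
  set M := N + 1 with hM
  set T := toep (m * p) M with hT
  set v := T.adjugate *ᵥ (fun j : Fin M => ψ j) with hv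
  set ε : Fin M → ℂ := fun k => ∑' i : ℕ, cf m' (-((i + M : ℕ) : ℤ)) *
    cf (m * p) (((i + M : ℕ) : ℤ) - (k : ℤ)) with hε
  have e2 : m' * (m * p) = p := by rw [← mul_assoc, mul_comm m', hm.mul_inv, one_mul]
  -- Row `0` of `T(m') T(mp) = T(p)` is the unit row, as `p` is a plus function with mean `1`.
  -- Cutting the sum over `j` at `M` leaves the tail `ε`.
  have hrow : ∀ k : Fin M, ∑ j : Fin M, cf m' (-(j : ℤ)) * T j k = (if k = 0 then 1 else 0) - ε k := by
    intro k
    have h1 := cf_mul_eq_tsum_add_hank (g := m * p) hw hm.inv_ne_top 0 (k : ℕ)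
    rw [hank_eq_zero_of_isMinus hm.inv_minus, add_zero, e2] at h1
    have hs : Summable fun i : ℕ => cf m' (((0 : ℕ) : ℤ) - i) * cf (m * p) ((i : ℤ) - (k : ℕ)) := by
      refine Summable.of_norm_bounded ((summable_cf_neg_add hw hm.inv_ne_top 0).mul_right ‖m * p‖)
        fun i => ?_
      rw [norm_mul]
      refine mul_le_mul (by simp) (norm_coeff_le (m * p).norm_coe_le_norm _) (norm_nonneg _)
        (norm_nonneg _)
    rw [← hs.sum_add_tsum_nat_add M, Finset.sum_range] at h1
    simp only [Nat.cast_zero, zero_sub] at h1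
    have h2 : cf p (-((k : ℕ) : ℤ)) = if k = 0 then 1 else 0 := by
      split_ifs with h
      · rw [h]; simpa using hp.mean
      · exact hp.plus _ (by have := Fin.pos_iff_ne_zero.2 h; omega)
    rw [← h2, h1]
    simp only [hε, hT, toep_apply]
    ring
  have hTv : T *ᵥ v = fun j : Fin M => T.det * ψ j := by
    rw [hv, Matrix.mulVec_mulVec, Matrix.mul_adjugate, Matrix.smul_mulVec, Matrix.one_mulVec]
    rfl
  -- The approximate left inverse row is paired with `T v = det T · ψ`, with no division by the
  -- determinant.
  have hmain : v 0 - ∑ k, ε k * v k = T.det * ∑ j : Fin M, cf m' (-(j : ℤ)) * ψ j := by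
    calc v 0 - ∑ k, ε k * v k = ∑ k, (∑ j : Fin M, cf m' (-(j : ℤ)) * T j k) * v k := by
          simp only [hrow, sub_mul, Finset.sum_sub_distrib, ite_mul, one_mul, zero_mul,
            Finset.sum_ite_eq', Finset.mem_univ, if_true]
      _ = ∑ j : Fin M, cf m' (-(j : ℤ)) * (T *ᵥ v) j := by
          simp only [Finset.sum_mul]
          rw [Finset.sum_comm]
          simp only [Matrix.mulVec, dotProduct, Finset.mul_sum, mul_assoc]
      _ = _ := by
          rw [hTv, Finset.mul_sum]
          exact Finset.sum_congr rfl fun j _ => by ring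
  have hsψ : ∀ L : ℕ, Summable fun i : ℕ => ‖cf m' (-((i + L : ℕ) : ℤ)) * ψ (i + L)‖ := fun L => by
    refine Summable.of_nonneg_of_le (fun _ => norm_nonneg _) (fun i => ?_)
      ((summable_cf_neg_add hw hm.inv_ne_top L).mul_right S)
    rw [norm_mul]
    gcongr
    exact hψ _
  have htail : ‖∑' i : ℕ, cf m' (-((i + M : ℕ) : ℤ)) * ψ (i + M)‖ ≤
      ((w M : ℝ))⁻¹ * (wnorm w m').toReal * S := by
    refine (norm_tsum_le_tsum_norm (hsψ M)).trans ?_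
    calc _ ≤ ∑' i : ℕ, ‖cf m' (-((i + M : ℕ) : ℤ))‖ * S := by
          refine (hsψ M).tsum_le_tsum (fun i => ?_)
            ((summable_cf_neg_add hw hm.inv_ne_top M).mul_right S)
          rw [norm_mul]
          gcongr
          exact hψ _
      _ ≤ _ := by
          rw [tsum_mul_right]
          gcongr
          exact tsum_norm_tail_le hw hm.inv_ne_top M
  have hsplit : ∑' k : ℕ, cf m' (-k) * ψ k = ∑ j : Fin M, cf m' (-(j : ℤ)) * ψ j +
      ∑' i : ℕ, cf m' (-((i + M : ℕ) : ℤ)) * ψ (i + M) := by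
    have := (hsψ 0).of_norm.sum_add_tsum_nat_add M
    simp only [add_zero] at this
    rw [← this, Finset.sum_range]
  have hfin : v 0 - T.det * ∑' k : ℕ, cf m' (-k) * ψ k =
      ∑ k, ε k * v k - T.det * ∑' i : ℕ, cf m' (-((i + M : ℕ) : ℤ)) * ψ (i + M) := by
    rw [hsplit, mul_add, ← hmain]
    ring
  rw [hfin]
  refine (norm_sub_le _ _).trans ?_
  have b1 := (norm_sum_mul_le ε v (hC M _ S hS fun k => hψ k)).trans
    (mul_le_mul_of_nonneg_right (sum_norm_tail_conv_le hw hm.inv_ne_top hmp M)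
      (mul_nonneg hC0 hS))
  have b2 : ‖T.det * ∑' i : ℕ, cf m' (-((i + M : ℕ) : ℤ)) * ψ (i + M)‖ ≤
      D * (((w M : ℝ))⁻¹ * (wnorm w m').toReal * S) := by
    rw [norm_mul]
    gcongr
    exact hD M
  calc _ ≤ _ := add_le_add b1 b2
    _ = _ := by ring

/-- Consecutive Toeplitz determinants differ by the reciprocal of the weight. -/
lemma exists_norm_det_sub_det_succ_le (hw : IsWeight w) (hm : MinusUnit w m m')
    (hp : PlusUnit w p p') : ∃ C : ℝ, 0 ≤ C ∧ ∀ N : ℕ,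
      ‖(toep (m * p) N).det - (toep (m * p) (N + 1)).det‖ ≤ C * ((w (N + 1 : ℕ) : ℝ))⁻¹ := by
  obtain ⟨C, hC0, hC⟩ := exists_norm_adjugate_mulVec_sub_le hw hm hp
  refine ⟨C, hC0, fun N => ?_⟩
  -- For the first unit vector, the entry of the adjugate is the cofactor at `(0, 0)`, which is the
  -- Toeplitz determinant of size `N`, and the sum reduces to the mean `1` of `m'`.
  have h := hC N (fun k => if k = 0 then 1 else 0) 1 fun k => by split_ifs <;> simp
  have h1 : ((toep (m * p) (N + 1)).adjugate *ᵥ fun j : Fin (N + 1) =>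
      (if (j : ℕ) = 0 then 1 else 0 : ℂ)) 0 = (toep (m * p) N).det := by
    simp only [Matrix.mulVec, dotProduct, Fin.val_eq_zero_iff, mul_ite, mul_one, mul_zero,
      Finset.sum_ite_eq', Finset.mem_univ, if_true]
    rw [Matrix.adjugate_fin_succ_eq_det_submatrix]
    simp only [Fin.val_zero, add_zero, pow_zero, one_mul]
    congr 1
    ext j k
    simp [toep_apply]
  have h2 : ∑' k : ℕ, cf m' (-k) * (if k = 0 then 1 else 0 : ℂ) = 1 := by
    rw [tsum_eq_single 0 fun k hk => by simp [hk]]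
    simpa using hm.inv_mean
  rw [h1, h2, mul_one, mul_one] at h
  exact h

/-! ### Splitting of the logarithm, Wiener–Hopf factors, and the general asymptotics. -/

lemma wnorm_ofCoeff (hw : IsWeight w) {c : ℤ → ℂ} {f : C(Circle, ℂ)} (hf : wnorm w f ≠ ⊤)
    (hc : ∀ n, ‖c n‖ ≤ ‖cf f n‖) :
    (∀ n, cf (ofCoeff c) n = c n) ∧ wnorm w (ofCoeff c) ≠ ⊤ := by
  have h1 : ∀ n, cf (ofCoeff c) n = c n :=
    cf_ofCoeff (Summable.of_norm_bounded (summable_cf hw hf).norm hc)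
  refine ⟨h1, ne_top_of_le_ne_top hf (ENNReal.tsum_le_tsum fun n => ?_)⟩
  rw [h1]
  gcongr
  exact enorm_le_iff_norm_le.2 (hc n)

/-- Splitting of a function into its mean and its strict minus and plus parts. -/
lemma exists_decomposition (hw : IsWeight w) {f : C(Circle, ℂ)} (hf : wnorm w f ≠ ⊤) :
    ∃ a b : C(Circle, ℂ), IsStrictMinus a ∧ IsStrictPlus b ∧ wnorm w a ≠ ⊤ ∧ wnorm w b ≠ ⊤ ∧
      (∀ n < 0, cf a n = cf f n) ∧ (∀ n > 0, cf b n = cf f n) ∧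
      ∀ z, f z = cf f 0 + a z + b z := by
  obtain ⟨ha, haw⟩ := wnorm_ofCoeff (c := fun n => if n < 0 then cf f n else 0) hw hf
    fun n => by split_ifs <;> simp
  obtain ⟨hb, hbw⟩ := wnorm_ofCoeff (c := fun n => if 0 < n then cf f n else 0) hw hf
    fun n => by split_ifs <;> simp
  set a := ofCoeff fun n => if n < 0 then cf f n else 0
  set b := ofCoeff fun n => if 0 < n then cf f n else 0
  refine ⟨a, b, fun n hn => by rw [ha, if_neg (by omega)], fun n hn => by rw [hb, if_neg (by omega)],
    haw, hbw, fun n hn => by rw [ha, if_pos hn], fun n hn => by rw [hb, if_pos hn], fun z => ?_⟩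
  have h := eq_const_of_coeff_eq_zero (f - a - b).continuous (fun n hn => by
    change cf (f - a - b) n = 0
    rw [cf_sub, cf_sub, ha, hb]
    rcases lt_or_gt_of_ne hn with h | h
    · simp [h, h.le]
    · simp [h, h.le]) z
  have h0 : cf (f - a - b) 0 = cf f 0 := by rw [cf_sub, cf_sub, ha, hb]; simp
  rw [← cf_def, h0] at h
  rw [← h]
  simp only [ContinuousMap.sub_apply]
  ring

/-- Reversing rows and columns turns `φ_{k-j}` into `φ_{j-k}` and moves the border to column `0`
with entries `ψ_j`; Cramer's rule does the rest. The power is `N` for size `N + 1` because the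
border column carries no factor `G`. -/
lemma borderedDet_succ {φ ψ : Circle → ℂ} {G : ℂ} {f : C(Circle, ℂ)} (hφ : ∀ z, φ z = G * f z)
    (N : ℕ) : borderedDet φ ψ (N + 1) =
      G ^ N * ((toep f (N + 1)).adjugate *ᵥ fun j => coeff ψ ((j : ℕ) : ℤ)) 0 := by
  have hc : ∀ n, coeff φ n = G * cf f n := fun n => by
    rw [funext hφ]; exact coeff_const_mul G f n
  have h1 : borderedDet φ ψ (N + 1) =
      ((G • toep f (N + 1)).updateCol 0 fun j => coeff ψ ((j : ℕ) : ℤ)).det := by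
    rw [borderedDet, ← Matrix.det_submatrix_equiv_self Fin.revPerm]
    congr 1
    ext j k
    have hj := j.2
    have hk := k.2
    simp only [Matrix.submatrix_apply, Matrix.of_apply, Fin.revPerm_apply, Fin.val_rev,
      Matrix.updateCol_apply, Matrix.smul_apply, toep_apply, smul_eq_mul, hc]
    by_cases h : k = 0
    · subst h
      rw [if_pos (by simp), if_pos rfl]
      congr 1
      omega
    · have : 0 < (k : ℕ) := Fin.pos_iff_ne_zero.2 h
      rw [if_neg (by omega), if_neg h]
      congr 2
      omega
  rw [h1, ← Matrix.cramer_apply, Matrix.cramer_eq_adjugate_mulVec, Matrix.adjugate_smul,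
    Fintype.card_fin, Nat.add_sub_cancel, Matrix.smul_mulVec]
  rfl

lemma exists_norm_coeff_le {ψ : Circle → ℂ} : ∃ S : ℝ, ∀ n, ‖coeff ψ n‖ ≤ S :=
  ⟨_, norm_coeff_le_integral ψ⟩

lemma coeff_minus_mul_zero (hw : IsWeight w) {f : C(Circle, ℂ)} (hfw : wnorm w f ≠ ⊤)
    (hf : IsMinus f) {ψ : Circle → ℂ} (hψ : IntegrableOnCircle ψ) :
    coeff (fun z => f z * ψ z) 0 = ∑' k : ℕ, cf f (-k) * coeff ψ k := by
  have h := hasSum_coeff_mul f.continuous (summable_cf hw hfw) hψ 0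
  have hinj : Function.Injective fun k : ℕ => -(k : ℤ) := fun a b hab => by simpa using hab
  rw [← hinj.hasSum_iff fun n hn => ?_] at h
  · rw [← h.tsum_eq]
    refine tsum_congr fun k => ?_
    simp [cf_def]
  · have : 0 < n := by
      by_contra h'
      exact hn ⟨n.natAbs, by simp only; omega⟩
    rw [← cf_def, hf n this, zero_mul]

/-- A canonical Wiener–Hopf factorization is unique up to a constant. -/
lemma IsCanonicalWienerHopf.eq_const_mul (hw : IsWeight w) {φ φm φp : Circle → ℂ} {G : ℂ}
    (h : IsCanonicalWienerHopf φ φm φp) (hm : MinusUnit w m m') (hp : PlusUnit w p p')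
    (hφ : ∀ z, φ z = G * (m * p) z) :
    ∃ c : ℂ, c ≠ 0 ∧ (∀ z, φp z = c * p z) ∧ ∀ z, (φm z)⁻¹ * G = c * m' z := by
  have hpp : ∀ z, p z * p' z = 1 := fun z => by
    simpa using congrArg (fun f : C(Circle, ℂ) => f z) hp.mul_inv
  have hmm : ∀ z, m z * m' z = 1 := fun z => by
    simpa using congrArg (fun f : C(Circle, ℂ) => f z) hm.mul_inv
  -- The left side has no negative coefficients and the right side no positive ones, so both are
  -- constant, as in Liouville's argument.
  have heq : ∀ z, p' z * φp z = m z * (φm z)⁻¹ * G := fun z => by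
    have h1 := h.factor z
    rw [hφ, ContinuousMap.mul_apply] at h1
    have h2 := h.minus_ne_zero z
    field_simp
    linear_combination (-(p' z)) * h1 + G * m z * hpp z
  have hcont : Continuous fun z => p' z * φp z := p'.continuous.mul h.plus.1
  have hneg : ∀ n < 0, coeff (fun z => p' z * φp z) n = 0 := fun n hn => by
    refine (hasSum_coeff_mul p'.continuous (summable_cf hw hp.inv_ne_top)
      h.plus.1.integrableOnCircle n).unique ?_
    convert hasSum_zero with k
    rcases lt_or_ge k 0 with hk | hk
    · rw [← cf_def, hp.inv_plus k hk, zero_mul]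
    · rw [h.plus.2 (n - k) (by omega), mul_zero]
  have hpos : ∀ n > 0, coeff (fun z => p' z * φp z) n = 0 := fun n hn => by
    have e : (fun z => p' z * φp z) = fun z => G * (m z * (φm z)⁻¹) :=
      funext fun z => by rw [heq]; ring
    rw [e, coeff_const_mul]
    convert mul_zero G
    refine (hasSum_coeff_mul m.continuous (summable_cf hw hm.ne_top)
      h.minus_inv.1.integrableOnCircle n).unique ?_
    convert hasSum_zero with k
    rcases lt_or_ge 0 k with hk | hk
    · rw [← cf_def, hm.minus k hk, zero_mul]
    · rw [h.minus_inv.2 (n - k) (by omega), mul_zero]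
  have hconst := eq_const_of_coeff_eq_zero hcont fun n hn => by
    rcases lt_or_gt_of_ne hn with h | h
    exacts [hneg n h, hpos n h]
  set c := coeff (fun z => p' z * φp z) 0
  have hφp : ∀ z, φp z = c * p z := fun z => by
    rw [← hconst z]
    linear_combination (-φp z) * hpp z
  refine ⟨c, fun h0 => h.plus_ne_zero 1 (by rw [hφp, h0, zero_mul]), hφp, fun z => ?_⟩
  rw [← hconst z, heq z]
  linear_combination (-(φm z)⁻¹ * G) * hmm z

/-- The asymptotics of bordered Toeplitz determinants for symbols whose logarithm is in a weighted
Wiener algebra. The error is controlled by the weight and by the error in the strong Szegő limit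
theorem. -/
theorem exists_asymptotics (hw : IsWeight w) {φ ψ : Circle → ℂ}
    (hlog : IsContinuousLog φ (contLog φ)) (hL : wnorm w ⟨contLog φ, hlog.1⟩ ≠ ⊤)
    (hψ : IntegrableOnCircle ψ) :
    Summable (szegoETerm φ) ∧ (∃ φm φp : Circle → ℂ, IsCanonicalWienerHopf φ φm φp) ∧
    ∃ d : ℕ → ℂ, Tendsto d atTop (𝓝 (szegoE φ)) ∧
      (∃ C : ℝ, 0 ≤ C ∧ ∀ N : ℕ, ‖d N - d (N + 1)‖ ≤ C * ((w (N + 1 : ℕ) : ℝ))⁻¹) ∧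
      ∀ φm φp : Circle → ℂ, IsCanonicalWienerHopf φ φm φp → coeff φp 0 ≠ 0 ∧
        ∃ (C : ℝ) (r : ℕ → ℂ), (∀ N : ℕ, ‖r (N + 1)‖ ≤
          C * (‖d (N + 1) - szegoE φ‖ + ((w (N + 1 : ℕ) : ℝ))⁻¹)) ∧
        ∀ N : ℕ, 1 < N → borderedDet φ ψ N =
          szegoG φ ^ N * szegoE φ * (constF φm φp ψ + r N) := by
  obtain ⟨a, b, ha, hb, haw, hbw, haL, hbL, hsplit⟩ := exists_decomposition hw hL
  have hm := ha.minusUnit hw haw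
  have hp := hb.plusUnit hw hbw
  set m := cexp a
  set m' := cexp (-a)
  set p := cexp b
  set p' := cexp (-b)
  set G := szegoG φ with hG
  have hG0 : G ≠ 0 := Complex.exp_ne_zero _
  have hφ : ∀ z, φ z = G * (m * p) z := fun z => by
    rw [← hlog.2 z]
    have := hsplit z
    simp only [ContinuousMap.coe_mk] at this
    rw [this, Complex.exp_add, Complex.exp_add, mul_assoc]
    rfl
  have hterm : ∀ n : ℕ, szegoETerm φ n = (n : ℂ) * cf b n * cf a (-n) := fun n => by
    rcases Nat.eq_zero_or_pos n with rfl | hn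
    · simp [szegoETerm]
    · rw [hbL n (by omega), haL _ (by omega)]; rfl
  have hE : szegoE φ = Complex.exp (∑' n : ℕ, (n : ℂ) * cf b n * cf a (-n)) := by
    rw [szegoE]; simp only [hterm]
  have hE0 : szegoE φ ≠ 0 := Complex.exp_ne_zero _
  have hmm : ∀ z, m z ≠ 0 := fun z => Complex.exp_ne_zero _
  have hpp : ∀ z, p z ≠ 0 := fun z => Complex.exp_ne_zero _
  have hpinv : ∀ z, (p z)⁻¹ = p' z := fun z => (Complex.exp_neg _).symm
  have hminv : ∀ z, (m z)⁻¹ = m' z := fun z => (Complex.exp_neg _).symm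
  have hlim := tendsto_det_toep_cexp hw ha hb haw hbw
  obtain ⟨C, hC0, hC⟩ := exists_norm_adjugate_mulVec_sub_le hw hm hp
  obtain ⟨S, hS⟩ := exists_norm_coeff_le (ψ := ψ)
  have hS0 : 0 ≤ S := (norm_nonneg _).trans (hS 0)
  refine ⟨?_, ⟨m, fun z => G * p z, ?_⟩, fun N => (toep (m * p) N).det, by rwa [hE],
    exists_norm_det_sub_det_succ_le hw hm hp, fun φm φp hWH => ?_⟩
  · rw [funext hterm]; exact summable_nat_mul_cf_mul_cf hw haw hbw
  · refine ⟨fun z => ?_, fun z => mul_ne_zero hG0 (hpp z), hmm, ⟨by fun_prop, fun n hn => ?_⟩,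
      ⟨?_, fun n hn => ?_⟩, ⟨m.continuous, fun n hn => hm.minus n hn⟩, ⟨?_, fun n hn => ?_⟩⟩
    · rw [hφ, ContinuousMap.mul_apply]; ring
    · rw [coeff_const_mul, ← cf_def, hp.plus n hn, mul_zero]
    · simp only [mul_inv, hpinv]; fun_prop
    · simp only [mul_inv, hpinv]
      rw [coeff_const_mul, ← cf_def, hp.inv_plus n hn, mul_zero]
    · simp only [hminv]; fun_prop
    · simp only [hminv]; exact hm.inv_minus n hn
  · obtain ⟨c, hc, hφp, hφm⟩ := hWH.eq_const_mul hw hm hp hφ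
    have hφp0 : coeff φp 0 = c := by
      rw [funext hφp, coeff_const_mul, ← cf_def, hp.mean, mul_one]
    refine ⟨by rwa [hφp0], ?_⟩
    set F := ∑' k : ℕ, cf m' (-k) * coeff ψ k with hF
    -- The constant `c` enters numerator and denominator alike and cancels.
    have hconstF : constF φm φp ψ = F / G := by
      have e : (fun z => (φm z)⁻¹ * ψ z) = fun z => (c / G) * (m' z * ψ z) := funext fun z => by
        have h9 : (φm z)⁻¹ = c / G * m' z := by
          rw [div_mul_eq_mul_div, ← hφm z, mul_div_cancel_right₀ _ hG0]
        rw [h9, mul_assoc]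
      rw [constF, hφp0, e, coeff_const_mul, coeff_minus_mul_zero hw hm.inv_ne_top hm.inv_minus hψ,
        ← hF]
      field_simp
    refine ⟨(‖F‖ + C * S) / (‖G‖ * ‖szegoE φ‖),
      fun N => borderedDet φ ψ N / (G ^ N * szegoE φ) - constF φm φp ψ, fun N => ?_, fun N hN => ?_⟩
    · have h1 := hC N (fun k => coeff ψ k) S fun k => hS k
      set x := ((toep (m * p) (N + 1)).adjugate *ᵥ fun j => coeff ψ ((j : ℕ) : ℤ)) 0 with hx
      set d := (toep (m * p) (N + 1)).det with hd
      -- The error splits into that of the bordered system and that of the strong Szegő limit.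
      have h2 : borderedDet φ ψ (N + 1) / (G ^ (N + 1) * szegoE φ) - constF φm φp ψ =
          ((x - d * F) + (d - szegoE φ) * F) / (G * szegoE φ) := by
        rw [borderedDet_succ hφ, hconstF, ← hx]
        field_simp
        ring
      beta_reduce
      rw [h2, norm_div, norm_mul, div_mul_eq_mul_div]
      gcongr
      refine (norm_add_le _ _).trans ?_
      rw [norm_mul]
      have h3 : 0 ≤ ((w (N + 1 : ℕ) : ℝ))⁻¹ := by positivity
      have h4 := norm_nonneg (d - szegoE φ)
      have h5 := norm_nonneg F
      have h6 : 0 ≤ C * S := mul_nonneg hC0 hS0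
      calc _ ≤ C * S * ((w (N + 1 : ℕ) : ℝ))⁻¹ + ‖d - szegoE φ‖ * ‖F‖ := by gcongr
        _ ≤ _ := by
          have h7 := mul_nonneg h5 h3
          have h8 := mul_nonneg h6 h4
          linarith
    · rw [add_sub_cancel, mul_div_cancel₀]
      exact mul_ne_zero (pow_ne_zero _ hG0) hE0

end

/-! ### Continuous logarithms, their derivatives, and the two kinds of weights. -/

section

open Topology AddCircle MeasureTheory
open scoped Matrix ENNReal NNReal

lemma exists_exp_eq (z : Circle) : ∃ t ∈ Set.Ico (0 : ℝ) (2 * Real.pi), Circle.exp t = z := by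
  obtain ⟨t, ht, h⟩ := AddCircle.eq_coe_Ico (homeomorphCircle'.symm z)
  exact ⟨t, ht, by rw [← homeomorphCircle'_apply_mk, h, Homeomorph.apply_symm_apply]⟩

lemma continuous_of_continuous_comp_exp {f : Circle → ℂ}
    (h : Continuous fun t : ℝ => f (Circle.exp t)) : Continuous f := by
  have h1 : Continuous fun x : AddCircle (2 * Real.pi) => f (homeomorphCircle' x) :=
    (QuotientAddGroup.isQuotientMap_mk (N := AddSubgroup.zmultiples (2 * Real.pi))).continuous_iff.2 h
  exact (h1.comp homeomorphCircle'.symm.continuous).congr fun z => by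
    rw [Function.comp_apply, Homeomorph.apply_symm_apply]

lemma exists_lift_of_periodic {h : ℝ → ℂ} (hp : Function.Periodic h (2 * Real.pi)) :
    ∃ g : Circle → ℂ, ∀ t, g (Circle.exp t) = h t :=
  ⟨fun z => hp.lift (homeomorphCircle'.symm z), fun t => by
    beta_reduce
    rw [← homeomorphCircle'_apply_mk, Homeomorph.symm_apply_apply]; rfl⟩

/-- A nonvanishing continuous function of winding number zero has a continuous logarithm. -/
lemma isContinuousLog_contLog {φ : Circle → ℂ} (hc : Continuous φ) (h0 : ∀ z, φ z ≠ 0)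
    (hwind : HasWindingNumber φ 0) : IsContinuousLog φ (contLog φ) := by
  suffices h : ∃ L, IsContinuousLog φ L by
    rw [contLog, dif_pos h]; exact h.choose_spec
  obtain ⟨θ, hθ, hφ, hper⟩ := hwind
  set g : ℝ → ℂ := fun t => (Real.log ‖φ (Circle.exp t)‖ : ℂ) + θ t * Complex.I with hg
  have hcont : ContinuousOn g (Set.Icc 0 (2 * Real.pi)) := by
    refine ContinuousOn.add (Continuous.continuousOn ?_) ?_
    · refine Complex.continuous_ofReal.comp (Continuous.log (by fun_prop) fun t => ?_)
      simpa using h0 _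
    · exact (Complex.continuous_ofReal.comp_continuousOn hθ).mul continuousOn_const
  -- Winding number zero is exactly what makes `log |φ| + i θ` close up around the circle.
  have hends : g 0 = g (2 * Real.pi) := by
    have h1 : θ (2 * Real.pi) = θ 0 := by simpa [sub_eq_zero] using hper
    simp only [hg, h1, Circle.exp_two_pi, Circle.exp_zero]
  have hl := AddCircle.liftIco_zero_continuous hends hcont
  refine ⟨fun z => AddCircle.liftIco (2 * Real.pi) 0 g (homeomorphCircle'.symm z),
    hl.comp homeomorphCircle'.symm.continuous, fun z => ?_⟩
  obtain ⟨t, ht, rfl⟩ := exists_exp_eq z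
  have h2 : homeomorphCircle'.symm (Circle.exp t) = (t : AddCircle (2 * Real.pi)) := by
    rw [← homeomorphCircle'_apply_mk, Homeomorph.symm_apply_apply]
  beta_reduce
  rw [h2, AddCircle.liftIco_zero_coe_apply ht]
  simp only [hg]
  rw [Complex.exp_add, hφ t ⟨ht.1, ht.2.le⟩, ← Complex.ofReal_exp, Real.exp_log (by simpa using h0 _)]
  simp

/-- The logarithmic derivative of a continuous logarithm. -/
lemma hasDerivAt_of_exp_eq {ℓ f : ℝ → ℂ} {f' : ℂ} {t : ℝ} (hℓ : Continuous ℓ)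
    (h : ∀ s, Complex.exp (ℓ s) = f s) (hf : HasDerivAt f f' t) : HasDerivAt ℓ (f' / f t) t := by
  have hft : f t ≠ 0 := by rw [← h]; exact Complex.exp_ne_zero _
  have h1 : HasDerivAt (fun s => ℓ t + Complex.log (f s / f t)) (f' / f t) t := by
    have h2 : HasDerivAt (fun s => f s / f t) (f' / f t) t := hf.div_const _
    have h3 := (h2.clog_real (by rw [div_self hft]; simp)).const_add (ℓ t)
    simpa [div_self hft] using h3
  refine h1.congr_of_eventuallyEq ?_
  -- Near `t` the increment of `ℓ` stays in the strip where the principal logarithm inverts the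
  -- exponential, so there `ℓ s = ℓ t + Log (f s / f t)`.
  have h4 : ∀ᶠ s in 𝓝 t, ‖ℓ s - ℓ t‖ < Real.pi :=
    (hℓ.sub continuous_const).norm.continuousAt.eventually_lt_const (by simpa using Real.pi_pos)
  filter_upwards [h4] with s hs
  have h5 := (Complex.abs_im_le_norm (ℓ s - ℓ t)).trans_lt hs
  rw [abs_lt] at h5
  rw [← h s, ← h t, ← Complex.exp_sub, Complex.log_exp h5.1 h5.2.le]
  ring

lemma coeff_eq_intervalIntegral (f : Circle → ℂ) (n : ℤ) :
    coeff f n = (2 * Real.pi : ℂ)⁻¹ *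
      ∫ t in (0 : ℝ)..(2 * Real.pi), Complex.exp (-(n * t * Complex.I)) * f (Circle.exp t) := by
  rw [coeff, fourierCoeff_eq_intervalIntegral _ _ 0, zero_add, Complex.real_smul]
  congr 1
  · simp
  · refine intervalIntegral.integral_congr fun t _ => ?_
    simp only [fourier_coe_apply, smul_eq_mul, toCircle_apply_mk]
    have hpi : (Real.pi : ℂ) ≠ 0 := by exact_mod_cast Real.pi_ne_zero
    congr 2
    · push_cast; field_simp
    · rw [div_self (by positivity), one_mul]

/-- Fourier coefficients of a derivative. -/
lemma coeff_of_hasDerivAt {f g : Circle → ℂ} (hg : Continuous g)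
    (h : ∀ t : ℝ, HasDerivAt (fun s : ℝ => f (Circle.exp s)) (g (Circle.exp t)) t) (n : ℤ) :
    coeff g n = n * Complex.I * coeff f n := by
  have hexp : ∀ t : ℝ, HasDerivAt (fun s : ℝ => Complex.exp (-(n * s * Complex.I)))
      (-(n * Complex.I) * Complex.exp (-(n * t * Complex.I))) t := fun t => by
    have h1 : HasDerivAt (fun s : ℝ => -(n * (s : ℂ) * Complex.I)) (-(n * Complex.I)) t := by
      have h2 := (((Complex.ofRealCLM.hasDerivAt (x := t)).const_mul (n : ℂ)).mul_const
        Complex.I).fun_neg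
      simpa using h2
    simpa [mul_comm] using h1.cexp
  have hfc : Continuous fun t : ℝ => f (Circle.exp t) :=
    continuous_iff_continuousAt.2 fun t => (h t).continuousAt
  have hfi : Continuous fun t : ℝ => Complex.exp (-(n * t * Complex.I)) * f (Circle.exp t) :=
    (by fun_prop : Continuous fun t : ℝ => Complex.exp (-(n * t * Complex.I))).mul hfc
  have hgi : Continuous fun t : ℝ => Complex.exp (-(n * t * Complex.I)) * g (Circle.exp t) := by
    fun_prop
  have key := intervalIntegral.integral_eq_sub_of_hasDerivAt (a := 0) (b := 2 * Real.pi)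
    (fun t _ => (hexp t).fun_mul (h t)) (by
      refine Continuous.intervalIntegrable (Continuous.add ?_ hgi) _ _
      simpa only [mul_assoc] using hfi.const_mul (-(n * Complex.I)))
  have hend : Complex.exp (-(n * ((2 * Real.pi : ℝ) : ℂ) * Complex.I)) = 1 := by
    rw [Complex.exp_eq_one_iff]
    exact ⟨-n, by push_cast; ring⟩
  rw [hend, Circle.exp_two_pi, Circle.exp_zero] at key
  simp only [Complex.ofReal_zero, mul_zero, zero_mul, neg_zero, Complex.exp_zero, sub_self] at key
  have e : ∀ t : ℝ, -(n * Complex.I) * Complex.exp (-(n * t * Complex.I)) * f (Circle.exp t) +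
      Complex.exp (-(n * t * Complex.I)) * g (Circle.exp t) =
      -(n * Complex.I) * (Complex.exp (-(n * t * Complex.I)) * f (Circle.exp t)) +
      Complex.exp (-(n * t * Complex.I)) * g (Circle.exp t) := fun t => by ring
  simp only [e] at key
  rw [intervalIntegral.integral_add ((hfi.const_mul _).intervalIntegrable _ _)
    (hgi.intervalIntegrable _ _), intervalIntegral.integral_const_mul] at key
  rw [coeff_eq_intervalIntegral, coeff_eq_intervalIntegral]
  linear_combination (2 * Real.pi : ℂ)⁻¹ * key

lemma wnorm_ne_top {w : ℤ → ℝ≥0} {f : C(Circle, ℂ)}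
    (h : Summable fun n : ℤ => (w n : ℝ) * ‖cf f n‖) : wnorm w f ≠ ⊤ := by
  have h1 : Summable fun n : ℤ => w n * ‖cf f n‖₊ := by
    rw [← NNReal.summable_coe]; exact h
  have h2 := ENNReal.tsum_coe_ne_top_iff_summable.2 h1
  rw [wnorm]
  convert h2 using 3 with n
  rw [ENNReal.coe_mul]; rfl

/-- Exponential weights. -/
lemma isWeight_pow_natAbs {ρ : ℝ≥0} (hρ : 1 < ρ) : IsWeight fun n : ℤ => ρ ^ n.natAbs where
  zero := by simp
  mono := fun m n h => pow_le_pow_right₀ hρ.le h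
  add_le := fun m n => by
    rw [← pow_add]; exact pow_le_pow_right₀ hρ.le (Int.natAbs_add_le m n)
  summable := by
    have h1 : (ρ⁻¹) ^ 2 < 1 := pow_lt_one₀ (by simp) (inv_lt_one_of_one_lt₀ hρ) two_ne_zero
    refine (NNReal.summable_geometric h1).congr fun l => ?_
    simp [← pow_mul, mul_comm]

/-- Polynomial weights. -/
lemma isWeight_one_add_rpow {α : ℝ} (hα : 1 / 2 < α) :
    IsWeight fun n : ℤ => (1 + (n.natAbs : ℝ≥0)) ^ α := by
  have h0 : 0 ≤ α := by linarith
  refine ⟨?_, fun m n h => ?_, fun m n => ?_, ?_⟩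
  · simp
  · exact NNReal.rpow_le_rpow (by gcongr) h0
  · rw [← NNReal.mul_rpow]
    refine NNReal.rpow_le_rpow ?_ h0
    have h : ((m + n).natAbs : ℝ≥0) ≤ m.natAbs + n.natAbs := by
      exact_mod_cast Int.natAbs_add_le m n
    calc 1 + ((m + n).natAbs : ℝ≥0) ≤ 1 + (m.natAbs + n.natAbs) := by gcongr
      _ ≤ 1 + (m.natAbs + n.natAbs) + m.natAbs * n.natAbs := le_self_add
      _ = (1 + (m.natAbs : ℝ≥0)) * (1 + n.natAbs) := by ring
  · have h1 : Summable fun l : ℕ => (l : ℝ≥0) ^ (-(2 * α)) :=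
      NNReal.summable_rpow.2 (by linarith)
    have h2 : Summable fun l : ℕ => ((l + 1 : ℕ) : ℝ≥0) ^ (-(2 * α)) :=
      NNReal.summable_nat_add (fun l : ℕ => (l : ℝ≥0) ^ (-(2 * α))) h1 1
    have e : ∀ l : ℕ, (((1 + ((l : ℤ).natAbs : ℝ≥0)) ^ α)⁻¹) ^ 2 =
        ((l + 1 : ℕ) : ℝ≥0) ^ (-(2 * α)) := fun l => by
      rw [← NNReal.rpow_neg, ← NNReal.rpow_natCast, ← NNReal.rpow_mul, Int.natAbs_natCast,
        Nat.cast_add, Nat.cast_one, add_comm]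
      congr 1
      push_cast
      ring
    simp only [e]
    exact h2

/-! ### Analytic symbols. -/

lemma circleIntegral_mul_zpow (h : ℂ → ℂ) (n : ℤ) :
    (∮ z in C(0, 1), h z * z ^ (-n - 1)) =
      2 * Real.pi * Complex.I * coeff (fun z : Circle => h z) n := by
  have e : (∮ z in C(0, 1), h z * z ^ (-n - 1)) = Complex.I * ∫ t in (0 : ℝ)..(2 * Real.pi),
      Complex.exp (-(n * t * Complex.I)) * h (Circle.exp t) := by
    rw [circleIntegral, ← intervalIntegral.integral_const_mul]
    refine intervalIntegral.integral_congr fun t _ => ?_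
    simp only [deriv_circleMap, circleMap, Complex.ofReal_one, one_mul, zero_add, Circle.coe_exp,
      smul_eq_mul, ← Complex.exp_int_mul]
    have h1 : Complex.exp (t * Complex.I) * Complex.exp (((-n - 1 : ℤ) : ℂ) * (t * Complex.I)) =
        Complex.exp (-(n * t * Complex.I)) := by
      rw [← Complex.exp_add]; congr 1; push_cast; ring
    rw [← h1]; ring
  have hpi : (Real.pi : ℂ) ≠ 0 := by exact_mod_cast Real.pi_ne_zero
  rw [e, coeff_eq_intervalIntegral]
  field_simp

/-- The coefficient is a contour integral of `h z * z ^ (-n - 1)`, and the contour may be moved to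
radius `r`. A radius above `1` serves `n ≥ 0`, one below `1` serves `n < 0`. -/
lemma norm_coeff_le_of_differentiableAt {h : ℂ → ℂ} {M r : ℝ} (hr : 0 < r)
    (hd : ∀ z : ℂ, ‖z‖ ∈ Set.uIcc 1 r → DifferentiableAt ℂ h z)
    (hM : ∀ z : ℂ, ‖z‖ = r → ‖h z‖ ≤ M) (n : ℤ) :
    ‖coeff (fun z : Circle => h z) n‖ ≤ M * r ^ (-n) := by
  have hd' : ∀ z : ℂ, ‖z‖ ∈ Set.uIcc 1 r →
      DifferentiableAt ℂ (fun z : ℂ => h z * z ^ (-n - 1)) z := fun z hz => by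
    have hz0 : z ≠ 0 := by
      rintro rfl
      rw [norm_zero, Set.mem_uIcc] at hz
      rcases hz with hz | hz <;> linarith [hz.1]
    exact (hd z hz).mul (differentiableAt_zpow.2 (Or.inl hz0))
  have key : (∮ z in C(0, 1), h z * z ^ (-n - 1)) = ∮ z in C(0, r), h z * z ^ (-n - 1) := by
    rcases le_total 1 r with h1 | h1
    · refine (Complex.circleIntegral_eq_of_differentiable_on_annulus_off_countable one_pos h1
        Set.countable_empty (fun z hz => ?_) fun z hz => ?_).symm
      · refine (hd' z ?_).continuousAt.continuousWithinAt
        rw [Set.uIcc_of_le h1]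
        simpa [and_comm] using hz
      · refine hd' z ?_
        rw [Set.uIcc_of_le h1]
        have := hz.1
        simp only [Set.mem_sdiff, Metric.mem_ball, dist_zero_right, Metric.mem_closedBall,
          not_le] at this
        exact ⟨this.2.le, this.1.le⟩
    · refine Complex.circleIntegral_eq_of_differentiable_on_annulus_off_countable hr h1
        Set.countable_empty (fun z hz => ?_) fun z hz => ?_
      · refine (hd' z ?_).continuousAt.continuousWithinAt
        rw [Set.uIcc_of_ge h1]
        simpa [and_comm] using hz
      · refine hd' z ?_
        rw [Set.uIcc_of_ge h1]
        have := hz.1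
        simp only [Set.mem_sdiff, Metric.mem_ball, dist_zero_right, Metric.mem_closedBall,
          not_le] at this
        exact ⟨this.2.le, this.1.le⟩
  have hb : ‖∮ z in C(0, r), h z * z ^ (-n - 1)‖ ≤ 2 * Real.pi * r * (M * r ^ (-n - 1)) := by
    refine circleIntegral.norm_integral_le_of_norm_le_const hr.le fun z hz => ?_
    have hz' : ‖z‖ = r := by simpa using hz
    rw [norm_mul, norm_zpow, hz']
    exact mul_le_mul_of_nonneg_right (hM z hz') (zpow_nonneg hr.le _)
  rw [← key, circleIntegral_mul_zpow, norm_mul] at hb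
  have h2 : ‖(2 * Real.pi * Complex.I : ℂ)‖ = 2 * Real.pi := by
    simp [abs_of_pos Real.pi_pos]
  rw [h2, zpow_sub_one₀ hr.ne'] at hb
  have h3 : 2 * Real.pi * r * (M * (r ^ (-n) * r⁻¹)) = 2 * Real.pi * (M * r ^ (-n)) := by
    field_simp
  rw [h3] at hb
  exact le_of_mul_le_mul_left hb Real.two_pi_pos

/-- Fourier coefficients of functions that are analytic near the circle decay exponentially. -/
lemma exists_norm_coeff_le_of_analyticOnNhd {h : ℂ → ℂ}
    (ha : AnalyticOnNhd ℂ h (Metric.sphere 0 1)) :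
    ∃ R M : ℝ, 1 < R ∧ ∀ n : ℤ, ‖coeff (fun z : Circle => h z) n‖ ≤ M * R⁻¹ ^ n.natAbs := by
  obtain ⟨δ, hδ, hsub⟩ := (isCompact_sphere (0 : ℂ) 1).exists_cthickening_subset_open
    (isOpen_analyticAt ℂ h) ha
  have hR : 1 < 1 + δ := by linarith
  set R := 1 + δ with hRdef
  have hR0 : 0 < R := by linarith
  have hin : ∀ z : ℂ, R⁻¹ ≤ ‖z‖ → ‖z‖ ≤ R → AnalyticAt ℂ h z := fun z h1 h2 => by
    have hz : 0 < ‖z‖ := (inv_pos.2 hR0).trans_le h1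
    refine hsub (Metric.mem_cthickening_of_dist_le z ((‖z‖⁻¹ : ℝ) * z) δ _ ?_ ?_)
    · simp [hz.ne']
    · have e : z - (‖z‖⁻¹ : ℝ) * z = (((‖z‖ - 1) / ‖z‖ : ℝ) : ℂ) * z := by
        have : (‖z‖ : ℂ) ≠ 0 := by exact_mod_cast hz.ne'
        push_cast; field_simp
      rw [dist_eq_norm, e, norm_mul, Complex.norm_real, Real.norm_eq_abs, abs_div, abs_of_pos hz,
        div_mul_cancel₀ _ hz.ne', abs_le]
      constructor
      · have : 1 - δ ≤ R⁻¹ := by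
          rw [← one_div, le_div_iff₀ hR0]
          nlinarith
        linarith
      · linarith
  obtain ⟨M, hM⟩ := ((isCompact_closedBall (0 : ℂ) R).diff
    (Metric.isOpen_ball (x := (0 : ℂ)) (ε := R⁻¹))).exists_bound_of_continuousOn (f := h)
    (fun z hz => (hin z (by simpa using hz.2) (by simpa using hz.1)).continuousAt.continuousWithinAt)
  have hRR : R⁻¹ ≤ 1 := inv_le_one_of_one_le₀ hR.le
  refine ⟨R, M, hR, fun n => ?_⟩
  rcases le_or_gt 0 n with hn | hn
  · have := norm_coeff_le_of_differentiableAt (h := h) (M := M) hR0 (fun z hz => by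
      rw [Set.uIcc_of_le hR.le] at hz
      exact (hin z (hRR.trans hz.1) hz.2).differentiableAt)
      (fun z hz => hM z (by simp [hz]; linarith)) n
    convert this using 2
    rw [zpow_neg, inv_pow, ← zpow_natCast, Int.natAbs_of_nonneg hn]
  · have := norm_coeff_le_of_differentiableAt (h := h) (M := M) (inv_pos.2 hR0) (fun z hz => by
      rw [Set.uIcc_of_ge hRR] at hz
      exact (hin z hz.1 (hz.2.trans hR.le)).differentiableAt)
      (fun z hz => hM z (by simp [hz]; linarith)) n
    convert this using 2
    rw [← zpow_natCast, Int.ofNat_natAbs_of_nonpos hn.le]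

lemma summable_pow_natAbs {q : ℝ} (h0 : 0 ≤ q) (h1 : q < 1) :
    Summable fun n : ℤ => q ^ n.natAbs :=
  Summable.of_nat_of_neg (by simpa using summable_geometric_of_lt_one h0 h1)
    (by simpa using summable_geometric_of_lt_one h0 h1)

lemma circle_coe_mem_sphere (z : Circle) : (z : ℂ) ∈ Metric.sphere (0 : ℂ) 1 :=
  mem_sphere_zero_iff_norm.2 z.norm_coe

lemma HasAnalyticContinuation.continuous {f : Circle → ℂ} (h : HasAnalyticContinuation f) :
    Continuous f := by
  obtain ⟨g, hg, hgf⟩ := h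
  have h1 : Continuous fun z : Circle => g z :=
    hg.continuousOn.comp_continuous continuous_subtype_val circle_coe_mem_sphere
  exact h1.congr hgf

/-- The Fourier coefficients of the logarithm of a symbol of Szegő type decay exponentially. -/
lemma IsSzegoType.exists_norm_coeff_contLog_le {φ : Circle → ℂ} (hφ : IsSzegoType φ)
    (hlog : IsContinuousLog φ (contLog φ)) :
    ∃ R M : ℝ, 1 < R ∧ ∀ n : ℤ, ‖coeff (contLog φ) n‖ ≤ M * R⁻¹ ^ n.natAbs := by
  obtain ⟨g, hg, hgφ⟩ := hφ.analytic
  have hg0 : ∀ z ∈ Metric.sphere (0 : ℂ) 1, g z ≠ 0 := fun z hz => by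
    rw [show g z = φ ⟨z, hz⟩ from hgφ ⟨z, hz⟩]
    exact hφ.ne_zero _
  -- The angular derivative of the logarithm is analytic near the circle, so its coefficients decay
  -- exponentially. They are `i n` times those of the logarithm, which avoids continuing the
  -- logarithm itself.
  set h : ℂ → ℂ := fun z => deriv g z * (z * Complex.I) / g z with hh
  have hh_an : AnalyticOnNhd ℂ h (Metric.sphere 0 1) :=
    (hg.deriv.mul (analyticOnNhd_id.mul analyticOnNhd_const)).div hg hg0
  obtain ⟨R, M, hR, hM⟩ := exists_norm_coeff_le_of_analyticOnNhd hh_an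
  have hcont : Continuous fun z : Circle => h z :=
    hh_an.continuousOn.comp_continuous continuous_subtype_val circle_coe_mem_sphere
  have hder : ∀ t : ℝ, HasDerivAt (fun s : ℝ => contLog φ (Circle.exp s))
      (h (Circle.exp t)) t := fun t => by
    have h1 : HasDerivAt (fun s : ℝ => (Circle.exp s : ℂ)) (Circle.exp t * Complex.I) t := by
      have h0 := hasDerivAt_circleMap 0 1 t
      have e : circleMap 0 1 = fun s : ℝ => (Circle.exp s : ℂ) := by ext s; simp [circleMap]
      rwa [e] at h0
    have h2 : HasDerivAt (fun s : ℝ => φ (Circle.exp s))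
        (deriv g (Circle.exp t) * (Circle.exp t * Complex.I)) t := by
      have := HasDerivAt.comp t (hg _ (circle_coe_mem_sphere (Circle.exp t))).differentiableAt.hasDerivAt h1
      refine this.congr_of_eventuallyEq (Eventually.of_forall fun s => ?_)
      exact (hgφ _).symm
    have h3 := hasDerivAt_of_exp_eq (hlog.1.comp Circle.exp.continuous)
      (fun s => hlog.2 (Circle.exp s)) h2
    simp only [hh, hgφ]
    exact h3
  have hcoeff := coeff_of_hasDerivAt hcont hder
  have hM0 : 0 ≤ M := by simpa using (norm_nonneg _).trans (hM 0)
  refine ⟨R, ‖coeff (contLog φ) 0‖ + M, hR, fun n => ?_⟩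
  rcases eq_or_ne n 0 with rfl | hn
  · simpa using hM0
  · have h1 : (1 : ℝ) ≤ ‖(n : ℂ)‖ := by
      rw [Complex.norm_intCast]; exact_mod_cast Int.one_le_abs hn
    have h2 := hM n
    rw [hcoeff, norm_mul, norm_mul, Complex.norm_I, mul_one] at h2
    calc ‖coeff (contLog φ) n‖ ≤ ‖(n : ℂ)‖ * ‖coeff (contLog φ) n‖ :=
          le_mul_of_one_le_left (norm_nonneg _) h1
      _ ≤ M * R⁻¹ ^ n.natAbs := h2
      _ ≤ _ := by
        gcongr
        exact le_add_of_nonneg_left (norm_nonneg _)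

/-- The asymptotics for symbols of Szegő type. -/
theorem IsSzegoType.asymptotics {φ ψ : Circle → ℂ} (hφ : IsSzegoType φ)
    (hψ : HasAnalyticContinuation ψ) :
    IsContinuousLog φ (contLog φ) ∧ Summable (szegoETerm φ) ∧
      (∃ φm φp : Circle → ℂ, IsCanonicalWienerHopf φ φm φp) ∧
      ∀ φm φp : Circle → ℂ, IsCanonicalWienerHopf φ φm φp →
        coeff φp 0 ≠ 0 ∧
        ∃ c : ℝ, 0 < c ∧ ∃ r : ℕ → ℂ, r =O[atTop] (fun N : ℕ => Real.exp (-c * (N : ℝ))) ∧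
          ∀ N : ℕ, 1 < N →
            borderedDet φ ψ N = szegoG φ ^ N * szegoE φ * (constF φm φp ψ + r N) := by
  have hlog := isContinuousLog_contLog hφ.analytic.continuous hφ.ne_zero hφ.winding
  obtain ⟨R, M, hR, hM⟩ := hφ.exists_norm_coeff_contLog_le hlog
  -- A base strictly below the decay rate `R` makes the weighted coefficient sum a convergent
  -- geometric series; the final decay constant is `log ρ`.
  obtain ⟨ρ', hρ1, hρR⟩ := exists_between hR
  lift ρ' to ℝ≥0 using by linarith with ρ
  have hw : IsWeight fun n : ℤ => ρ ^ n.natAbs := isWeight_pow_natAbs (by exact_mod_cast hρ1)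
  have hR0 : 0 < R := by linarith
  have hρ0 : (0 : ℝ) < ρ := by linarith
  have hL : wnorm (fun n : ℤ => ρ ^ n.natAbs) ⟨contLog φ, hlog.1⟩ ≠ ⊤ := by
    refine wnorm_ne_top ?_
    refine Summable.of_nonneg_of_le (fun n => by positivity) (fun n => ?_)
      ((summable_pow_natAbs (q := ρ * R⁻¹) (by positivity) ?_).mul_left M)
    · rw [mul_pow, NNReal.coe_pow, mul_left_comm]
      exact mul_le_mul_of_nonneg_left (hM n) (by positivity)
    · rw [← div_eq_mul_inv, div_lt_one hR0]; exact hρR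
  obtain ⟨hsum, hex, d, hd, ⟨C, hC, hdC⟩, hall⟩ :=
    exists_asymptotics hw hlog hL hψ.continuous.integrableOnCircle
  refine ⟨hlog, hsum, hex, fun φm φp hWH => ?_⟩
  obtain ⟨hne, C₂, r, hr, hdet⟩ := hall φm φp hWH
  refine ⟨hne, Real.log ρ, Real.log_pos hρ1, r, ?_, hdet⟩
  have hq1 : (ρ : ℝ)⁻¹ < 1 := inv_lt_one_of_one_lt₀ hρ1
  -- Consecutive determinants differ geometrically and their limit is already known, so telescoping
  -- gives the rate.
  have hdist : ∀ N, ‖d N - szegoE φ‖ ≤ C * (ρ : ℝ)⁻¹ ^ N / (1 - (ρ : ℝ)⁻¹) := fun N => by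
    rw [← dist_eq_norm]
    refine dist_le_of_le_geometric_of_tendsto _ _ hq1 (fun n => ?_) hd N
    rw [dist_eq_norm]
    refine (hdC n).trans (mul_le_mul_of_nonneg_left ?_ hC)
    rw [Int.natAbs_natCast, NNReal.coe_pow, ← inv_pow]
    exact pow_le_pow_of_le_one (by positivity) hq1.le (Nat.le_succ n)
  refine IsBigO.of_bound (|C₂| * (C / (1 - (ρ : ℝ)⁻¹) + 1)) ?_
  filter_upwards [eventually_ge_atTop 1] with N hN
  obtain ⟨N, rfl⟩ := Nat.exists_eq_add_of_le' hN
  have e : Real.exp (-Real.log ρ * ((N + 1 : ℕ) : ℝ)) = (ρ : ℝ)⁻¹ ^ (N + 1) := by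
    rw [mul_comm, Real.exp_nat_mul, Real.exp_neg, Real.exp_log hρ0]
  rw [e, Real.norm_of_nonneg (by positivity)]
  have h1 := hr N
  rw [Int.natAbs_natCast, NNReal.coe_pow, ← inv_pow] at h1
  refine h1.trans ?_
  rw [mul_assoc]
  refine mul_le_mul (le_abs_self _) ?_ (by positivity) (abs_nonneg _)
  rw [add_mul, one_mul, div_mul_eq_mul_div]
  exact add_le_add_left (hdist (N + 1)) _

/-! ### Hölder symbols: a Bernstein-type estimate by dyadic rotations. -/

lemma coeff_comp_exp_mul (f : Circle → ℂ) (a : ℝ) (n : ℤ) :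
    coeff (fun z => f (Circle.exp a * z)) n = Complex.exp (Complex.I * (n * a : ℝ)) * coeff f n := by
  have h := integral_add_left_eq_self (μ := haarAddCircle (T := 2 * Real.pi))
    (fun θ : AddCircle (2 * Real.pi) => fourier (-n) θ • f (toCircle θ))
    (a : AddCircle (2 * Real.pi))
  rw [coeff, coeff, fourierCoeff, fourierCoeff, ← h, ← integral_const_mul]
  refine integral_congr_ae (Eventually.of_forall fun θ => ?_)
  have e : (fourier (-n) ((a : AddCircle (2 * Real.pi)) + θ) : ℂ) =
      Complex.exp (-(Complex.I * (n * a : ℝ))) * fourier (-n) θ := by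
    rw [fourier_apply, fourier_apply, smul_add, toCircle_add, Circle.coe_mul, ← fourier_apply,
      fourier_coe_apply]
    have hpi : (Real.pi : ℂ) ≠ 0 := by exact_mod_cast Real.pi_ne_zero
    congr 2
    push_cast
    field_simp
  simp only [smul_eq_mul, e, toCircle_add, toCircle_apply_mk]
  rw [← mul_assoc, ← mul_assoc, ← Complex.exp_add, add_neg_cancel, Complex.exp_zero, one_mul,
    div_self Real.two_pi_pos.ne', one_mul]

/-- Parseval's identity, in the form of an inequality. -/
lemma tsum_norm_sq_cf_le {u : C(Circle, ℂ)} {D : ℝ} (hu : ∀ z, ‖u z‖ ≤ D) :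
    ∑' n : ℤ, ENNReal.ofReal (‖cf u n‖ ^ 2) ≤ ENNReal.ofReal (D ^ 2) := by
  set v : C(AddCircle (2 * Real.pi), ℂ) := ⟨fun θ => u (toCircle θ), by fun_prop⟩ with hv
  have h := hasSum_sq_fourierCoeff (ContinuousMap.toLp (E := ℂ) 2 haarAddCircle ℂ v)
  simp only [fourierCoeff_toLp] at h
  have hc : ∀ n, fourierCoeff v n = cf u n := fun n => rfl
  simp only [hc] at h
  rw [← ENNReal.ofReal_tsum_of_nonneg (fun n => by positivity) h.summable, h.tsum_eq]
  refine ENNReal.ofReal_le_ofReal ?_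
  have h1 : ∫ t, ‖(ContinuousMap.toLp (E := ℂ) 2 haarAddCircle ℂ v) t‖ ^ 2 ∂haarAddCircle =
      ∫ t, ‖v t‖ ^ 2 ∂haarAddCircle (T := 2 * Real.pi) := by
    refine integral_congr_ae ?_
    filter_upwards [ContinuousMap.coeFn_toLp (p := 2) (𝕜 := ℂ) haarAddCircle v] with t ht
    rw [ht]
  rw [h1]
  have h2 : ∫ t, ‖v t‖ ^ 2 ∂haarAddCircle (T := 2 * Real.pi) ≤
      ∫ _, D ^ 2 ∂haarAddCircle (T := 2 * Real.pi) := by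
    refine integral_mono_of_nonneg (Eventually.of_forall fun t => by positivity)
      (integrable_const _) (Eventually.of_forall fun t => ?_)
    exact pow_le_pow_left₀ (norm_nonneg _) (hu _) 2
  simpa using h2

/-- If `2 ^ k ≤ |n| < 2 ^ (k + 1)`, the angle `n π / 2 ^ (k + 1)` has absolute value between `π / 2`
and `π`, far from a full turn; Jordan's inequality bounds the sine from below. -/
lemma one_le_norm_exp_dyadic {n : ℤ} (hn : n ≠ 0) :
    1 ≤ ‖Complex.exp (Complex.I * (n * (Real.pi / 2 ^ (Nat.log 2 n.natAbs + 1)) : ℝ)) - 1‖ := by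
  have hn' : n.natAbs ≠ 0 := Int.natAbs_ne_zero.2 hn
  set k := Nat.log 2 n.natAbs
  have h1 : (2 : ℝ) ^ k ≤ |(n : ℝ)| := by
    rw [← Int.cast_abs, ← Nat.cast_natAbs]
    exact_mod_cast Nat.pow_log_le_self 2 hn'
  have h2 : |(n : ℝ)| ≤ 2 ^ (k + 1) := by
    rw [← Int.cast_abs, ← Nat.cast_natAbs]
    exact_mod_cast (Nat.lt_pow_succ_log_self one_lt_two _).le
  rw [Complex.norm_exp_I_mul_ofReal_sub_one, norm_mul, Real.norm_eq_abs, Real.norm_eq_abs,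
    abs_two]
  have e : |n * (Real.pi / 2 ^ (k + 1)) / 2| = |(n : ℝ)| / 2 ^ (k + 1) * (Real.pi / 2) := by
    rw [abs_div, abs_mul, abs_of_pos (by positivity : 0 < Real.pi / 2 ^ (k + 1)), abs_two]
    ring
  have h3 : |(n : ℝ)| / 2 ^ (k + 1) ≤ 1 := (div_le_one (by positivity)).2 h2
  have h4 : 1 / 2 ≤ |(n : ℝ)| / 2 ^ (k + 1) := by
    rw [le_div_iff₀ (by positivity), pow_succ]; linarith
  have h5 := Real.mul_abs_le_abs_sin (x := n * (Real.pi / 2 ^ (k + 1)) / 2) (by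
    rw [e]; exact mul_le_of_le_one_left (by positivity) h3)
  rw [e] at h5
  have h6 : 2 / Real.pi * (|(n : ℝ)| / 2 ^ (k + 1) * (Real.pi / 2)) = |(n : ℝ)| / 2 ^ (k + 1) := by
    field_simp
  linarith

/-- A quantitative form of Bernstein's theorem: Hölder continuous functions belong to a fractional
Sobolev space. -/
lemma summable_rpow_mul_norm_sq {g : C(Circle, ℂ)} {ε C : ℝ} (hε : 0 < ε)
    (hC : ∀ a ∈ Set.Icc (0 : ℝ) 2, ∀ z, ‖g (Circle.exp a * z) - g z‖ ≤ C * a ^ ε) :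
    Summable fun n : ℤ => |(n : ℝ)| ^ ε * ‖cf g n‖ ^ 2 := by
  set a : ℕ → ℝ := fun k => Real.pi / 2 ^ (k + 1) with ha
  have ha0 : ∀ k, 0 ≤ a k := fun k => by positivity
  have ha2 : ∀ k, a k ≤ 2 := fun k => by
    have : (2 : ℝ) ≤ 2 ^ (k + 1) := by
      rw [pow_succ]; linarith [one_le_pow₀ (one_le_two : (1 : ℝ) ≤ 2) (n := k)]
    rw [ha, div_le_iff₀ (by positivity)]
    linarith [Real.pi_le_four]
  set u : ℕ → C(Circle, ℂ) := fun k => ⟨fun z => g (Circle.exp (a k) * z), by fun_prop⟩ - g with hu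
  have hcf : ∀ k n, cf (u k) n = (Complex.exp (Complex.I * (n * a k : ℝ)) - 1) * cf g n :=
    fun k n => by
      rw [hu, cf_sub, sub_one_mul, cf_def, cf_def, ← coeff_comp_exp_mul]
      rfl
  have hpars : ∀ k, ∑' n : ℤ, ENNReal.ofReal (‖cf (u k) n‖ ^ 2) ≤
      ENNReal.ofReal ((C * a k ^ ε) ^ 2) := fun k =>
    tsum_norm_sq_cf_le fun z => hC (a k) ⟨ha0 k, ha2 k⟩ z
  -- Only the summand `k = log₂ |n|` is needed, where the rotation by `a k` does not shrink the
  -- coefficient. After exchanging the sums, Parseval bounds the `k`-th one by `2 ^ ((k + 1) ε) (C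
  -- a_k ^ ε)²`, of geometric size `2 ^ (-(k + 1) ε)`.
  have hterm : ∀ n : ℤ, ENNReal.ofReal (|(n : ℝ)| ^ ε * ‖cf g n‖ ^ 2) ≤
      ∑' k, ENNReal.ofReal (((2 : ℝ) ^ (k + 1)) ^ ε) * ENNReal.ofReal (‖cf (u k) n‖ ^ 2) := by
    intro n
    rcases eq_or_ne n 0 with rfl | hn
    · simp [Real.zero_rpow hε.ne']
    · refine le_trans ?_ (ENNReal.le_tsum (Nat.log 2 n.natAbs))
      rw [← ENNReal.ofReal_mul (by positivity)]
      refine ENNReal.ofReal_le_ofReal ?_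
      have h1 : |(n : ℝ)| ≤ 2 ^ (Nat.log 2 n.natAbs + 1) := by
        rw [← Int.cast_abs, ← Nat.cast_natAbs]
        exact_mod_cast (Nat.lt_pow_succ_log_self one_lt_two _).le
      have h2 : ‖cf g n‖ ≤ ‖cf (u (Nat.log 2 n.natAbs)) n‖ := by
        rw [hcf, norm_mul]
        exact le_mul_of_one_le_left (norm_nonneg _) (one_le_norm_exp_dyadic hn)
      gcongr
  have hq0 : (0 : ℝ) ≤ 2 ^ (-ε) := by positivity
  have hq1 : (2 : ℝ) ^ (-ε) < 1 := Real.rpow_lt_one_of_one_lt_of_neg one_lt_two (by linarith)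
  have hval : ∀ k, ENNReal.ofReal (((2 : ℝ) ^ (k + 1)) ^ ε) *
      ENNReal.ofReal ((C * a k ^ ε) ^ 2) =
      ENNReal.ofReal ((C * Real.pi ^ ε) ^ 2 * ((2 : ℝ) ^ (-ε)) ^ (k + 1)) := fun k => by
    rw [← ENNReal.ofReal_mul (by positivity)]
    congr 1
    have e1 : a k ^ ε = Real.pi ^ ε * ((2 : ℝ) ^ (-ε)) ^ (k + 1) := by
      rw [ha, Real.div_rpow Real.pi_pos.le (by positivity), div_eq_mul_inv,
        ← Real.rpow_natCast, ← Real.rpow_natCast, ← Real.rpow_mul zero_le_two,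
        ← Real.rpow_mul zero_le_two, ← Real.rpow_neg zero_le_two]
      congr 2
      ring
    have e2 : ((2 : ℝ) ^ (k + 1)) ^ ε * ((2 : ℝ) ^ (-ε)) ^ (k + 1) = 1 := by
      rw [← Real.rpow_natCast, ← Real.rpow_natCast, ← Real.rpow_mul zero_le_two,
        ← Real.rpow_mul zero_le_two, ← Real.rpow_add two_pos]
      convert Real.rpow_zero 2 using 2
      ring
    rw [e1]
    linear_combination (C * Real.pi ^ ε) ^ 2 * ((2 : ℝ) ^ (-ε)) ^ (k + 1) * e2
  have hfin : ∑' n : ℤ, ENNReal.ofReal (|(n : ℝ)| ^ ε * ‖cf g n‖ ^ 2) ≠ ⊤ := by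
    refine ne_top_of_le_ne_top (b := ∑' k : ℕ,
      ENNReal.ofReal ((C * Real.pi ^ ε) ^ 2 * ((2 : ℝ) ^ (-ε)) ^ (k + 1))) ?_ ?_
    · have hs : Summable fun k : ℕ => (C * Real.pi ^ ε) ^ 2 * ((2 : ℝ) ^ (-ε)) ^ (k + 1) :=
        ((summable_nat_add_iff 1).2 (summable_geometric_of_lt_one hq0 hq1)).mul_left _
      exact hs.tsum_ofReal_ne_top
    · refine (ENNReal.tsum_le_tsum hterm).trans ?_
      rw [ENNReal.tsum_comm]
      refine ENNReal.tsum_le_tsum fun k => ?_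
      rw [ENNReal.tsum_mul_left, ← hval]
      exact mul_le_mul_right (hpars k) _
  refine (ENNReal.summable_toReal hfin).congr fun n => ?_
  exact ENNReal.toReal_ofReal (by positivity)

/-- A function whose derivative is Hölder continuous has Fourier coefficients in a weighted `ℓ¹`
space with a polynomial weight of exponent above `1 / 2`. -/
lemma summable_weight_of_coeff_deriv {L g : C(Circle, ℂ)} {ε C : ℝ} (hε : 0 < ε)
    (hL : ∀ n : ℤ, cf g n = n * Complex.I * cf L n)
    (hC : ∀ a ∈ Set.Icc (0 : ℝ) 2, ∀ z, ‖g (Circle.exp a * z) - g z‖ ≤ C * a ^ ε) :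
    Summable fun n : ℤ => (1 + (n.natAbs : ℝ)) ^ (1 / 2 + ε / 4) * ‖cf L n‖ := by
  have h1 := summable_rpow_mul_norm_sq hε hC
  have h2 : Summable fun n : ℤ => |(n : ℝ)| ^ (-(1 + ε / 2)) :=
    Real.summable_abs_int_rpow (by linarith)
  refine Summable.of_norm_bounded_eventually
    (((h1.add h2).mul_left (2 ^ (1 / 2 + ε / 4)))) ?_
  rw [Filter.eventually_cofinite]
  refine (Set.finite_singleton (0 : ℤ)).subset fun n hn => ?_
  by_contra hn0
  refine hn ?_
  have hn1 : (1 : ℝ) ≤ |(n : ℝ)| := by exact_mod_cast Int.one_le_abs hn0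
  have hx : 0 < |(n : ℝ)| := by linarith
  have hna : (n.natAbs : ℝ) = |(n : ℝ)| := by
    rw [← Int.cast_abs, ← Nat.cast_natAbs]
  rw [Real.norm_of_nonneg (by positivity), hna]
  set x := |(n : ℝ)|
  set y := ‖cf g n‖ with hy
  have hLn : ‖cf L n‖ = x⁻¹ * y := by
    rw [hy, hL, norm_mul, norm_mul, Complex.norm_I, mul_one, Complex.norm_intCast,
      inv_mul_cancel_left₀ hx.ne']
  have e1 : (1 + x) ^ (1 / 2 + ε / 4) ≤ 2 ^ (1 / 2 + ε / 4) * x ^ (1 / 2 + ε / 4) := by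
    rw [← Real.mul_rpow zero_le_two hx.le]
    exact Real.rpow_le_rpow (by positivity) (by linarith) (by positivity)
  -- The exponents are balanced for the inequality `u v ≤ u² + v²`: the square of `x ^ (ε / 2) * y`
  -- is summable by the Bernstein-type bound, and the other square is `x ^ (-(1 + ε / 2))`.
  have e2 : x ^ (1 / 2 + ε / 4) * x⁻¹ = x ^ (ε / 2) * x ^ (-(1 / 2 + ε / 4)) := by
    rw [← Real.rpow_neg_one, ← Real.rpow_add hx, ← Real.rpow_add hx]
    congr 1; ring
  have e3 : (x ^ (ε / 2)) ^ 2 = x ^ ε := by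
    rw [← Real.rpow_natCast, ← Real.rpow_mul hx.le]; congr 1; push_cast; ring
  have e4 : (x ^ (-(1 / 2 + ε / 4))) ^ 2 = x ^ (-(1 + ε / 2)) := by
    rw [← Real.rpow_natCast, ← Real.rpow_mul hx.le]; congr 1; push_cast; ring
  calc (1 + x) ^ (1 / 2 + ε / 4) * ‖cf L n‖
      ≤ 2 ^ (1 / 2 + ε / 4) * x ^ (1 / 2 + ε / 4) * ‖cf L n‖ := by gcongr
    _ = 2 ^ (1 / 2 + ε / 4) * ((x ^ (ε / 2) * y) * x ^ (-(1 / 2 + ε / 4))) := by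
        rw [hLn]; linear_combination 2 ^ (1 / 2 + ε / 4) * y * e2
    _ ≤ 2 ^ (1 / 2 + ε / 4) * (x ^ ε * y ^ 2 + x ^ (-(1 + ε / 2))) := by
        rw [← e3, ← e4, ← mul_pow]
        gcongr
        nlinarith [sq_nonneg (x ^ (ε / 2) * y), sq_nonneg (x ^ (-(1 / 2 + ε / 4))),
          sq_nonneg (x ^ (ε / 2) * y - x ^ (-(1 / 2 + ε / 4)))]

/-- Converts a Lipschitz bound into a Hölder bound of exponent `ε` on the range of rotation angles
in use. -/
lemma le_two_mul_rpow {a ε : ℝ} (h0 : 0 ≤ a) (h2 : a ≤ 2) (hε0 : 0 < ε) (hε1 : ε ≤ 1) :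
    a ≤ 2 * a ^ ε := by
  have h1 : a / 2 ≤ (a / 2) ^ ε := by
    rcases h0.eq_or_lt with rfl | h0
    · simp [Real.zero_rpow hε0.ne']
    · simpa using Real.rpow_le_rpow_of_exponent_ge (by positivity) (by linarith) hε1
  have h3 : (a / 2) ^ ε ≤ a ^ ε := Real.rpow_le_rpow (by positivity) (by linarith) hε0.le
  linarith

/-- The derivative of a `C^{1+ε}` function on the circle. -/
lemma IsC1Holder.exists_deriv {ε : ℝ≥0} {φ : Circle → ℂ} (h : IsC1Holder ε φ) :
    ∃ φ₁ : Circle → ℂ, Continuous φ₁ ∧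
      (∀ t : ℝ, HasDerivAt (fun s : ℝ => φ (Circle.exp s)) (φ₁ (Circle.exp t)) t) ∧
      ∃ C : ℝ≥0, ∀ a : ℝ, 0 ≤ a → ∀ z, ‖φ₁ (Circle.exp a * z) - φ₁ z‖ ≤ C * a ^ (ε : ℝ) := by
  obtain ⟨h1, C, hC⟩ := h
  set f : ℝ → ℂ := fun t => φ (Circle.exp t) with hf
  have hp : Function.Periodic (deriv f) (2 * Real.pi) := fun t => by
    have hfp : (fun s => f (s + 2 * Real.pi)) = f := by
      ext s; simp only [hf, Circle.exp_add, Circle.exp_two_pi, mul_one]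
    rw [← deriv_comp_add_const, hfp]
  obtain ⟨φ₁, hφ₁⟩ := exists_lift_of_periodic hp
  refine ⟨φ₁, continuous_of_continuous_comp_exp ?_, fun t => ?_, C, fun a ha z => ?_⟩
  · simp only [hφ₁]
    exact h1.continuous_deriv le_rfl
  · rw [hφ₁]
    exact (h1.differentiable one_ne_zero t).hasDerivAt
  · obtain ⟨t, -, rfl⟩ := exists_exp_eq z
    rw [← Circle.exp_add, hφ₁, hφ₁, ← dist_eq_norm]
    refine (hC.dist_le _ _).trans_eq ?_
    rw [Real.dist_eq, add_sub_cancel_right, abs_of_nonneg ha]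

/-- The logarithm of a nonvanishing `C^{1+ε}` symbol has a Hölder continuous derivative. -/
lemma IsC1Holder.exists_deriv_contLog {ε : ℝ≥0} {φ : Circle → ℂ} (h : IsC1Holder ε φ)
    (hε0 : 0 < ε) (hε1 : ε ≤ 1) (h0 : ∀ z, φ z ≠ 0) (hlog : IsContinuousLog φ (contLog φ)) :
    ∃ g : C(Circle, ℂ),
      (∀ t : ℝ, HasDerivAt (fun s : ℝ => contLog φ (Circle.exp s)) (g (Circle.exp t)) t) ∧
      ∃ C : ℝ, ∀ a ∈ Set.Icc (0 : ℝ) 2, ∀ z,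
        ‖g (Circle.exp a * z) - g z‖ ≤ C * a ^ (ε : ℝ) := by
  obtain ⟨φ₁, hφ₁c, hφ₁, C, hC⟩ := h.exists_deriv
  have hε0' : (0 : ℝ) < ε := by exact_mod_cast hε0
  have hε1' : (ε : ℝ) ≤ 1 := by exact_mod_cast hε1
  have hφc : Continuous φ := continuous_of_continuous_comp_exp h.1.continuous
  obtain ⟨g, hg⟩ : ∃ g : C(Circle, ℂ), ∀ z, g z = φ₁ z / φ z :=
    ⟨⟨_, hφ₁c.div hφc h0⟩, fun _ => rfl⟩
  obtain ⟨B, hB⟩ := isCompact_univ.exists_bound_of_continuousOn hφ₁c.continuousOn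
  obtain ⟨K, hK⟩ := isCompact_univ.exists_bound_of_continuousOn
    (hφc.inv₀ h0).continuousOn
  replace hB : ∀ z, ‖φ₁ z‖ ≤ B := fun z => hB z (Set.mem_univ z)
  replace hK : ∀ z, ‖(φ z)⁻¹‖ ≤ K := fun z => hK z (Set.mem_univ z)
  have hB0 : 0 ≤ B := (norm_nonneg _).trans (hB 1)
  have hK0 : 0 ≤ K := (norm_nonneg _).trans (hK 1)
  have hder : ∀ t : ℝ, HasDerivAt (fun s : ℝ => contLog φ (Circle.exp s)) (g (Circle.exp t)) t :=
    fun t => by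
      rw [hg]
      exact hasDerivAt_of_exp_eq (ℓ := fun s : ℝ => contLog φ (Circle.exp s))
        (f := fun s : ℝ => φ (Circle.exp s)) (hlog.1.comp Circle.exp.continuous)
        (fun s => hlog.2 (Circle.exp s)) (hφ₁ t)
  -- Here `B` bounds the derivative of `φ` and `K` bounds `1 / φ`. The first term is the Hölder
  -- increment of the derivative, the second that of `1 / φ`, which is Lipschitz.
  refine ⟨g, hder, C * K + B * (K * (B * 2) * K), fun a ha z => ?_⟩
  have hlip : ‖φ z - φ (Circle.exp a * z)‖ ≤ B * (2 * a ^ (ε : ℝ)) := by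
    obtain ⟨t, -, rfl⟩ := exists_exp_eq z
    have := Convex.norm_image_sub_le_of_norm_hasDerivWithin_le
      (f := fun s : ℝ => φ (Circle.exp s)) (s := Set.univ) (x := t) (y := a + t)
      (fun s _ => (hφ₁ s).hasDerivWithinAt) (fun s _ => hB _) convex_univ
      (Set.mem_univ _) (Set.mem_univ _)
    rw [norm_sub_rev, ← Circle.exp_add]
    refine this.trans (mul_le_mul_of_nonneg_left ?_ hB0)
    rw [add_sub_cancel_right, Real.norm_of_nonneg ha.1]
    exact le_two_mul_rpow ha.1 ha.2 hε0' hε1'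
  set w := Circle.exp a * z
  have e : g w - g z = (φ₁ w - φ₁ z) * (φ w)⁻¹ +
      φ₁ z * ((φ w)⁻¹ * (φ z - φ w) * (φ z)⁻¹) := by
    have := h0 w
    have := h0 z
    rw [hg, hg]
    field_simp
    ring
  calc ‖g w - g z‖ ≤ ‖φ₁ w - φ₁ z‖ * ‖(φ w)⁻¹‖ +
        ‖φ₁ z‖ * (‖(φ w)⁻¹‖ * ‖φ z - φ w‖ * ‖(φ z)⁻¹‖) := by
        rw [e]
        refine (norm_add_le _ _).trans_eq ?_
        simp only [norm_mul]
    _ ≤ (C * a ^ (ε : ℝ)) * K + B * (K * (B * (2 * a ^ (ε : ℝ))) * K) := by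
        have := ha.1
        gcongr
        · exact hC a ha.1 z
        · exact hK w
        · exact hB z
        · exact hK w
        · exact hK z
    _ = _ := by ring

lemma IsC1Holder.summable_coeff_contLog {ε : ℝ≥0} {φ : Circle → ℂ} (h : IsC1Holder ε φ)
    (hε0 : 0 < ε) (hε1 : ε ≤ 1) (h0 : ∀ z, φ z ≠ 0) (hlog : IsContinuousLog φ (contLog φ)) :
    Summable fun n : ℤ =>
      (1 + (n.natAbs : ℝ)) ^ (1 / 2 + (ε : ℝ) / 4) * ‖cf ⟨contLog φ, hlog.1⟩ n‖ := by
  obtain ⟨g, hg, C, hC⟩ := h.exists_deriv_contLog hε0 hε1 h0 hlog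
  have hcoeff : ∀ n : ℤ, cf g n = n * Complex.I * cf ⟨contLog φ, hlog.1⟩ n :=
    coeff_of_hasDerivAt (f := contLog φ) g.continuous hg
  exact summable_weight_of_coeff_deriv (by exact_mod_cast hε0) hcoeff hC

/-- The asymptotics for symbols in a Hölder class. -/
theorem IsC1Holder.asymptotics {ε : ℝ≥0} {φ ψ : Circle → ℂ} (h : IsC1Holder ε φ)
    (hε0 : 0 < ε) (hε1 : ε ≤ 1) (h0 : ∀ z, φ z ≠ 0) (hwind : HasWindingNumber φ 0)
    (hψ : IsL2 ψ) :
    IsContinuousLog φ (contLog φ) ∧ Summable (szegoETerm φ) ∧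
      (∃ φm φp : Circle → ℂ, IsCanonicalWienerHopf φ φm φp) ∧
      ∀ φm φp : Circle → ℂ, IsCanonicalWienerHopf φ φm φp →
        coeff φp 0 ≠ 0 ∧
        ∃ r : ℕ → ℂ, r =o[atTop] (fun _ : ℕ => (1 : ℝ)) ∧
          ∀ N : ℕ, 1 < N →
            borderedDet φ ψ N = szegoG φ ^ N * szegoE φ * (constF φm φp ψ + r N) := by
  have hlog := isContinuousLog_contLog (continuous_of_continuous_comp_exp h.1.continuous) h0 hwind
  have hε0' : (0 : ℝ) < ε := by exact_mod_cast hε0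
  have hw := isWeight_one_add_rpow (α := 1 / 2 + (ε : ℝ) / 4) (by linarith)
  have hL : wnorm (fun n : ℤ => (1 + (n.natAbs : ℝ≥0)) ^ (1 / 2 + (ε : ℝ) / 4))
      ⟨contLog φ, hlog.1⟩ ≠ ⊤ :=
    wnorm_ne_top (by simpa using h.summable_coeff_contLog hε0 hε1 h0 hlog)
  have hψ' : IntegrableOnCircle ψ := MemLp.integrable one_le_two hψ
  obtain ⟨hsum, hex, d, hd, -, hall⟩ := exists_asymptotics hw hlog hL hψ'
  refine ⟨hlog, hsum, hex, fun φm φp hWH => ?_⟩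
  obtain ⟨hne, C, r, hr, hdet⟩ := hall φm φp hWH
  refine ⟨hne, r, ?_, hdet⟩
  -- The error bound is stated for sizes `N + 1`, hence the shift. No rate for the Szegő limit is
  -- needed here.
  rw [isLittleO_one_iff, ← tendsto_add_atTop_iff_nat 1]
  refine squeeze_zero_norm hr ?_
  have h1 : Tendsto (fun N => ‖d (N + 1) - szegoE φ‖) atTop (𝓝 0) := by
    have := (hd.comp (tendsto_add_atTop_nat 1)).sub_const (szegoE φ)
    simpa [Function.comp_def] using this.norm
  have h2 := (hw.tendsto_inv.comp (tendsto_add_atTop_nat 1))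
  have h3 := (h1.add h2).const_mul C
  rwa [add_zero, mul_zero] at h3

end

end BorderedToeplitz

end

theorem theorem1p2 (φ ψ : Circle → ℂ) :
    -- Analytic symbols: exponentially small error.
    (BorderedToeplitz.IsSzegoType φ → BorderedToeplitz.HasAnalyticContinuation ψ →
      BorderedToeplitz.IsContinuousLog φ (BorderedToeplitz.contLog φ) ∧
      Summable (BorderedToeplitz.szegoETerm φ) ∧
      (∃ φm φp : Circle → ℂ, BorderedToeplitz.IsCanonicalWienerHopf φ φm φp) ∧
      ∀ φm φp : Circle → ℂ, BorderedToeplitz.IsCanonicalWienerHopf φ φm φp →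
        BorderedToeplitz.coeff φp 0 ≠ 0 ∧
        ∃ c : ℝ, 0 < c ∧ ∃ r : ℕ → ℂ,
          r =O[atTop] (fun N : ℕ => Real.exp (-c * (N : ℝ))) ∧
          ∀ N : ℕ, 1 < N →
            BorderedToeplitz.borderedDet φ ψ N =
              BorderedToeplitz.szegoG φ ^ N * BorderedToeplitz.szegoE φ *
                (BorderedToeplitz.constF φm φp ψ + r N)) ∧
    -- Symbols in a Hölder class and square integrable borders: error `o(1)`.
    (∀ ε : NNReal, 0 < ε → ε ≤ 1 → BorderedToeplitz.IsC1Holder ε φ → (∀ z, φ z ≠ 0) →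
      BorderedToeplitz.HasWindingNumber φ 0 → BorderedToeplitz.IsL2 ψ →
      BorderedToeplitz.IsContinuousLog φ (BorderedToeplitz.contLog φ) ∧
      Summable (BorderedToeplitz.szegoETerm φ) ∧
      (∃ φm φp : Circle → ℂ, BorderedToeplitz.IsCanonicalWienerHopf φ φm φp) ∧
      ∀ φm φp : Circle → ℂ, BorderedToeplitz.IsCanonicalWienerHopf φ φm φp →
        BorderedToeplitz.coeff φp 0 ≠ 0 ∧
        ∃ r : ℕ → ℂ,
          r =o[atTop] (fun _ : ℕ => (1 : ℝ)) ∧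
          ∀ N : ℕ, 1 < N →
            BorderedToeplitz.borderedDet φ ψ N =
              BorderedToeplitz.szegoG φ ^ N * BorderedToeplitz.szegoE φ *
                (BorderedToeplitz.constF φm φp ψ + r N)) := by
  exact ⟨fun hφ hψ => hφ.asymptotics hψ,
    fun _ hε0 hε1 h h0 hwind hψ => h.asymptotics hε0 hε1 h0 hwind hψ⟩
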